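/- A binary code of length $60$ is a linear subspace $C\subseteq\mathbb F_2^{60}$; it is a $[60,30,12]$ code if $\dim C=30$ and its minimum Hamming distance is $12$. It is self-dual if $C=C^\perp$ for the Euclidean inner product, and a self-dual binary code is of Type I if it contains a codeword whose weight is not divisible by $4$. A binary code of length $3\ell$ is cubic if it is $\ell$-quasi-cyclic, i.e. invariant under the $\ell$-fold cyclic shift of coordinates. Two codes are equivalent if they differ by a permutation of the coordinates, and the automorphism group of a code is the group of coordinate permutations that map the code onto itself. Let $$\begin{aligned}W_3={}&1+3195y^{12}+29760y^{14}+284625y^{16}+1728000y^{18}+7769400y^{20}+26392320y^{22}+67226760y^{24}\\&+130060800y^{26}+193151475y^{28}+220449152y^{30}+193151475y^{32}+130060800y^{34}+67226760y^{36}\\&+26392320y^{38}+7769400y^{40}+1728000y^{42}+284625y^{44}+29760y^{46}+3195y^{48}+y^{60}.\end{aligned}$$ There exist nine pairwise inequivalent binary cubic (that is, $20$-quasi-cyclic) self-dual $[60,30,12]$ codes of Type I, all with weight enumerator $W_3$, whose automorphism groups have orders $3,6,9,12,18,24,30,48,60$, respectively. Each of them arises from the cubic construction: it equals $$\{(x+a\mid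 x+b\mid x+a+b) : x\in C_1,\ a,b\in\mathbb F_2^{20},\ a+\omega b\in C_2\}$$ for some binary self-dual Type I code $C_1$ of length $20$ and some code $C_2$ of length $20$ over $\mathbb F_4=\mathbb F_2(\omega)$, $\omega^2+\omega+1=0$, that is self-dual for the Hermitian inner product $\sum_j x_jy_j^2$. The six of them with automorphism groups of orders $9,18,24,30,48,60$ are new in the following sense: none of them is equivalent to a code whose automorphism group has order $3$, $6$ or $12$, the orders that occur for the three previously known such codes. -/

import Mathlib

open Polynomial

noncomputable section

/-- Linear codes of length `n` over the field `F`: linear subspaces of `F ^ n`. -/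
abbrev LinearCode (F : Type) [Field F] (n : ℕ) : Type := Submodule F (Fin n → F)

namespace LinearCode

variable {F : Type} [Field F] {n : ℕ}

/-- `C` has dimension `k` and minimum Hamming distance `d`, i.e. `C` is an `[n, k, d]` code. -/
def HasParams [DecidableEq F] (C : LinearCode F n) (k d : ℕ) : Prop :=
  Module.finrank F C = k ∧
    IsLeast {t : ℕ | ∃ u ∈ C, ∃ v ∈ C, u ≠ v ∧ hammingDist u v = t} d

/-- The number `A_i` of codewords of Hamming weight `i`. -/
def weightCount [DecidableEq F] (C : LinearCode F n) (i : ℕ) : ℕ :=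
  {c : Fin n → F | c ∈ C ∧ hammingNorm c = i}.ncard

/-- The Hamming weight enumerator `∑ A_i y ^ i`. -/
def weightEnumerator [DecidableEq F] (C : LinearCode F n) : ℕ[X] :=
  ∑ i ∈ Finset.range (n + 1), Polynomial.C (C.weightCount i) * X ^ i

/-- The dual code for the Euclidean inner product. -/
def dual (C : LinearCode F n) : LinearCode F n where
  carrier := {u | ∀ v ∈ C, ∑ i, u i * v i = 0}
  zero_mem' := by intro v _; simp
  add_mem' := by
    intro a b ha hb v hv
    have h1 := ha v hv
    have h2 := hb v hv
    simp only [Pi.add_apply, add_mul, Finset.sum_add_distrib, h1, h2, add_zero]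
  smul_mem' := by
    intro r a ha v hv
    have h1 := ha v hv
    simp only [Pi.smul_apply, smul_eq_mul, mul_assoc, ← Finset.mul_sum, h1, mul_zero]

/-- Self-duality with respect to the Euclidean inner product. -/
def IsSelfDual (C : LinearCode F n) : Prop := C = C.dual

/-- Binary self-dual codes of Type I (singly-even): some codeword has weight not divisible
by 4. -/
def IsTypeI (C : LinearCode (ZMod 2) n) : Prop :=
  C.IsSelfDual ∧ ∃ c ∈ C, ¬ 4 ∣ hammingNorm c

/-- The cyclic shift `(c_0, c_1, …, c_{n-1}) ↦ (c_{n-1}, c_0, …, c_{n-2})`. -/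
def cyclicShift (c : Fin n → F) : Fin n → F := c ∘ (finRotate n).symm

/-- Quasi-cyclic codes of index `ℓ`, where `ℓ` divides the length: invariance under `ℓ`
cyclic shifts. -/
def IsQuasiCyclic (ℓ : ℕ) (C : LinearCode F n) : Prop :=
  ℓ ∣ n ∧ ∀ c ∈ C, cyclicShift^[ℓ] c ∈ C

/-- Binary cubic codes: binary `ℓ`-quasi-cyclic codes of length `3 ℓ`. -/
def IsCubic {ℓ : ℕ} (C : LinearCode (ZMod 2) (3 * ℓ)) : Prop := C.IsQuasiCyclic ℓ

/-- Equivalence of codes up to a permutation of the coordinates. -/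
def PermEquiv (C D : LinearCode F n) : Prop :=
  ∃ σ : Equiv.Perm (Fin n), ∀ c : Fin n → F, c ∈ C ↔ c ∘ σ ∈ D

/-- The (permutation) automorphism group of a code: all coordinate permutations that map
the code onto itself. -/
def autGroup (C : LinearCode F n) : Subgroup (Equiv.Perm (Fin n)) where
  carrier := {σ | ∀ c : Fin n → F, c ∈ C ↔ c ∘ σ ∈ C}
  one_mem' := by intro c; rfl
  mul_mem' := by
    intro σ τ hσ hτ c
    rw [hσ c, hτ (c ∘ σ)]
    rfl
  inv_mem' := by
    intro σ hσ c
    rw [hσ (c ∘ ⇑σ⁻¹), Function.comp_assoc, ← Equiv.Perm.coe_mul, inv_mul_cancel]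
    rfl

/-- The field with four elements. -/
abbrev F4 : Type := GaloisField 2 2

/-- The dual of a quaternary code for the Hermitian inner product `∑ x_j * conj y_j`, where
conjugation on the field with four elements is `y ↦ y ^ 2`. -/
def hermitianDual (C : LinearCode F4 n) : LinearCode F4 n where
  carrier := {u | ∀ v ∈ C, ∑ i, u i * v i ^ 2 = 0}
  zero_mem' := by intro v _; simp
  add_mem' := by
    intro a b ha hb v hv
    have h1 := ha v hv
    have h2 := hb v hv
    simp only [Pi.add_apply, add_mul, Finset.sum_add_distrib, h1, h2, add_zero]
  smul_mem' := by
    intro r a ha v hv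
    have h1 := ha v hv
    simp only [Pi.smul_apply, smul_eq_mul, mul_assoc, ← Finset.mul_sum, h1, mul_zero]

/-- Self-duality of a quaternary code with respect to the Hermitian inner product. -/
def IsHermitianSelfDual (C : LinearCode F4 n) : Prop := C = C.hermitianDual

/-- The concatenation `(u | v | w)` of three words of length `ℓ`; coordinate `j` of the
`i`-th block has index `i * ℓ + j`. -/
def concat3 {ℓ : ℕ} (u v w : Fin ℓ → ZMod 2) : Fin (3 * ℓ) → ZMod 2 :=
  fun k => ![u, v, w] (finProdFinEquiv.symm k).1 (finProdFinEquiv.symm k).2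

/-- The cubic construction: all words `(x + a | x + b | x + a + b)` with `x ∈ C₁` and
`a + ω b ∈ C₂`. -/
def cubicConstruction {ℓ : ℕ} (ω : F4) (C₁ : LinearCode (ZMod 2) ℓ) (C₂ : LinearCode F4 ℓ) :
    Set (Fin (3 * ℓ) → ZMod 2) :=
  {c | ∃ x ∈ C₁, ∃ a b : Fin ℓ → ZMod 2,
    (fun j => algebraMap (ZMod 2) F4 (a j) + ω * algebraMap (ZMod 2) F4 (b j)) ∈ C₂ ∧
    c = concat3 (x + a) (x + b) (x + a + b)}

end LinearCode

/-- The weight enumerator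
`W₃ = 1 + 3195 y ^ 12 + 29760 y ^ 14 + 284625 y ^ 16 + …`, written out in full. -/
def W₃ : ℕ[X] :=
  1 + 3195 * X ^ 12 + 29760 * X ^ 14 + 284625 * X ^ 16 + 1728000 * X ^ 18
    + 7769400 * X ^ 20 + 26392320 * X ^ 22 + 67226760 * X ^ 24 + 130060800 * X ^ 26
    + 193151475 * X ^ 28 + 220449152 * X ^ 30 + 193151475 * X ^ 32 + 130060800 * X ^ 34
    + 67226760 * X ^ 36 + 26392320 * X ^ 38 + 7769400 * X ^ 40 + 1728000 * X ^ 42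
    + 284625 * X ^ 44 + 29760 * X ^ 46 + 3195 * X ^ 48 + X ^ 60

end

/-!
All nine codes have a coordinate set divided into ten blocks of six coordinates such that a codeword
of weight `w` meets every block in `w / 2` coordinates modulo two; in other words, the shadow of the
code contains the ten blocks as words of weight six (`LinearCode.IsBlockCode`).

*Weight enumerator.* Let `E` be the even part of such a code `C`, consisting of the codewords of
weight divisible by four. The nonzero words of weight less than ten in the dual of `E` are the ten
blocks, because for any other word `d` of the shadow the ten words `d + B` are codewords of weight at least
twelve. The MacWilliams identities for `E` and `C` then determine all weights
(`LinearCode.IsBlockCode.weightEnumerator_eq`).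

*Minimum distance.* For the codewords of weight divisible by four it has to be shown that they are
constant on all blocks or non-constant on at least five of them. Since a word with at most four non-constant blocks has at most
two of them among the first or among the last five blocks, it suffices to look at sums of generators
belonging to two blocks, where the generators are systematic with respect to either half. All other
codewords have weight at least ten, and weight ten means meeting every block in one coordinate,
which a search over the blocks of one half excludes (`LinearCode.BlockData.Valid.isBlockCode`).

*Automorphism group.* The automorphisms permute the words of weight ten in the dual of `E` which
meet all blocks evenly, hence they preserve the two-point invariant `LinearCode.profile` computed
from the overlaps of these words. In every code there is a coordinate `b` for which `profile b` is
injective, so that the stabilizer of `b` is trivial, and whose orbit is separated from the others by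
the diagonal values `profile x x`. Therefore the order of the group is the length of the orbit of `b`
under explicitly given automorphisms (`LinearCode.Certificate.card_autGroup`).

*Cubic structure.* One of the automorphisms has only cycles of length three, and renumbering the
coordinates turns it into the `20`-fold cyclic shift. A self-dual code of Type I invariant under this
shift arises from the cubic construction (`LinearCode.IsTypeI.exists_cubicConstruction`).

Equivalent codes have conjugate automorphism groups, so that codes with automorphism groups of
different orders are inequivalent.
-/

namespace LinearCode

/-! ### Weights and inner products of binary words -/

theorem mem_dual_iff {F : Type} [Field F] {n : ℕ} {C : LinearCode F n} {u : Fin n → F} :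
    u ∈ C.dual ↔ ∀ v ∈ C, ∑ i, u i * v i = 0 := Iff.rfl

section Binary

variable {n : ℕ}

theorem hammingNorm_eq_sum_val (c : Fin n → ZMod 2) : hammingNorm c = ∑ i, (c i).val := by
  have h : ∀ a : ZMod 2, a.val = if a ≠ 0 then 1 else 0 := by decide
  simp only [h, hammingNorm, Finset.card_filter]

/-- Inclusion–exclusion for the supports of two binary words. -/
theorem hammingNorm_add_two_mul (c d : Fin n → ZMod 2) :
    hammingNorm (c + d) + 2 * ∑ i, (c i).val * (d i).val = hammingNorm c + hammingNorm d := by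
  have h : ∀ a b : ZMod 2, (a + b).val + 2 * (a.val * b.val) = a.val + b.val := by decide
  simp only [hammingNorm_eq_sum_val, Finset.mul_sum, ← Finset.sum_add_distrib, Pi.add_apply, h]

theorem cast_sum_val_mul (c d : Fin n → ZMod 2) :
    ((∑ i, (c i).val * (d i).val : ℕ) : ZMod 2) = ∑ i, c i * d i := by
  push_cast
  simp

theorem cast_hammingNorm (c : Fin n → ZMod 2) : ((hammingNorm c : ℕ) : ZMod 2) = ∑ i, c i := by
  rw [hammingNorm_eq_sum_val]
  push_cast
  simp

/-- The weight is additive modulo four on orthogonal words. -/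
theorem hammingNorm_add_mod_four {c d : Fin n → ZMod 2} (h : ∑ i, c i * d i = 0) :
    hammingNorm (c + d) % 4 = (hammingNorm c + hammingNorm d) % 4 := by
  have h1 := hammingNorm_add_two_mul c d
  rw [← cast_sum_val_mul, ZMod.natCast_eq_zero_iff] at h
  omega

theorem IsSelfDual.sum_mul_eq_zero {F : Type} [Field F] {C : LinearCode F n} (h : C.IsSelfDual)
    {c d : Fin n → F} (hc : c ∈ C) (hd : d ∈ C) : ∑ i, c i * d i = 0 := by
  have h1 : c ∈ C.dual := by
    rw [← h]
    exact hc
  exact h1 d hd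

theorem IsSelfDual.mem_of_forall {F : Type} [Field F] {C : LinearCode F n} (h : C.IsSelfDual)
    {c : Fin n → F} (hc : ∀ d ∈ C, ∑ i, c i * d i = 0) : c ∈ C := by
  rw [h]
  exact hc

theorem IsSelfDual.even_hammingNorm {C : LinearCode (ZMod 2) n} (h : C.IsSelfDual)
    {c : Fin n → ZMod 2} (hc : c ∈ C) : 2 ∣ hammingNorm c := by
  rw [← ZMod.natCast_eq_zero_iff, cast_hammingNorm]
  have h1 : ∀ a : ZMod 2, a * a = a := by decide
  simpa only [h1] using h.sum_mul_eq_zero hc hc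

/-! ### Permuting the coordinates of a code -/

theorem hammingNorm_comp_perm (c : Fin n → ZMod 2) (σ : Equiv.Perm (Fin n)) :
    hammingNorm (c ∘ σ) = hammingNorm c := by
  simp only [hammingNorm_eq_sum_val, Function.comp_apply]
  exact Equiv.sum_comp σ fun i => (c i).val

theorem sum_mul_comp_perm {F : Type} [Field F] (c d : Fin n → F) (σ : Equiv.Perm (Fin n)) :
    ∑ i, (c ∘ σ) i * (d ∘ σ) i = ∑ i, c i * d i :=
  Equiv.sum_comp σ fun i => c i * d i

/-- The code of all words `c` with `c ∘ σ ∈ C`. -/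
def permute {F : Type} [Field F] (σ : Equiv.Perm (Fin n)) (C : LinearCode F n) : LinearCode F n :=
  C.comap (LinearMap.funLeft F F σ)

theorem mem_permute {F : Type} [Field F] {σ : Equiv.Perm (Fin n)} {C : LinearCode F n}
    {c : Fin n → F} : c ∈ C.permute σ ↔ c ∘ σ ∈ C := Iff.rfl

theorem IsSelfDual.permute {F : Type} [Field F] {C : LinearCode F n} (h : C.IsSelfDual)
    (σ : Equiv.Perm (Fin n)) : (C.permute σ).IsSelfDual := by
  ext c
  rw [mem_dual_iff, mem_permute]
  constructor
  · intro hc d hd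
    rw [← sum_mul_comp_perm c d σ]
    exact h.sum_mul_eq_zero hc hd
  · intro hc
    refine h.mem_of_forall fun d hd => ?_
    have h1 := hc (d ∘ σ.symm) (by
      rw [mem_permute, Function.comp_assoc, Equiv.symm_comp_self]
      exact hd)
    rw [← sum_mul_comp_perm _ _ σ, Function.comp_assoc, Equiv.symm_comp_self] at h1
    exact h1

theorem IsTypeI.permute {C : LinearCode (ZMod 2) n} (h : C.IsTypeI) (σ : Equiv.Perm (Fin n)) :
    (C.permute σ).IsTypeI := by
  obtain ⟨h1, c, hc, hw⟩ := h
  refine ⟨h1.permute σ, c ∘ σ.symm, ?_, ?_⟩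
  · rw [mem_permute, Function.comp_assoc, Equiv.symm_comp_self]
    exact hc
  · rw [hammingNorm_comp_perm]
    exact hw

theorem weightCount_permute (C : LinearCode (ZMod 2) n) (σ : Equiv.Perm (Fin n)) (i : ℕ) :
    (C.permute σ).weightCount i = C.weightCount i := by
  refine Set.ncard_congr (fun c _ => c ∘ σ) ?_ ?_ ?_
  · rintro c ⟨hc, hi⟩
    exact ⟨hc, by rw [hammingNorm_comp_perm, hi]⟩
  · intro a b _ _ hab
    exact σ.surjective.injective_comp_right hab
  · rintro c ⟨hc, hi⟩
    have h1 : (c ∘ σ.symm) ∘ σ = c := by rw [Function.comp_assoc, Equiv.symm_comp_self]; rfl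
    exact ⟨c ∘ σ.symm, ⟨by rw [mem_permute, h1]; exact hc, by rw [hammingNorm_comp_perm, hi]⟩, h1⟩

/-- Equivalent codes have conjugate automorphism groups. -/
theorem PermEquiv.card_autGroup {F : Type} [Field F] {C D : LinearCode F n} (h : C.PermEquiv D) :
    Nat.card C.autGroup = Nat.card D.autGroup := by
  obtain ⟨σ, hσ⟩ := h
  refine Nat.card_congr ((MulAut.conj σ⁻¹).toEquiv.subtypeEquiv fun τ => ?_)
  have key : ∀ c : Fin n → F, (c ∘ ⇑σ⁻¹) ∘ σ = c := fun c => by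
    ext x
    simp
  constructor
  · intro hτ c
    rw [← key c, ← hσ, hτ, hσ]
    refine iff_of_eq (congrArg (· ∈ D) ?_)
    ext x
    simp
  · intro hτ c
    rw [hσ, hτ, hσ]
    refine iff_of_eq (congrArg (· ∈ D) ?_)
    ext x
    simp

theorem permEquiv_permute {F : Type} [Field F] (C : LinearCode F n) (σ : Equiv.Perm (Fin n)) :
    (C.permute σ).PermEquiv C := ⟨σ, fun _ => Iff.rfl⟩

end Binary

/-- A binary linear code is determined in its parameters by its size and its weights. -/
theorem hasParams_of_weight {n k d : ℕ} {C : LinearCode (ZMod 2) n}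
    (hk : Module.finrank (ZMod 2) C = k) (h1 : ∃ c ∈ C, hammingNorm c = d) (hd : d ≠ 0)
    (h2 : ∀ c ∈ C, c ≠ 0 → d ≤ hammingNorm c) : C.HasParams k d := by
  refine ⟨hk, ?_, ?_⟩
  · obtain ⟨c, hc, hcd⟩ := h1
    refine ⟨c, hc, 0, C.zero_mem, ?_, by rw [hammingDist_zero_right, hcd]⟩
    rintro rfl
    simp at hcd
    exact hd hcd.symm
  · rintro t ⟨u, hu, v, hv, huv, rfl⟩
    rw [hammingDist_eq_hammingNorm]
    exact h2 _ (C.add_mem (C.neg_mem hu) hv) (by rwa [ne_eq, neg_add_eq_zero])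

/-! ### The cubic construction -/

theorem add_self_binary {n : ℕ} (x : Fin n → ZMod 2) : x + x = 0 := by
  ext j
  exact CharTwo.add_self_eq_zero _

/-- The permutation of the coordinates induced by the `20`-fold cyclic shift. -/
def blockShift (p : Fin (3 * 20)) : Fin (3 * 20) := ⟨(p.val + 40) % 60, Nat.mod_lt _ (by norm_num)⟩

theorem iterate_cyclicShift (c : Fin (3 * 20) → ZMod 2) :
    cyclicShift^[20] c = c ∘ blockShift := by
  have h1 : ∀ k, cyclicShift^[k] c = c ∘ (finRotate (3 * 20)).symm^[k] := by
    intro k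
    induction k with
    | zero => rfl
    | succ k ih =>
      rw [Function.iterate_succ_apply', ih, Function.iterate_succ]
      rfl
  rw [h1]
  have h2 : ∀ p : Fin (3 * 20), ((finRotate (3 * 20)).symm p).val = (p.val + 59) % 60 := by
    intro p
    obtain ⟨q, rfl⟩ := (finRotate (3 * 20)).surjective p
    rw [Equiv.symm_apply_apply]
    have h3 : finRotate (59 + 1) q = q + 1 := finRotate_apply q
    have h4 : (finRotate (3 * 20) q).val = (q.val + 1) % 60 := by
      change (finRotate (59 + 1) q).val = _
      rw [h3, Fin.val_add]
      rfl
    have := q.isLt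
    omega
  have h3 : ∀ (k : ℕ) (p : Fin (3 * 20)),
      ((finRotate (3 * 20)).symm^[k] p).val = (p.val + 59 * k) % 60 := by
    intro k
    induction k with
    | zero =>
      intro p
      have := p.isLt
      simp only [Function.iterate_zero, id]
      omega
    | succ k ih =>
      intro p
      rw [Function.iterate_succ_apply', h2, ih]
      omega
  ext p
  have h4 : (finRotate (3 * 20)).symm^[20] p = blockShift p := by
    apply Fin.ext
    rw [h3]
    simp only [blockShift]
    omega
  rw [Function.comp_apply, h4, Function.comp_apply]

theorem concat3_comp_blockShift (u v w : Fin 20 → ZMod 2) :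
    concat3 u v w ∘ blockShift = concat3 w u v := by
  ext p
  obtain ⟨⟨i, j⟩, rfl⟩ := finProdFinEquiv.surjective p
  have h : blockShift (finProdFinEquiv (i, j)) = finProdFinEquiv (i + 2, j) := by
    apply Fin.ext
    have := j.isLt
    fin_cases i <;> simp [blockShift, finProdFinEquiv] <;> omega
  simp only [Function.comp_apply, concat3, h, Equiv.symm_apply_apply]
  fin_cases i <;> rfl

theorem sum_concat3_mul (u v w u' v' w' : Fin 20 → ZMod 2) :
    ∑ p, concat3 u v w p * concat3 u' v' w' p =
      ∑ j, u j * u' j + ∑ j, v j * v' j + ∑ j, w j * w' j := by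
  rw [← Equiv.sum_comp finProdFinEquiv, Fintype.sum_prod_type]
  simp [concat3, Fin.sum_univ_three]

theorem concat3_add (u v w u' v' w' : Fin 20 → ZMod 2) :
    concat3 (u + u') (v + v') (w + w') = concat3 u v w + concat3 u' v' w' := by
  ext p
  obtain ⟨⟨i, j⟩, rfl⟩ := finProdFinEquiv.surjective p
  simp only [concat3, Pi.add_apply, Equiv.symm_apply_apply]
  fin_cases i <;> rfl

theorem exists_concat3 (c : Fin (3 * 20) → ZMod 2) : ∃ u v w, c = concat3 u v w := by
  refine ⟨fun j => c (finProdFinEquiv (0, j)), fun j => c (finProdFinEquiv (1, j)),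
    fun j => c (finProdFinEquiv (2, j)), ?_⟩
  ext p
  obtain ⟨⟨i, j⟩, rfl⟩ := finProdFinEquiv.surjective p
  simp only [concat3, Equiv.symm_apply_apply]
  fin_cases i <;> rfl

theorem hammingNorm_concat3 (u v w : Fin 20 → ZMod 2) :
    hammingNorm (concat3 u v w) = hammingNorm u + hammingNorm v + hammingNorm w := by
  simp only [hammingNorm_eq_sum_val]
  rw [← Equiv.sum_comp finProdFinEquiv, Fintype.sum_prod_type]
  simp [concat3, Fin.sum_univ_three]

/-- The words `x` with `(x | x | x) ∈ C`. -/
def diagonalPart (C : LinearCode (ZMod 2) (3 * 20)) : LinearCode (ZMod 2) 20 where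
  carrier := {x | concat3 x x x ∈ C}
  zero_mem' := by
    have h : concat3 (0 : Fin 20 → ZMod 2) 0 0 = 0 := by
      have := concat3_add (0 : Fin 20 → ZMod 2) 0 0 0 0 0
      simpa using this
    simp only [Set.mem_ofPred_eq, h, C.zero_mem]
  add_mem' := by
    intro a b ha hb
    simp only [Set.mem_ofPred_eq, concat3_add]
    exact C.add_mem ha hb
  smul_mem' := by
    intro r a ha
    have h : r = 0 ∨ r = 1 := by
      revert r
      decide
    rcases h with rfl | rfl
    · have h : concat3 (0 : Fin 20 → ZMod 2) 0 0 = 0 := by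
        have := concat3_add (0 : Fin 20 → ZMod 2) 0 0 0 0 0
        simpa using this
      simp only [Set.mem_ofPred_eq, zero_smul, h, C.zero_mem]
    · simpa using ha

/-- The word `a + ω b` over the field with four elements. -/
noncomputable def quaternary (ω : F4) (a b : Fin 20 → ZMod 2) : Fin 20 → F4 :=
  fun j => algebraMap (ZMod 2) F4 (a j) + ω * algebraMap (ZMod 2) F4 (b j)

theorem card_F4 : Nat.card F4 = 4 := by
  rw [GaloisField.card 2 2 two_ne_zero]
  norm_num

theorem exists_primitive_root : ∃ ω : F4, ω ^ 2 + ω + 1 = 0 := by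
  classical
  have : Finite F4 := Nat.finite_of_card_ne_zero (by rw [card_F4]; norm_num)
  have : Fintype F4 := Fintype.ofFinite F4
  have hc : Fintype.card F4 = 4 := by rw [← Nat.card_eq_fintype_card, card_F4]
  obtain ⟨ω, h0⟩ : ∃ ω : F4, ω ∉ ({0, 1} : Finset F4) := by
    by_contra! h
    have h1 := Finset.card_le_card (fun x _ => h x : (Finset.univ : Finset F4) ⊆ {0, 1})
    rw [Finset.card_univ, hc] at h1
    have h2 := Finset.card_le_two (a := (0 : F4)) (b := 1)
    omega
  simp only [Finset.mem_insert, Finset.mem_singleton, not_or] at h0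
  refine ⟨ω, ?_⟩
  have h1 : ω ^ 4 = ω := by
    have := FiniteField.pow_card ω
    rwa [hc] at this
  have h2 : (ω ^ 2 + ω + 1) * (ω * (ω - 1)) = 0 := by linear_combination h1
  rcases mul_eq_zero.mp h2 with h | h
  · exact h
  · rcases mul_eq_zero.mp h with h | h
    · exact absurd h h0.1
    · exact absurd (sub_eq_zero.mp h) h0.2

theorem two_eq_zero_F4 : (2 : F4) = 0 := CharTwo.two_eq_zero

theorem eq_zero_of_add_omega_mul {ω : F4} (hω : ω ^ 2 + ω + 1 = 0) {a b : ZMod 2}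
    (h : algebraMap (ZMod 2) F4 a + ω * algebraMap (ZMod 2) F4 b = 0) : a = 0 ∧ b = 0 := by
  have h2 := two_eq_zero_F4
  have hz : ∀ x : ZMod 2, x = 0 ∨ x = 1 := by decide
  rcases hz a with rfl | rfl <;> rcases hz b with rfl | rfl <;> simp at h ⊢
  · subst h
    simp at hω
  · have : ω = 1 := by linear_combination h - h2
    subst this
    exact one_ne_zero (α := F4) (by linear_combination hω - h2)

theorem exists_add_omega_mul {ω : F4} (hω : ω ^ 2 + ω + 1 = 0) (x : F4) :
    ∃ a b : ZMod 2, x = algebraMap (ZMod 2) F4 a + ω * algebraMap (ZMod 2) F4 b := by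
  have hfin : Finite F4 := Nat.finite_of_card_ne_zero (by rw [card_F4]; norm_num)
  let f : ZMod 2 × ZMod 2 → F4 := fun q =>
    algebraMap (ZMod 2) F4 q.1 + ω * algebraMap (ZMod 2) F4 q.2
  have hf : Function.Injective f := by
    rintro ⟨a, b⟩ ⟨a', b'⟩ h
    have h1 := eq_zero_of_add_omega_mul hω (a := a - a') (b := b - b') (by
      simp only [f] at h
      rw [map_sub, map_sub]
      linear_combination h)
    rw [Prod.mk.injEq]
    exact ⟨sub_eq_zero.mp h1.1, sub_eq_zero.mp h1.2⟩
  have hb : Function.Bijective f := by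
    rw [Nat.bijective_iff_injective_and_card]
    refine ⟨hf, ?_⟩
    rw [card_F4, Nat.card_eq_fintype_card]
    rfl
  obtain ⟨⟨a, b⟩, h⟩ := hb.2 x
  exact ⟨a, b, h.symm⟩

theorem exists_quaternary {ω : F4} (hω : ω ^ 2 + ω + 1 = 0) (v : Fin 20 → F4) :
    ∃ a b, v = quaternary ω a b := by
  choose a b h using fun j => exists_add_omega_mul hω (v j)
  exact ⟨a, b, funext h⟩

theorem quaternary_injective {ω : F4} (hω : ω ^ 2 + ω + 1 = 0) {a b a' b' : Fin 20 → ZMod 2}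
    (h : quaternary ω a b = quaternary ω a' b') : a = a' ∧ b = b' := by
  have h1 : ∀ j, a j - a' j = 0 ∧ b j - b' j = 0 := fun j =>
    eq_zero_of_add_omega_mul hω (by
      have := congrFun h j
      simp only [quaternary] at this
      rw [map_sub, map_sub]
      linear_combination this)
  exact ⟨funext fun j => sub_eq_zero.mp (h1 j).1, funext fun j => sub_eq_zero.mp (h1 j).2⟩

theorem quaternary_add (ω : F4) (a b a' b' : Fin 20 → ZMod 2) :
    quaternary ω (a + a') (b + b') = quaternary ω a b + quaternary ω a' b' := by
  ext j
  simp only [quaternary, Pi.add_apply, map_add]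
  ring

theorem omega_smul_quaternary {ω : F4} (hω : ω ^ 2 + ω + 1 = 0) (a b : Fin 20 → ZMod 2) :
    ω • quaternary ω a b = quaternary ω b (a + b) := by
  ext j
  simp only [quaternary, Pi.smul_apply, Pi.add_apply, map_add, smul_eq_mul]
  have h2 := two_eq_zero_F4
  linear_combination (algebraMap (ZMod 2) F4 (b j)) * hω -
    (algebraMap (ZMod 2) F4 (b j)) * (1 + ω) * h2

/-- The Hermitian inner product in terms of binary inner products. -/
theorem sum_quaternary_mul_sq {ω : F4} (hω : ω ^ 2 + ω + 1 = 0) (a b c d : Fin 20 → ZMod 2) :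
    ∑ j, quaternary ω a b j * quaternary ω c d j ^ 2 =
      algebraMap (ZMod 2) F4 (∑ j, a j * c j + ∑ j, a j * d j + ∑ j, b j * d j) +
        ω * algebraMap (ZMod 2) F4 (∑ j, a j * d j + ∑ j, b j * c j) := by
  simp only [← Finset.sum_add_distrib, map_sum, Finset.mul_sum]
  refine Finset.sum_congr rfl fun j _ => ?_
  have h2 := two_eq_zero_F4
  have hz : ∀ x : ZMod 2, x = 0 ∨ x = 1 := by decide
  simp only [quaternary, map_add, map_mul]
  have hs : ∀ x : ZMod 2, algebraMap (ZMod 2) F4 x ^ 2 = algebraMap (ZMod 2) F4 x := by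
    intro x
    rcases hz x with rfl | rfl <;> simp
  have hc := hs (c j)
  have hd := hs (d j)
  generalize algebraMap (ZMod 2) F4 (a j) = A at *
  generalize algebraMap (ZMod 2) F4 (b j) = B at *
  generalize algebraMap (ZMod 2) F4 (c j) = C at *
  generalize algebraMap (ZMod 2) F4 (d j) = D at *
  have e1 : (C + ω * D) ^ 2 = C + (1 + ω) * D := by
    linear_combination hc + ω ^ 2 * hd + D * hω + (ω * C * D - (1 + ω) * D) * h2
  rw [e1]
  linear_combination B * D * hω - (B * D) * h2

/-- The quaternary words `a + ω b` with `(a | b | a + b) ∈ C`. -/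
noncomputable def quaternaryPart (C : LinearCode (ZMod 2) (3 * 20))
    (hC : ∀ c ∈ C, c ∘ blockShift ∈ C) (ω : F4) (hω : ω ^ 2 + ω + 1 = 0) :
    LinearCode F4 20 where
  carrier := {v | ∃ a b, concat3 a b (a + b) ∈ C ∧ v = quaternary ω a b}
  zero_mem' := by
    refine ⟨0, 0, ?_, ?_⟩
    · have h := concat3_add (0 : Fin 20 → ZMod 2) 0 0 0 0 0
      simp only [add_zero, left_eq_add] at h
      rw [add_zero, h]
      exact C.zero_mem
    · ext j
      simp [quaternary]
  add_mem' := by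
    rintro _ _ ⟨a, b, h, rfl⟩ ⟨a', b', h', rfl⟩
    refine ⟨a + a', b + b', ?_, (quaternary_add ω a b a' b').symm⟩
    rw [add_add_add_comm, concat3_add]
    exact C.add_mem h h'
  smul_mem' := by
    rintro r _ ⟨a, b, h, rfl⟩
    have hz : ∀ x : ZMod 2, x = 0 ∨ x = 1 := by decide
    have h0 : concat3 (0 : Fin 20 → ZMod 2) 0 (0 + 0) ∈ C := by
      have h := concat3_add (0 : Fin 20 → ZMod 2) 0 0 0 0 0
      simp only [add_zero, left_eq_add] at h
      rw [add_zero, h]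
      exact C.zero_mem
    have h1 : concat3 b (a + b) (b + (a + b)) ∈ C := by
      have h2 : b + (a + b) = a := by rw [add_left_comm, add_self_binary, add_zero]
      have h3 := hC _ (hC _ h)
      rw [h2]
      rwa [concat3_comp_blockShift, concat3_comp_blockShift] at h3
    obtain ⟨s, t, rfl⟩ := exists_add_omega_mul hω r
    have e0 : (0 : Fin 20 → F4) = quaternary ω 0 0 := by
      ext j
      simp [quaternary]
    rw [add_smul, mul_comm ω, mul_smul, omega_smul_quaternary hω]
    rcases hz s with rfl | rfl <;> rcases hz t with rfl | rfl
    · exact ⟨0, 0, h0, by simp [← e0]⟩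
    · exact ⟨b, a + b, h1, by simp⟩
    · exact ⟨a, b, h, by simp⟩
    · refine ⟨a + b, b + (a + b), ?_, by simp [quaternary_add]⟩
      rw [add_add_add_comm, concat3_add]
      exact C.add_mem h h1

/-- A cubic code contains, with `(u | v | w)`, the word `(s | s | s)` with `s = u + v + w`. -/
theorem concat3_sum_mem {C : LinearCode (ZMod 2) (3 * 20)} (hC : ∀ c ∈ C, c ∘ blockShift ∈ C)
    {u v w : Fin 20 → ZMod 2} (h : concat3 u v w ∈ C) :
    concat3 (u + v + w) (u + v + w) (u + v + w) ∈ C := by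
  have h1 := hC _ h
  have h2 := hC _ h1
  rw [concat3_comp_blockShift] at h1 h2
  rw [concat3_comp_blockShift] at h2
  have h3 := C.add_mem (C.add_mem h h1) h2
  rw [← concat3_add, ← concat3_add] at h3
  convert h3 using 2 <;> abel

theorem concat3_pairs_mem {C : LinearCode (ZMod 2) (3 * 20)} (hC : ∀ c ∈ C, c ∘ blockShift ∈ C)
    {u v w : Fin 20 → ZMod 2} (h : concat3 u v w ∈ C) :
    concat3 (v + w) (u + w) (v + w + (u + w)) ∈ C := by
  have h3 := C.add_mem h (concat3_sum_mem hC h)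
  rw [← concat3_add] at h3
  have e : ∀ x y z : ZMod 2, x + (x + y + z) = y + z ∧ y + (x + y + z) = x + z ∧
      z + (x + y + z) = y + z + (x + z) := by decide
  convert h3 using 2
  · ext j
    exact (e (u j) (v j) (w j)).1.symm
  · ext j
    exact (e (u j) (v j) (w j)).2.1.symm
  · ext j
    exact (e (u j) (v j) (w j)).2.2.symm

/-- A cubic self-dual code of Type I arises from the cubic construction: the binary constituent
consists of the `x` with `(x | x | x) ∈ C`, the quaternary one of the `a + ω b` with
`(a | b | a + b) ∈ C`. -/
theorem IsTypeI.exists_cubicConstruction {C : LinearCode (ZMod 2) (3 * 20)} (hI : C.IsTypeI)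
    (hC : ∀ c ∈ C, c ∘ blockShift ∈ C) :
    ∃ (ω : F4) (C₁ : LinearCode (ZMod 2) 20) (C₂ : LinearCode F4 20),
      ω ^ 2 + ω + 1 = 0 ∧ C₁.IsTypeI ∧ C₂.IsHermitianSelfDual ∧
      (C : Set (Fin (3 * 20) → ZMod 2)) = cubicConstruction ω C₁ C₂ := by
  obtain ⟨hsd, c₀, hc₀, hw₀⟩ := hI
  obtain ⟨ω, hω⟩ := exists_primitive_root
  refine ⟨ω, diagonalPart C, quaternaryPart C hC ω hω, hω, ⟨?_, ?_⟩, ?_, ?_⟩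
  · ext x
    constructor
    · intro hx y hy
      have h1 := hsd.sum_mul_eq_zero hx hy
      rw [sum_concat3_mul] at h1
      have e : ∀ z : ZMod 2, z + z + z = z := by decide
      rwa [e] at h1
    · intro hx
      refine hsd.mem_of_forall fun d hd => ?_
      obtain ⟨u, v, w, rfl⟩ := exists_concat3 d
      have h1 := hx _ (concat3_sum_mem hC hd)
      rw [sum_concat3_mul]
      simpa only [Pi.add_apply, mul_add, Finset.sum_add_distrib] using h1
  · obtain ⟨u, v, w, rfl⟩ := exists_concat3 c₀
    refine ⟨u + v + w, concat3_sum_mem hC hc₀, ?_⟩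
    have h1 := hC _ hc₀
    have h2 := hC _ h1
    rw [concat3_comp_blockShift] at h1 h2
    rw [concat3_comp_blockShift] at h2
    have e1 := hammingNorm_add_mod_four (hsd.sum_mul_eq_zero hc₀ h1)
    have e2 := hammingNorm_add_mod_four (hsd.sum_mul_eq_zero (C.add_mem hc₀ h1) h2)
    have e3 : concat3 u v w + concat3 w u v + concat3 v w u =
        concat3 (u + v + w) (u + v + w) (u + v + w) := by
      rw [← concat3_add, ← concat3_add]
      congr 1 <;> abel
    have e4 := hsd.even_hammingNorm hc₀
    rw [e3] at e2
    simp only [hammingNorm_concat3] at e1 e2 e4 hw₀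
    omega
  · ext y
    constructor
    · rintro ⟨a, b, hab, rfl⟩ _ ⟨c, d, hcd, rfl⟩
      rw [sum_quaternary_mul_sq hω]
      have h1 := hsd.sum_mul_eq_zero hab hcd
      have h2 := hsd.sum_mul_eq_zero hab (hC _ (hC _ hcd))
      rw [concat3_comp_blockShift, concat3_comp_blockShift] at h2
      rw [sum_concat3_mul] at h1 h2
      simp only [Pi.add_apply, mul_add, add_mul, Finset.sum_add_distrib] at h1 h2
      generalize ∑ j, a j * c j = p at *
      generalize ∑ j, a j * d j = q at *
      generalize ∑ j, b j * c j = r at *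
      generalize ∑ j, b j * d j = t at *
      have e : ∀ p q r t : ZMod 2, p + t + (p + r + (q + t)) = 0 → q + (r + t) + (p + r) = 0 →
          p + q + t = 0 ∧ q + r = 0 := by decide
      obtain ⟨h3, h4⟩ := e p q r t h1 h2
      rw [h3, h4]
      simp
    · intro hy
      obtain ⟨a, b, rfl⟩ := exists_quaternary hω y
      refine ⟨a, b, hsd.mem_of_forall fun e he => ?_, rfl⟩
      obtain ⟨u, v, w, rfl⟩ := exists_concat3 e
      have h1 := hy _ ⟨_, _, concat3_pairs_mem hC he, rfl⟩
      rw [sum_quaternary_mul_sq hω] at h1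
      have h2 := (eq_zero_of_add_omega_mul hω h1).2
      rw [sum_concat3_mul]
      simp only [Pi.add_apply, mul_add, add_mul, Finset.sum_add_distrib] at h2 ⊢
      linear_combination h2
  · ext c
    constructor
    · intro hc
      obtain ⟨u, v, w, rfl⟩ := exists_concat3 c
      refine ⟨u + v + w, concat3_sum_mem hC hc, v + w, u + w,
        ⟨_, _, concat3_pairs_mem hC hc, rfl⟩, ?_⟩
      have e : ∀ x y z : ZMod 2, x + y + z + (y + z) = x ∧ x + y + z + (x + z) = y ∧
          x + y + z + (y + z) + (x + z) = z := by decide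
      congr 1
      · ext j
        exact (e (u j) (v j) (w j)).1.symm
      · ext j
        exact (e (u j) (v j) (w j)).2.1.symm
      · ext j
        exact (e (u j) (v j) (w j)).2.2.symm
    · rintro ⟨x, hx, a, b, ⟨a', b', hab, h⟩, rfl⟩
      obtain ⟨rfl, rfl⟩ := quaternary_injective hω h
      rw [add_assoc x, concat3_add]
      exact C.add_mem hx hab

/-! ### The MacWilliams identity for binary codes -/

section MacWilliams

variable {n : ℕ}

/-- The nontrivial character of `ZMod 2`, with values in `ℤ[X]`. -/
noncomputable def signChar (a : ZMod 2) : ℤ[X] := if a = 0 then 1 else -1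

theorem signChar_add (a b : ZMod 2) : signChar (a + b) = signChar a * signChar b := by
  have h : ∀ a : ZMod 2, a = 0 ∨ a = 1 := by decide
  have h2 : (1 + 1 : ZMod 2) = 0 := rfl
  rcases h a with rfl | rfl <;> rcases h b with rfl | rfl <;> simp [signChar, h2]

theorem signChar_sum {ι : Type*} (s : Finset ι) (f : ι → ZMod 2) :
    signChar (∑ i ∈ s, f i) = ∏ i ∈ s, signChar (f i) := by
  classical
  induction s using Finset.induction_on with
  | empty => simp [signChar]
  | insert a s ha ih => rw [Finset.sum_insert ha, Finset.prod_insert ha, signChar_add, ih]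

theorem prod_eq_pow_mul_pow (c : Fin n → ZMod 2) :
    ∏ i, (1 + signChar (c i) * X) =
      ((1 - X) ^ hammingNorm c * (1 + X) ^ (n - hammingNorm c) : ℤ[X]) := by
  have h1 : ∀ i, (1 + signChar (c i) * X : ℤ[X]) = if c i ≠ 0 then 1 - X else 1 + X := by
    intro i
    by_cases h : c i = 0 <;> simp [signChar, h, sub_eq_add_neg]
  have h2 : (Finset.univ.filter fun i => ¬ c i ≠ 0).card = n - hammingNorm c := by
    have h3 := Finset.card_filter_add_card_filter_not (s := (Finset.univ : Finset (Fin n)))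
      (p := fun i => c i ≠ 0)
    rw [Finset.card_univ, Fintype.card_fin] at h3
    have h4 : hammingNorm c = (Finset.univ.filter fun i => c i ≠ 0).card := rfl
    omega
  simp only [h1]
  rw [Finset.prod_ite, Finset.prod_const, Finset.prod_const, h2]
  rfl

theorem prod_eq_sum_signChar (c : Fin n → ZMod 2) :
    ∏ i, (1 + signChar (c i) * X) =
      ∑ d : Fin n → ZMod 2, signChar (∑ i, c i * d i) * X ^ hammingNorm d := by
  have h1 : ∀ i, (1 + signChar (c i) * X : ℤ[X]) =
      ∑ a : ZMod 2, signChar (c i * a) * X ^ a.val := by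
    intro i
    have : (Finset.univ : Finset (ZMod 2)) = {0, 1} := rfl
    rw [this, Finset.sum_pair (by decide)]
    have e : (1 : ZMod 2).val = 1 := rfl
    simp [signChar, e]
  simp only [h1]
  rw [Fintype.prod_sum]
  refine Finset.sum_congr rfl fun d _ => ?_
  rw [Finset.prod_mul_distrib, ← signChar_sum, Finset.prod_pow_eq_pow_sum, hammingNorm_eq_sum_val]

open Classical in
theorem sum_signChar_mem (E : LinearCode (ZMod 2) n) (d : Fin n → ZMod 2) :
    ∑ c with c ∈ E, signChar (∑ i, c i * d i) =
      if d ∈ E.dual then ((Nat.card E : ℕ) : ℤ[X]) else 0 := by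
  have hcard : Nat.card E = (Finset.univ.filter fun c => c ∈ E).card := by
    rw [Nat.card_eq_fintype_card, Fintype.card_subtype]
  split_ifs with hd
  · rw [hcard, Finset.card_eq_sum_ones, Nat.cast_sum]
    refine Finset.sum_congr rfl fun c hc => ?_
    have h1 := hd c (Finset.mem_filter.mp hc).2
    have h2 : ∑ i, c i * d i = 0 := by
      rw [← h1]
      exact Finset.sum_congr rfl fun i _ => mul_comm _ _
    rw [h2]
    simp [signChar]
  · rw [mem_dual_iff] at hd
    push Not at hd
    obtain ⟨c₀, hc₀, h0⟩ := hd
    have h1 : ∑ i, c₀ i * d i = 1 := by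
      have h2 : ∀ a : ZMod 2, a ≠ 0 → a = 1 := by decide
      apply h2
      convert h0 using 1
      exact Finset.sum_congr rfl fun i _ => mul_comm _ _
    refine Finset.sum_involution (fun c _ => c + c₀) ?_ ?_ ?_ ?_
    · intro c _
      simp only [Pi.add_apply, add_mul, Finset.sum_add_distrib, h1, signChar_add]
      simp [signChar]
    · intro c _ _ h
      have h3 : c₀ = 0 := by simpa using h
      simp [h3] at h1
    · intro c hc
      simp only [Finset.mem_filter, Finset.mem_univ, true_and] at hc ⊢
      exact E.add_mem hc hc₀
    · intro c _
      rw [add_assoc, add_self_binary, add_zero]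

open Classical in
/-- The MacWilliams identity, in terms of the words of the code. -/
theorem macWilliams (E : LinearCode (ZMod 2) n) :
    ∑ c with c ∈ E, ((1 - X) ^ hammingNorm c * (1 + X) ^ (n - hammingNorm c) : ℤ[X]) =
      (Nat.card E : ℤ[X]) * ∑ d with d ∈ E.dual, X ^ hammingNorm d := by
  simp only [← prod_eq_pow_mul_pow, prod_eq_sum_signChar]
  rw [Finset.sum_comm, Finset.mul_sum, Finset.sum_filter]
  refine Finset.sum_congr rfl fun d _ => ?_
  rw [← Finset.sum_mul, sum_signChar_mem]
  split_ifs <;> simp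

open Classical in
theorem weightCount_eq_card (E : LinearCode (ZMod 2) n) (i : ℕ) :
    E.weightCount i = (Finset.univ.filter fun c => c ∈ E ∧ hammingNorm c = i).card := by
  rw [weightCount, ← Set.ncard_coe_finset]
  congr 1
  ext c
  simp

open Classical in
theorem sum_comp_hammingNorm {M : Type*} [CommSemiring M] (E : LinearCode (ZMod 2) n)
    (f : ℕ → M) :
    ∑ c with c ∈ E, f (hammingNorm c) =
      ∑ i ∈ Finset.range (n + 1), (E.weightCount i : M) * f i := by
  rw [← Finset.sum_fiberwise_of_maps_to (t := Finset.range (n + 1)) (g := hammingNorm)]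
  · refine Finset.sum_congr rfl fun i _ => ?_
    rw [Finset.sum_congr rfl (g := fun _ => f i), Finset.sum_const, weightCount_eq_card,
      Finset.filter_filter, nsmul_eq_mul]
    intro c hc
    rw [(Finset.mem_filter.mp hc).2]
  · intro c _
    rw [Finset.mem_range, Nat.lt_succ_iff]
    exact (hammingNorm_le_card_fintype).trans (by simp)

theorem card_mul_card_dual (E : LinearCode (ZMod 2) n) :
    Nat.card E * Nat.card E.dual = 2 ^ n := by
  classical
  have h := congrArg (Polynomial.eval 1) (macWilliams E)
  simp only [eval_finsetSum, eval_mul, eval_pow, eval_sub, eval_add, eval_one, eval_X, sub_self,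
    one_pow, Finset.sum_const, nsmul_eq_mul, mul_one, eval_natCast] at h
  rw [Finset.sum_eq_single 0] at h
  · have hcard : Nat.card E.dual = (Finset.univ.filter fun c => c ∈ E.dual).card := by
      rw [Nat.card_eq_fintype_card, Fintype.card_subtype]
    rw [hcard]
    simp only [hammingNorm_zero, pow_zero, one_mul, Nat.sub_zero] at h
    rw [one_add_one_eq_two] at h
    exact_mod_cast h.symm
  · intro c _ hc
    rw [zero_pow (hammingNorm_ne_zero_iff.mpr hc), zero_mul]
  · intro h0
    exact absurd (Finset.mem_filter.mpr ⟨Finset.mem_univ _, E.zero_mem⟩) h0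

/-- The Krawtchouk number: the coefficient of `X ^ r` in `(1 - X) ^ w * (1 + X) ^ (n - w)`. -/
noncomputable def krawtchouk (n w r : ℕ) : ℤ := ((1 - X) ^ w * (1 + X) ^ (n - w) : ℤ[X]).coeff r

/-- The MacWilliams identity, coefficient by coefficient. -/
theorem sum_weightCount_mul_krawtchouk (E : LinearCode (ZMod 2) n) {r : ℕ} (hr : r ≤ n) :
    ∑ i ∈ Finset.range (n + 1), (E.weightCount i : ℤ) * krawtchouk n i r =
      Nat.card E * E.dual.weightCount r := by
  classical
  have h := macWilliams E
  rw [sum_comp_hammingNorm E fun w => ((1 - X) ^ w * (1 + X) ^ (n - w) : ℤ[X]),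
    sum_comp_hammingNorm E.dual fun w => (X ^ w : ℤ[X])] at h
  have h1 := congrArg (fun p => p.coeff r) h
  simp only [Finset.mul_sum, finsetSum_coeff, ← C_eq_natCast, coeff_C_mul,
    coeff_X_pow] at h1
  simp only [krawtchouk]
  rw [h1, Finset.sum_eq_single r]
  · simp
  · intro b _ hb
    simp [hb.symm]
  · intro h2
    rw [Finset.mem_range] at h2
    omega

end MacWilliams

/-! ### Krawtchouk numbers by truncated polynomial arithmetic -/

/-- From the list of the first coefficients of `p` (preceded by the coefficient `a`), that of
`(1 + s X) * p`. -/
def mulLinear (s : ℤ) : ℤ → List ℤ → List ℤ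
  | _, [] => []
  | a, b :: l => (b + s * a) :: mulLinear s b l

theorem mulLinear_map_coeff (s : ℤ) (p : ℤ[X]) (k m : ℕ) :
    mulLinear s (p.coeff k) ((List.range' (k + 1) m).map p.coeff) =
      (List.range' (k + 1) m).map ((1 + C s * X) * p).coeff := by
  induction m generalizing k with
  | zero => rfl
  | succ m ih =>
    rw [List.range'_succ, List.map_cons, List.map_cons, mulLinear, ih, List.cons.injEq]
    refine ⟨?_, rfl⟩
    rw [add_mul, one_mul, mul_assoc, coeff_add, coeff_C_mul, coeff_X_mul]

theorem mulLinear_zero_map_coeff (s : ℤ) (p : ℤ[X]) (m : ℕ) :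
    mulLinear s 0 ((List.range' 0 m).map p.coeff) =
      (List.range' 0 m).map ((1 + C s * X) * p).coeff := by
  cases m with
  | zero => rfl
  | succ m =>
    rw [List.range'_succ, List.map_cons, List.map_cons, mulLinear, mulLinear_map_coeff,
      List.cons.injEq]
    refine ⟨?_, rfl⟩
    rw [add_mul, one_mul, mul_assoc, coeff_add, coeff_C_mul]
    simp

theorem iterate_mulLinear (s : ℤ) (p : ℤ[X]) (m k : ℕ) :
    (mulLinear s 0)^[k] ((List.range' 0 m).map p.coeff) =
      (List.range' 0 m).map ((1 + C s * X) ^ k * p).coeff := by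
  induction k with
  | zero => simp
  | succ k ih =>
    rw [Function.iterate_succ_apply', ih, mulLinear_zero_map_coeff, pow_succ', mul_assoc]

/-- The Krawtchouk numbers of degree less than nine for length sixty. -/
def krawtchoukList (w : ℕ) : List ℤ :=
  (mulLinear (-1) 0)^[w] ((mulLinear 1 0)^[60 - w] [1, 0, 0, 0, 0, 0, 0, 0, 0])

theorem krawtchouk_eq (w r : ℕ) (hr : r < 9) : krawtchouk 60 w r = (krawtchoukList w).getD r 0 := by
  have h1 : [1, 0, 0, 0, 0, 0, 0, 0, 0] = (List.range' 0 9).map (1 : ℤ[X]).coeff := by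
    simp [List.range', coeff_one]
  rw [krawtchoukList, h1, iterate_mulLinear, iterate_mulLinear, krawtchouk]
  have h2 : ((1 + C (-1) * X) ^ w * ((1 + C 1 * X) ^ (60 - w) * 1) : ℤ[X]) =
      (1 - X) ^ w * (1 + X) ^ (60 - w) := by
    simp [sub_eq_add_neg]
  rw [h2]
  interval_cases r <;> rfl

/-! ### Codes with ten blocks of six coordinates -/

/-- The coordinate in position `k` of the block `b`. -/
def point (b : Fin 10) (k : Fin 6) : Fin (3 * 20) := ⟨6 * b.val + k.val, by omega⟩

/-- The block of a coordinate. -/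
def blockOf (p : Fin (3 * 20)) : Fin 10 := ⟨p.val / 6, by omega⟩

/-- The indicator word of a block. -/
def blockWord (b : Fin 10) : Fin (3 * 20) → ZMod 2 := fun p => if blockOf p = b then 1 else 0

/-- The weight of a word on a block. -/
def blockCount (c : Fin (3 * 20) → ZMod 2) (b : Fin 10) : ℕ := ∑ k, (c (point b k)).val

theorem sum_eq_sum_point {M : Type*} [AddCommMonoid M] (f : Fin (3 * 20) → M) :
    ∑ p, f p = ∑ b, ∑ k, f (point b k) := by
  rw [← Fintype.sum_prod_type']
  refine (Equiv.sum_comp (finProdFinEquiv : Fin 10 × Fin 6 ≃ Fin (10 * 6)) f).symm.trans ?_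
  refine Finset.sum_congr rfl fun x _ => congrArg f (Fin.ext ?_)
  simp [finProdFinEquiv, point, add_comm]

@[simp]
theorem blockOf_point (b : Fin 10) (k : Fin 6) : blockOf (point b k) = b := by
  apply Fin.ext
  simp only [blockOf, point]
  omega

theorem exists_eq_point (p : Fin (3 * 20)) : ∃ k, p = point (blockOf p) k :=
  ⟨⟨p.val % 6, Nat.mod_lt _ (by norm_num)⟩, Fin.ext (by simp only [blockOf, point]; omega)⟩

theorem hammingNorm_eq_sum_blockCount (c : Fin (3 * 20) → ZMod 2) :
    hammingNorm c = ∑ b, blockCount c b := by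
  rw [hammingNorm_eq_sum_val, sum_eq_sum_point]
  rfl

theorem sum_val_mul_blockWord (c : Fin (3 * 20) → ZMod 2) (b : Fin 10) :
    ∑ p, (c p).val * (blockWord b p).val = blockCount c b := by
  rw [sum_eq_sum_point, Finset.sum_eq_single b]
  · have e : (1 : ZMod 2).val = 1 := rfl
    simp [blockWord, blockCount, e]
  · intro b' _ h
    simp [blockWord, h]
  · simp

theorem sum_mul_blockWord (c : Fin (3 * 20) → ZMod 2) (b : Fin 10) :
    ∑ p, c p * blockWord b p = (blockCount c b : ℕ) := by
  rw [← sum_val_mul_blockWord, cast_sum_val_mul]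

theorem blockCount_blockWord (b b' : Fin 10) :
    blockCount (blockWord b) b' = if b' = b then 6 else 0 := by
  have e : (1 : ZMod 2).val = 1 := rfl
  simp only [blockCount, blockWord, blockOf_point]
  split_ifs <;> simp [e]

theorem hammingNorm_blockWord (b : Fin 10) : hammingNorm (blockWord b) = 6 := by
  rw [hammingNorm_eq_sum_blockCount]
  simp [blockCount_blockWord]

theorem hammingNorm_add_blockWord (c : Fin (3 * 20) → ZMod 2) (b : Fin 10) :
    hammingNorm (c + blockWord b) + 2 * blockCount c b = hammingNorm c + 6 := by
  rw [← sum_val_mul_blockWord, hammingNorm_add_two_mul, hammingNorm_blockWord]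

theorem blockCount_add_mod_two (c d : Fin (3 * 20) → ZMod 2) (b : Fin 10) :
    blockCount (c + d) b % 2 = (blockCount c b + blockCount d b) % 2 := by
  have h : ((blockCount (c + d) b : ℕ) : ZMod 2) = ((blockCount c b + blockCount d b : ℕ)) := by
    rw [Nat.cast_add, ← sum_mul_blockWord, ← sum_mul_blockWord, ← sum_mul_blockWord,
      ← Finset.sum_add_distrib]
    exact Finset.sum_congr rfl fun p _ => add_mul _ _ _
  exact (ZMod.natCast_eq_natCast_iff' _ _ 2).mp h

/-- Self-dual codes with minimum weight at least twelve for which the ten blocks of six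
coordinates belong to the shadow: every codeword of weight `w` meets every block in a number of
coordinates congruent to `w / 2` modulo two. -/
structure IsBlockCode (C : LinearCode (ZMod 2) (3 * 20)) : Prop where
  selfDual : C.IsSelfDual
  mod_four : ∀ c ∈ C, ∀ b, hammingNorm c % 4 = 2 * (blockCount c b % 2)
  minimum : ∀ c ∈ C, c ≠ 0 → 12 ≤ hammingNorm c

/-- The codewords meeting every block evenly, that is, those of weight divisible by four. -/
def evenPart (C : LinearCode (ZMod 2) (3 * 20)) : LinearCode (ZMod 2) (3 * 20) where
  carrier := {c | c ∈ C ∧ ∑ p, c p * blockWord 0 p = 0}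
  zero_mem' := ⟨C.zero_mem, by simp⟩
  add_mem' := by
    rintro a b ⟨ha, ha'⟩ ⟨hb, hb'⟩
    refine ⟨C.add_mem ha hb, ?_⟩
    simp only [Pi.add_apply, add_mul, Finset.sum_add_distrib, ha', hb', add_zero]
  smul_mem' := by
    rintro r a ⟨ha, ha'⟩
    refine ⟨C.smul_mem r ha, ?_⟩
    simp only [Pi.smul_apply, smul_eq_mul, mul_assoc, ← Finset.mul_sum, ha', mul_zero]

namespace IsBlockCode

variable {C : LinearCode (ZMod 2) (3 * 20)}

theorem blockWord_add_mem (hC : IsBlockCode C) (i j : Fin 10) : blockWord i + blockWord j ∈ C := by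
  refine hC.selfDual.mem_of_forall fun d hd => ?_
  have h : ∑ p, (blockWord i + blockWord j) p * d p =
      ∑ p, d p * blockWord i p + ∑ p, d p * blockWord j p := by
    rw [← Finset.sum_add_distrib]
    exact Finset.sum_congr rfl fun p _ => by rw [Pi.add_apply]; ring
  rw [h, sum_mul_blockWord, sum_mul_blockWord, ← Nat.cast_add, ZMod.natCast_eq_zero_iff]
  have h1 := hC.mod_four d hd i
  have h2 := hC.mod_four d hd j
  omega

theorem blockWord_notMem (hC : IsBlockCode C) (b : Fin 10) : blockWord b ∉ C := by
  intro h
  have h0 : blockWord b ≠ 0 := by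
    intro h0
    have := hammingNorm_blockWord b
    rw [h0] at this
    simp at this
  have := hC.minimum _ h h0
  rw [hammingNorm_blockWord] at this
  omega

theorem exists_odd (hC : IsBlockCode C) : ∃ u ∈ C, ∑ p, u p * blockWord 0 p = 1 := by
  by_contra! h
  refine hC.blockWord_notMem 0 (hC.selfDual.mem_of_forall fun d hd => ?_)
  have h1 : ∀ a : ZMod 2, a ≠ 1 → a = 0 := by decide
  rw [← h1 _ (h d hd)]
  exact Finset.sum_congr rfl fun p _ => mul_comm _ _

/-- The dual of the even part is generated by the code and a block. -/
theorem mem_or_add_blockWord_mem (hC : IsBlockCode C) {d : Fin (3 * 20) → ZMod 2}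
    (hd : d ∈ (evenPart C).dual) :
    d ∈ C ∨ d + blockWord 0 ∈ C := by
  by_cases h : d ∈ C
  · exact Or.inl h
  obtain ⟨u, hu, hu1⟩ := hC.exists_odd
  have hz : ∀ a : ZMod 2, a = 0 ∨ a = 1 := by decide
  have hcd : ∀ c : Fin (3 * 20) → ZMod 2, ∑ p, (d + blockWord 0) p * c p =
      ∑ p, d p * c p + ∑ p, c p * blockWord 0 p := by
    intro c
    rw [← Finset.sum_add_distrib]
    exact Finset.sum_congr rfl fun p _ => by rw [Pi.add_apply]; ring
  have key : ∀ c ∈ C, ∑ p, c p * blockWord 0 p = 1 →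
      ∑ p, d p * c p = ∑ p, d p * u p := by
    intro c hc hc1
    have h1 := hd (c + u) ⟨C.add_mem hc hu, by
      simp only [Pi.add_apply, add_mul, Finset.sum_add_distrib, hc1, hu1]
      rfl⟩
    simp only [Pi.add_apply, mul_add, Finset.sum_add_distrib] at h1
    rcases hz (∑ p, d p * c p) with h2 | h2 <;> rcases hz (∑ p, d p * u p) with h3 | h3 <;>
      simp [h2, h3] at h1 ⊢
  have h1 : ∑ p, d p * u p = 1 := by
    rcases hz (∑ p, d p * u p) with h2 | h2
    · exfalso
      refine h (hC.selfDual.mem_of_forall fun c hc => ?_)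
      rcases hz (∑ p, c p * blockWord 0 p) with h3 | h3
      · exact hd c ⟨hc, h3⟩
      · rw [key c hc h3, h2]
    · exact h2
  refine Or.inr (hC.selfDual.mem_of_forall fun c hc => ?_)
  rw [hcd]
  rcases hz (∑ p, c p * blockWord 0 p) with h3 | h3
  · rw [h3, hd c ⟨hc, h3⟩, add_zero]
  · rw [key c hc h3, h1, h3]
    rfl

theorem blockWord_mem_dual (hC : IsBlockCode C) (b : Fin 10) : blockWord b ∈ (evenPart C).dual := by
  rintro c ⟨hc, h0⟩
  have h : ∑ p, blockWord b p * c p = ∑ p, c p * blockWord b p :=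
    Finset.sum_congr rfl fun p _ => mul_comm _ _
  rw [h, sum_mul_blockWord, ZMod.natCast_eq_zero_iff]
  rw [sum_mul_blockWord, ZMod.natCast_eq_zero_iff] at h0
  have h1 := hC.mod_four c hc b
  have h2 := hC.mod_four c hc 0
  omega

/-- A word `d` with `d + B₀ ∈ C` is a block, or has weight at least ten: all `d + Bᵢ` are
codewords, and their ten weights add up to `8 * wt d + 60`. -/
theorem eq_blockWord_or_ten_le (hC : IsBlockCode C) {d : Fin (3 * 20) → ZMod 2}
    (hd : d + blockWord 0 ∈ C) :
    (∃ b, d = blockWord b) ∨ 10 ≤ hammingNorm d := by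
  by_cases h : ∃ b, d = blockWord b
  · exact Or.inl h
  push Not at h
  have hmem : ∀ b, d + blockWord b ∈ C := fun b => by
    have h1 := C.add_mem hd (hC.blockWord_add_mem 0 b)
    rwa [add_assoc, ← add_assoc (blockWord 0), add_self_binary, zero_add] at h1
  have hmin : ∀ b, 12 + 2 * blockCount d b ≤ hammingNorm d + 6 := fun b => by
    rw [← hammingNorm_add_blockWord]
    refine Nat.add_le_add_right (hC.minimum _ (hmem b) fun h0 => h b ?_) _
    have h1 : d + blockWord b + blockWord b = blockWord b := by rw [h0, zero_add]
    rwa [add_assoc, add_self_binary, add_zero] at h1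
  have hsum := Finset.sum_le_sum fun b (_ : b ∈ (Finset.univ : Finset (Fin 10))) => hmin b
  simp only [Finset.sum_add_distrib, ← Finset.mul_sum, ← hammingNorm_eq_sum_blockCount,
    Finset.sum_const, Finset.card_univ, Fintype.card_fin, smul_eq_mul] at hsum
  have h4 := hC.mod_four _ (hmem 0) 0
  have h5 := hammingNorm_add_blockWord d 0
  have h6 := blockCount_add_mod_two d (blockWord 0) 0
  rw [blockCount_blockWord, if_pos rfl] at h6
  right
  omega

theorem eq_blockWord_of_lt_ten (hC : IsBlockCode C) {d : Fin (3 * 20) → ZMod 2}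
    (hd : d ∈ (evenPart C).dual)
    (h0 : d ≠ 0) (hw : hammingNorm d < 10) : ∃ b, d = blockWord b := by
  rcases hC.mem_or_add_blockWord_mem hd with h | h
  · have := hC.minimum d h h0
    omega
  · exact (hC.eq_blockWord_or_ten_le h).resolve_right (by omega)

theorem card (hC : IsBlockCode C) : Nat.card C = 2 ^ 30 := by
  have h := card_mul_card_dual C
  rw [← hC.selfDual] at h
  have h2 : (Nat.card C) ^ 2 = (2 ^ 30) ^ 2 := by
    rw [pow_two, h]
    norm_num
  exact Nat.pow_left_injective (n := 2) (by norm_num) h2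

theorem finrank (hC : IsBlockCode C) : Module.finrank (ZMod 2) C = 30 := by
  have h := hC.card
  rw [Module.natCard_eq_pow_finrank (K := ZMod 2), Nat.card_zmod] at h
  exact Nat.pow_right_injective (le_refl 2) h

theorem card_evenPart (hC : IsBlockCode C) : Nat.card (evenPart C) = 2 ^ 29 := by
  classical
  obtain ⟨u, hu, hu1⟩ := hC.exists_odd
  have hz : ∀ a : ZMod 2, a = 0 ∨ a = 1 := by decide
  let e : evenPart C × Fin 2 ≃ C := Equiv.ofBijective
    (fun x => ⟨if x.2 = 0 then x.1.1 else x.1.1 + u, by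
      split_ifs
      · exact x.1.2.1
      · exact C.add_mem x.1.2.1 hu⟩) ⟨?_, ?_⟩
  · have h := Nat.card_congr e
    rw [Nat.card_prod, hC.card, Nat.card_eq_fintype_card (α := Fin 2), Fintype.card_fin] at h
    omega
  · rintro ⟨⟨a, ha, ha0⟩, i⟩ ⟨⟨b, hb, hb0⟩, j⟩ h
    simp only [Subtype.mk.injEq] at h
    have h1 := congrArg (fun c : Fin (3 * 20) → ZMod 2 => ∑ p, c p * blockWord 0 p) h
    fin_cases i <;> fin_cases j <;>
      simp [add_mul, Finset.sum_add_distrib, ha0, hb0, hu1] at h h1 ⊢ <;> exact Subtype.ext h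
  · rintro ⟨c, hc⟩
    rcases hz (∑ p, c p * blockWord 0 p) with h | h
    · exact ⟨(⟨c, hc, h⟩, 0), by simp⟩
    · refine ⟨(⟨c + u, C.add_mem hc hu, ?_⟩, 1), ?_⟩
      · simp only [Pi.add_apply, add_mul, Finset.sum_add_distrib, h, hu1]
        rfl
      · simp [add_assoc, add_self_binary]

/-! ### The weight enumerator -/

theorem weightCount_zero : C.weightCount 0 = 1 := by
  rw [weightCount, Set.ncard_eq_one]
  refine ⟨0, ?_⟩
  ext c
  simp only [hammingNorm_eq_zero, Set.mem_ofPred_eq, Set.mem_singleton_iff]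
  constructor
  · exact fun h => h.2
  · rintro rfl
    exact ⟨C.zero_mem, rfl⟩

theorem weightCount_eq_zero_of_lt (hC : IsBlockCode C) {i : ℕ} (h0 : 0 < i) (hi : i < 12) :
    C.weightCount i = 0 := by
  rw [weightCount, Set.ncard_eq_zero]
  ext c
  simp only [Set.mem_ofPred_eq, Set.mem_empty_iff_false, iff_false, not_and]
  intro hc h
  have h1 := hC.minimum c hc (by
    rintro rfl
    simp at h
    omega)
  omega

theorem weightCount_eq_zero_of_odd (hC : IsBlockCode C) {i : ℕ} (hi : i % 2 = 1) :
    C.weightCount i = 0 := by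
  rw [weightCount, Set.ncard_eq_zero]
  ext c
  simp only [Set.mem_ofPred_eq, Set.mem_empty_iff_false, iff_false, not_and]
  intro hc h
  have h1 := hC.selfDual.even_hammingNorm hc
  omega

theorem one_mem (hC : IsBlockCode C) : (1 : Fin (3 * 20) → ZMod 2) ∈ C := by
  refine hC.selfDual.mem_of_forall fun d hd => ?_
  have h := hC.selfDual.even_hammingNorm hd
  rw [← ZMod.natCast_eq_zero_iff, cast_hammingNorm] at h
  simpa using h

theorem weightCount_sub (hC : IsBlockCode C) {i : ℕ} (hi : i ≤ 60) :
    C.weightCount (60 - i) = C.weightCount i := by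
  have h : ∀ c : Fin (3 * 20) → ZMod 2, hammingNorm (c + 1) + hammingNorm c = 60 := by
    intro c
    simp only [hammingNorm_eq_sum_val, ← Finset.sum_add_distrib]
    have h : ∀ a : ZMod 2, (a + 1).val + a.val = 1 := by decide
    simp [h]
  have h1 : ∀ c : Fin (3 * 20) → ZMod 2, c + 1 + 1 = c := fun c => by
    rw [add_assoc, add_self_binary, add_zero]
  refine Set.ncard_congr (fun c _ => c + 1) ?_ ?_ ?_
  · rintro c ⟨hc, hw⟩
    refine ⟨C.add_mem hc hC.one_mem, ?_⟩
    have := h c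
    omega
  · intro a b _ _ hab
    exact add_right_cancel hab
  · rintro c ⟨hc, hw⟩
    refine ⟨c + 1, ⟨C.add_mem hc hC.one_mem, ?_⟩, h1 c⟩
    have := h c
    omega

theorem weightCount_evenPart (hC : IsBlockCode C) (i : ℕ) :
    (evenPart C).weightCount i = if 4 ∣ i then C.weightCount i else 0 := by
  have key : ∀ c ∈ C, ((∑ p, c p * blockWord 0 p = 0) ↔ 4 ∣ hammingNorm c) := by
    intro c hc
    rw [sum_mul_blockWord, ZMod.natCast_eq_zero_iff]
    have := hC.mod_four c hc 0
    omega
  split_ifs with h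
  · unfold weightCount
    congr 1
    ext c
    constructor
    · rintro ⟨⟨hc, -⟩, hi⟩
      exact ⟨hc, hi⟩
    · rintro ⟨hc, hi⟩
      exact ⟨⟨hc, (key c hc).mpr (by rwa [hi])⟩, hi⟩
  · rw [weightCount, Set.ncard_eq_zero]
    ext c
    simp only [Set.mem_ofPred_eq, Set.mem_empty_iff_false, iff_false, not_and]
    rintro ⟨hc, hc0⟩ hi
    exact h (hi ▸ (key c hc).mp hc0)

theorem weightCount_dual_evenPart (hC : IsBlockCode C) {i : ℕ} (h0 : 0 < i) (hi : i < 10) :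
    (evenPart C).dual.weightCount i = if i = 6 then 10 else 0 := by
  split_ifs with h
  · subst h
    have h1 : {c : Fin (3 * 20) → ZMod 2 | c ∈ (evenPart C).dual ∧ hammingNorm c = 6} =
        Set.range blockWord := by
      ext c
      constructor
      · rintro ⟨hc, hw⟩
        obtain ⟨b, rfl⟩ := hC.eq_blockWord_of_lt_ten hc
          (by rintro rfl; simp at hw) (by omega)
        exact ⟨b, rfl⟩
      · rintro ⟨b, rfl⟩
        exact ⟨hC.blockWord_mem_dual b, hammingNorm_blockWord b⟩
    rw [weightCount, h1, ← Set.image_univ, Set.ncard_image_of_injective, Set.ncard_univ,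
      Nat.card_eq_fintype_card, Fintype.card_fin]
    intro b b' hb
    have h2 := congrFun (congrArg blockCount hb) b
    rw [blockCount_blockWord, blockCount_blockWord, if_pos rfl] at h2
    by_contra h3
    rw [if_neg h3] at h2
    omega
  · rw [weightCount, Set.ncard_eq_zero]
    ext c
    simp only [Set.mem_ofPred_eq, Set.mem_empty_iff_false, iff_false, not_and]
    intro hc hw
    obtain ⟨b, rfl⟩ := hC.eq_blockWord_of_lt_ten hc
      (by rintro rfl; simp at hw; omega) (by omega)
    rw [hammingNorm_blockWord] at hw
    omega

end IsBlockCode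

theorem krawtchoukList_values :
    krawtchoukList 0 = [1, 60, 1770, 34220, 487635, 5461512, 50063860, 386206920, 2558620845] ∧
    krawtchoukList 12 = [1, 36, 618, 6708, 51411, 293688, 1282292, 4287096, 10636461] ∧
    krawtchoukList 14 = [1, 32, 482, 4512, 29107, 134848, 447524, 986304, 924429] ∧
    krawtchoukList 16 = [1, 28, 362, 2828, 14547, 49224, 93940, -11000, -672595] ∧
    krawtchoukList 18 = [1, 24, 258, 1592, 5811, 9744, -15260, -128880, -283635] ∧
    krawtchoukList 20 = [1, 20, 170, 740, 1235, -3496, -23180, -38760, 59565] ∧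
    krawtchoukList 22 = [1, 16, 98, 208, -589, -4256, -5852, 20064, 79629] ∧
    krawtchoukList 24 = [1, 12, 42, -68, -813, -1176, 5236, 18216, -8019] ∧
    krawtchoukList 26 = [1, 8, 2, -152, -333, 1200, 4708, -4048, -35827] ∧
    krawtchoukList 28 = [1, 4, -22, -108, 211, 1400, -1036, -11592, 1197] ∧
    krawtchoukList 30 = [1, 0, -30, 0, 435, 0, -4060, 0, 27405] ∧
    krawtchoukList 32 = [1, -4, -22, 108, 211, -1400, -1036, 11592, 1197] ∧
    krawtchoukList 34 = [1, -8, 2, 152, -333, -1200, 4708, 4048, -35827] ∧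
    krawtchoukList 36 = [1, -12, 42, 68, -813, 1176, 5236, -18216, -8019] ∧
    krawtchoukList 38 = [1, -16, 98, -208, -589, 4256, -5852, -20064, 79629] ∧
    krawtchoukList 40 = [1, -20, 170, -740, 1235, 3496, -23180, 38760, 59565] ∧
    krawtchoukList 42 = [1, -24, 258, -1592, 5811, -9744, -15260, 128880, -283635] ∧
    krawtchoukList 44 = [1, -28, 362, -2828, 14547, -49224, 93940, 11000, -672595] ∧
    krawtchoukList 46 = [1, -32, 482, -4512, 29107, -134848, 447524, -986304, 924429] ∧
    krawtchoukList 48 = [1, -36, 618, -6708, 51411, -293688, 1282292, -4287096, 10636461] ∧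
    krawtchoukList 60 =
      [1, -60, 1770, -34220, 487635, -5461512, 50063860, -386206920, 2558620845] := by
  decide +kernel

theorem sum_weightCount_mul_krawtchoukList (E : LinearCode (ZMod 2) (3 * 20)) {r : ℕ}
    (hr : r < 9) :
    ∑ i ∈ Finset.range 61, (E.weightCount i : ℤ) * (krawtchoukList i).getD r 0 =
      Nat.card E * E.dual.weightCount r := by
  rw [← sum_weightCount_mul_krawtchouk E (by omega)]
  refine Finset.sum_congr rfl fun i _ => ?_
  rw [← krawtchouk_eq i r hr]

namespace IsBlockCode

variable {C : LinearCode (ZMod 2) (3 * 20)}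

/-- Summation over the weights, using their symmetry under complementation. -/
theorem sum_weightCount_mul {M : Type*} [CommSemiring M] (hC : IsBlockCode C)
    (f : ℕ → M) :
    ∑ i ∈ Finset.range 61, (C.weightCount i : M) * f i =
      (f 0 + f 60) + C.weightCount 30 * f 30 +
      ∑ k ∈ Finset.range 9, C.weightCount (12 + 2 * k) * (f (12 + 2 * k) + f (48 - 2 * k)) := by
  have hodd : ∀ k, C.weightCount (2 * k + 1) = 0 := fun k =>
    hC.weightCount_eq_zero_of_odd (by omega)
  have hsym : ∀ k ≤ 60, C.weightCount k = C.weightCount (60 - k) := fun k hk =>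
    (hC.weightCount_sub hk).symm
  have hlow : ∀ k < 11, C.weightCount (k + 1) = 0 := fun k hk =>
    hC.weightCount_eq_zero_of_lt (by omega) (by omega)
  have a0 : C.weightCount 0 = 1 := weightCount_zero
  have a1 : C.weightCount 1 = 0 := hlow 0 (by norm_num)
  have a2 : C.weightCount 2 = 0 := hlow 1 (by norm_num)
  have a3 : C.weightCount 3 = 0 := hlow 2 (by norm_num)
  have a4 : C.weightCount 4 = 0 := hlow 3 (by norm_num)
  have a5 : C.weightCount 5 = 0 := hlow 4 (by norm_num)
  have a6 : C.weightCount 6 = 0 := hlow 5 (by norm_num)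
  have a7 : C.weightCount 7 = 0 := hlow 6 (by norm_num)
  have a8 : C.weightCount 8 = 0 := hlow 7 (by norm_num)
  have a9 : C.weightCount 9 = 0 := hlow 8 (by norm_num)
  have a10 : C.weightCount 10 = 0 := hlow 9 (by norm_num)
  have a11 : C.weightCount 11 = 0 := hlow 10 (by norm_num)
  have a13 : C.weightCount 13 = 0 := hodd 6
  have a15 : C.weightCount 15 = 0 := hodd 7
  have a17 : C.weightCount 17 = 0 := hodd 8
  have a19 : C.weightCount 19 = 0 := hodd 9
  have a21 : C.weightCount 21 = 0 := hodd 10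
  have a23 : C.weightCount 23 = 0 := hodd 11
  have a25 : C.weightCount 25 = 0 := hodd 12
  have a27 : C.weightCount 27 = 0 := hodd 13
  have a29 : C.weightCount 29 = 0 := hodd 14
  have a31 : C.weightCount 31 = 0 := hodd 15
  have a32 : C.weightCount 32 = C.weightCount 28 := hsym 32 (by norm_num)
  have a33 : C.weightCount 33 = 0 := hodd 16
  have a34 : C.weightCount 34 = C.weightCount 26 := hsym 34 (by norm_num)
  have a35 : C.weightCount 35 = 0 := hodd 17
  have a36 : C.weightCount 36 = C.weightCount 24 := hsym 36 (by norm_num)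
  have a37 : C.weightCount 37 = 0 := hodd 18
  have a38 : C.weightCount 38 = C.weightCount 22 := hsym 38 (by norm_num)
  have a39 : C.weightCount 39 = 0 := hodd 19
  have a40 : C.weightCount 40 = C.weightCount 20 := hsym 40 (by norm_num)
  have a41 : C.weightCount 41 = 0 := hodd 20
  have a42 : C.weightCount 42 = C.weightCount 18 := hsym 42 (by norm_num)
  have a43 : C.weightCount 43 = 0 := hodd 21
  have a44 : C.weightCount 44 = C.weightCount 16 := hsym 44 (by norm_num)
  have a45 : C.weightCount 45 = 0 := hodd 22
  have a46 : C.weightCount 46 = C.weightCount 14 := hsym 46 (by norm_num)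
  have a47 : C.weightCount 47 = 0 := hodd 23
  have a48 : C.weightCount 48 = C.weightCount 12 := hsym 48 (by norm_num)
  have a49 : C.weightCount 49 = 0 := hodd 24
  have a50 : C.weightCount 50 = 0 := (hsym 50 (by norm_num)).trans a10
  have a51 : C.weightCount 51 = 0 := hodd 25
  have a52 : C.weightCount 52 = 0 := (hsym 52 (by norm_num)).trans a8
  have a53 : C.weightCount 53 = 0 := hodd 26
  have a54 : C.weightCount 54 = 0 := (hsym 54 (by norm_num)).trans a6
  have a55 : C.weightCount 55 = 0 := hodd 27
  have a56 : C.weightCount 56 = 0 := (hsym 56 (by norm_num)).trans a4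
  have a57 : C.weightCount 57 = 0 := hodd 28
  have a58 : C.weightCount 58 = 0 := (hsym 58 (by norm_num)).trans a2
  have a59 : C.weightCount 59 = 0 := hodd 29
  have a60 : C.weightCount 60 = 1 := (hsym 60 (by norm_num)).trans a0
  simp only [Finset.sum_range_succ, Finset.sum_range_zero, a0, a1, a2, a3, a4, a5, a6, a7,
    a8, a9, a10, a11, a13, a15, a17, a19, a21, a23, a25, a27, a29, a31, a32, a33, a34, a35, a36,
    a37, a38, a39, a40, a41, a42, a43, a44, a45, a46, a47, a48, a49, a50, a51, a52, a53, a54, a55,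
    a56, a57, a58, a59, a60,
    Nat.cast_zero, Nat.cast_one, zero_mul, one_mul, add_zero, zero_add, mul_zero, mul_one]
  norm_num
  ring

theorem sum_weightCount_evenPart_mul (hC : IsBlockCode C) (f : ℕ → ℤ) :
    ∑ i ∈ Finset.range 61, ((evenPart C).weightCount i : ℤ) * f i =
      (f 0 + f 60) +
      ∑ k ∈ Finset.range 5, C.weightCount (12 + 4 * k) * (f (12 + 4 * k) + f (48 - 4 * k)) := by
  have h := hC.sum_weightCount_mul fun i => if 4 ∣ i then f i else 0
  have h1 : ∀ i, ((evenPart C).weightCount i : ℤ) * f i =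
      C.weightCount i * if 4 ∣ i then f i else 0 := by
    intro i
    rw [hC.weightCount_evenPart]
    split_ifs <;> simp
  simp only [h1]
  rw [h]
  simp [Finset.sum_range_succ]

set_option maxHeartbeats 1000000 in
/-- The numbers of codewords of all weights. The weights of the even part are divisible by four, so
that its coefficients `0, 2, …, 8` of the MacWilliams identity determine the numbers of words of
weight `12, 16, …, 28`. Those of the whole code give the remaining ones. -/
theorem weightCount_values (hC : IsBlockCode C) :
    (C.weightCount 12 = 3195 ∧ C.weightCount 16 = 284625 ∧ C.weightCount 20 = 7769400 ∧
      C.weightCount 24 = 67226760 ∧ C.weightCount 28 = 193151475) ∧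
    C.weightCount 14 = 29760 ∧ C.weightCount 18 = 1728000 ∧ C.weightCount 22 = 26392320 ∧
      C.weightCount 26 = 130060800 ∧ C.weightCount 30 = 220449152 := by
  obtain ⟨k0, k12, k14, k16, k18, k20, k22, k24, k26, k28, k30, k32, k34, k36, k38, k40, k42, k44,
    k46, k48, k60⟩ := krawtchoukList_values
  have heven : ∀ r < 9, _ := fun r hr =>
    (hC.sum_weightCount_evenPart_mul fun i => (krawtchoukList i).getD r 0).symm.trans
      (sum_weightCount_mul_krawtchoukList (evenPart C) hr)
  have hall : ∀ r < 9, _ := fun r hr =>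
    (hC.sum_weightCount_mul fun i => (krawtchoukList i).getD r 0).symm.trans
      (sum_weightCount_mul_krawtchoukList C hr)
  rw [hC.card_evenPart] at heven
  rw [hC.card, ← hC.selfDual] at hall
  have d0 : (evenPart C).dual.weightCount 0 = 1 := weightCount_zero
  have c0 : C.weightCount 0 = 1 := weightCount_zero
  have d2 := hC.weightCount_dual_evenPart (i := 2) (by norm_num) (by norm_num)
  have d4 := hC.weightCount_dual_evenPart (i := 4) (by norm_num) (by norm_num)
  have d6 := hC.weightCount_dual_evenPart (i := 6) (by norm_num) (by norm_num)
  have d8 := hC.weightCount_dual_evenPart (i := 8) (by norm_num) (by norm_num)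
  have c2 := hC.weightCount_eq_zero_of_lt (i := 2) (by norm_num) (by norm_num)
  have c4 := hC.weightCount_eq_zero_of_lt (i := 4) (by norm_num) (by norm_num)
  have c6 := hC.weightCount_eq_zero_of_lt (i := 6) (by norm_num) (by norm_num)
  have c8 := hC.weightCount_eq_zero_of_lt (i := 8) (by norm_num) (by norm_num)
  have e0 := heven 0 (by norm_num)
  have f0 := hall 0 (by norm_num)
  have e2 := heven 2 (by norm_num)
  have f2 := hall 2 (by norm_num)
  have e4 := heven 4 (by norm_num)
  have f4 := hall 4 (by norm_num)
  have e6 := heven 6 (by norm_num)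
  have f6 := hall 6 (by norm_num)
  have e8 := heven 8 (by norm_num)
  have f8 := hall 8 (by norm_num)
  clear heven hall
  simp only [Finset.sum_range_succ, Finset.sum_range_zero, d0, d2, d4, d6, d8, c0, c2, c4, c6, c8,
    k0, k12, k14, k16, k18, k20, k22, k24, k26, k28, k30, k32, k34, k36, k38, k40, k42, k44, k46, k48,
    k60] at e0 e2 e4 e6 e8 f0 f2 f4 f6 f8
  norm_num at e0 e2 e4 e6 e8 f0 f2 f4 f6 f8
  have b : (C.weightCount 12 : ℤ) = 3195 ∧ (C.weightCount 16 : ℤ) = 284625 ∧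
      (C.weightCount 20 : ℤ) = 7769400 ∧ (C.weightCount 24 : ℤ) = 67226760 ∧
      (C.weightCount 28 : ℤ) = 193151475 := by
    refine ⟨?_, ?_, ?_, ?_, ?_⟩ <;> linarith
  obtain ⟨b12, b16, b20, b24, b28⟩ := b
  rw [b12, b16, b20, b24, b28] at f0 f2 f4 f6 f8
  have b : (C.weightCount 14 : ℤ) = 29760 ∧ (C.weightCount 18 : ℤ) = 1728000 ∧
      (C.weightCount 22 : ℤ) = 26392320 ∧ (C.weightCount 26 : ℤ) = 130060800 ∧
      (C.weightCount 30 : ℤ) = 220449152 := by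
    refine ⟨?_, ?_, ?_, ?_, ?_⟩ <;> linarith
  obtain ⟨b14, b18, b22, b26, b30⟩ := b
  refine ⟨⟨?_, ?_, ?_, ?_, ?_⟩, ?_, ?_, ?_, ?_, ?_⟩ <;> omega

theorem weightEnumerator_eq (hC : IsBlockCode C) : C.weightEnumerator = W₃ := by
  obtain ⟨⟨b12, b16, b20, b24, b28⟩, b14, b18, b22, b26, b30⟩ := hC.weightCount_values
  have h := hC.sum_weightCount_mul fun i => (X ^ i : ℕ[X])
  have h1 : C.weightEnumerator = ∑ i ∈ Finset.range 61, (C.weightCount i : ℕ[X]) * X ^ i :=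
    Finset.sum_congr rfl fun i _ => by rw [← C_eq_natCast, Nat.cast_id]
  rw [h1, h]
  simp only [Finset.sum_range_succ, Finset.sum_range_zero, Nat.reduceMul, Nat.reduceAdd,
    Nat.reduceSub, b12, b14, b16, b18, b20, b22, b24, b26, b28, b30, W₃]
  push_cast
  ring

theorem isTypeI (hC : IsBlockCode C) : C.IsTypeI := by
  obtain ⟨u, hu, hu1⟩ := hC.exists_odd
  refine ⟨hC.selfDual, u, hu, fun h => ?_⟩
  have h1 := hC.mod_four u hu 0
  have h2 : blockCount u 0 % 2 = 0 := by omega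
  rw [sum_mul_blockWord, (ZMod.natCast_eq_zero_iff _ 2).mpr (Nat.dvd_of_mod_eq_zero h2)] at hu1
  exact zero_ne_one hu1

end IsBlockCode

/-! ### Bounding the automorphism group -/

/-- A permutation group with an invariant two-point function `f` is determined in its order, if
`f b` is injective (so that the stabilizer of `b` is trivial) and `f x x = f b b` happens only on
the orbit `O` of `b`. -/
theorem card_eq_of_invariant {α β : Type*} (G : Subgroup (Equiv.Perm α)) (f : α → α → β)
    (hf : ∀ σ ∈ G, ∀ x y, f (σ x) (σ y) = f x y) (b : α) (hb : Function.Injective (f b))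
    (O : Finset α) (hO : ∀ x ∈ O, ∃ σ ∈ G, σ b = x) (hn : ∀ x ∉ O, f x x ≠ f b b) :
    Nat.card G = O.card := by
  have hmem : ∀ σ ∈ G, σ b ∈ O := fun σ hσ => by
    by_contra h
    exact hn _ h (hf σ hσ b b)
  let e : G ≃ O := Equiv.ofBijective (fun σ => ⟨σ.1 b, hmem σ.1 σ.2⟩) ⟨?_, ?_⟩
  · rw [Nat.card_congr e, Nat.card_eq_fintype_card, Fintype.card_coe]
  · rintro ⟨σ, hσ⟩ ⟨τ, hτ⟩ h
    have h0 : σ b = τ b := congrArg Subtype.val h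
    rw [Subtype.mk.injEq]
    ext x
    have h1 := hf (σ⁻¹ * τ) (G.mul_mem (G.inv_mem hσ) hτ) b x
    have h2 : (σ⁻¹ * τ) b = b := by
      rw [Equiv.Perm.mul_apply, ← h0]
      exact σ.symm_apply_apply b
    rw [h2] at h1
    have h3 : σ.symm (τ x) = x := hb h1
    rw [← h3, σ.apply_symm_apply, h3]
  · rintro ⟨x, hx⟩
    obtain ⟨σ, hσ, h⟩ := hO x hx
    exact ⟨⟨σ, hσ⟩, Subtype.ext h⟩

section Invariance

variable {n : ℕ}

theorem comp_mem_of_mem_autGroup {F : Type} [Field F] {C : LinearCode F n}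
    {σ : Equiv.Perm (Fin n)} (hσ : σ ∈ C.autGroup) {c : Fin n → F} (hc : c ∈ C) : c ∘ σ ∈ C :=
  (hσ c).mp hc

theorem mem_autGroup_of_forall {C : LinearCode (ZMod 2) n} {σ : Equiv.Perm (Fin n)}
    (h : ∀ c ∈ C, c ∘ σ ∈ C) : σ ∈ C.autGroup := by
  have h1 : Function.Bijective fun c : C => (⟨c.1 ∘ σ, h c.1 c.2⟩ : C) := by
    refine Finite.injective_iff_bijective.mp fun a b hab => ?_
    rw [Subtype.mk.injEq] at hab
    exact Subtype.ext (σ.surjective.injective_comp_right hab)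
  refine fun c => ⟨h c, fun hc => ?_⟩
  obtain ⟨⟨d, hd⟩, hdc⟩ := h1.2 ⟨c ∘ σ, hc⟩
  rw [Subtype.mk.injEq] at hdc
  rwa [← σ.surjective.injective_comp_right hdc]

theorem mem_autGroup_dual {C : LinearCode (ZMod 2) n} {σ : Equiv.Perm (Fin n)}
    (hσ : σ ∈ C.autGroup) : σ ∈ C.dual.autGroup := by
  refine mem_autGroup_of_forall fun d hd c hc => ?_
  have h1 : c ∘ ⇑σ⁻¹ ∈ C := comp_mem_of_mem_autGroup (C.autGroup.inv_mem hσ) hc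
  have h2 := hd _ h1
  rw [← sum_mul_comp_perm _ _ σ, Function.comp_assoc, ← Equiv.Perm.coe_mul, inv_mul_cancel] at h2
  exact h2

end Invariance

/-- The words of weight ten in the dual of the even part of `C` which meet all blocks evenly. This
set is invariant under the automorphisms of `C`. -/
noncomputable def tenWords (C : LinearCode (ZMod 2) (3 * 20)) :
    Finset (Fin (3 * 20) → ZMod 2) := by
  classical
  exact Finset.univ.filter fun d =>
    d ∈ (evenPart C).dual ∧ (∀ b, blockCount d b % 2 = 0) ∧ hammingNorm d = 10

theorem mem_tenWords {C : LinearCode (ZMod 2) (3 * 20)} {d : Fin (3 * 20) → ZMod 2} :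
    d ∈ tenWords C ↔
      d ∈ (evenPart C).dual ∧ (∀ b, blockCount d b % 2 = 0) ∧ hammingNorm d = 10 := by
  simp [tenWords]

/-- The number of coordinates in which two binary words are both nonzero. -/
def overlap (d e : Fin (3 * 20) → ZMod 2) : ℕ := ∑ p, (d p).val * (e p).val

/-- The total overlap of `d` with the words of `H` through the coordinate `x`. -/
def overlapAt (H : Finset (Fin (3 * 20) → ZMod 2)) (x : Fin (3 * 20))
    (d : Fin (3 * 20) → ZMod 2) : ℕ :=
  ∑ e ∈ H, if e x = 1 then overlap d e else 0

/-- An arbitrary nonlinear function, which makes the invariant `profile` discriminating. -/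
def scramble (s : ℕ) : ℕ := (s * s + 1) * (s + 7) % 1000003

/-- A two-point invariant of a set `H` of words: the sum, over the words of `H` through `y`, of
their scrambled total overlap with the words of `H` through `x`. -/
def profile (H : Finset (Fin (3 * 20) → ZMod 2)) (x y : Fin (3 * 20)) : ℕ :=
  ∑ d ∈ H, if d y = 1 then scramble (overlapAt H x d) else 0

section Profile

variable {H : Finset (Fin (3 * 20) → ZMod 2)} {σ : Equiv.Perm (Fin (3 * 20))}

theorem sum_comp_of_invariant {M : Type*} [AddCommMonoid M] (hσ : ∀ d ∈ H, d ∘ σ ∈ H)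
    (f : (Fin (3 * 20) → ZMod 2) → M) : ∑ d ∈ H, f (d ∘ σ) = ∑ d ∈ H, f d := by
  classical
  have hinj : Function.Injective fun d : Fin (3 * 20) → ZMod 2 => d ∘ σ :=
    σ.surjective.injective_comp_right
  have himg : H.image (fun d => d ∘ σ) = H :=
    Finset.eq_of_subset_of_card_le (Finset.image_subset_iff.mpr hσ)
      (Finset.card_image_of_injective H hinj).ge
  conv_rhs => rw [← himg]
  rw [Finset.sum_image hinj.injOn]

theorem overlapAt_comp (hσ : ∀ d ∈ H, d ∘ σ ∈ H) (x : Fin (3 * 20))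
    (d : Fin (3 * 20) → ZMod 2) : overlapAt H x (d ∘ σ) = overlapAt H (σ x) d := by
  rw [overlapAt, ← sum_comp_of_invariant hσ]
  refine Finset.sum_congr rfl fun e _ => ?_
  have h : overlap (d ∘ σ) (e ∘ σ) = overlap d e :=
    Equiv.sum_comp σ fun p => (d p).val * (e p).val
  rw [h]
  rfl

theorem profile_comp (hσ : ∀ d ∈ H, d ∘ σ ∈ H) (x y : Fin (3 * 20)) :
    profile H (σ x) (σ y) = profile H x y := by
  conv_rhs => rw [profile, ← sum_comp_of_invariant hσ]
  refine Finset.sum_congr rfl fun d _ => ?_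
  rw [overlapAt_comp hσ]
  rfl

end Profile

namespace IsBlockCode

variable {C : LinearCode (ZMod 2) (3 * 20)}

theorem mem_evenPart_iff (hC : IsBlockCode C) {c : Fin (3 * 20) → ZMod 2} :
    c ∈ evenPart C ↔ c ∈ C ∧ 4 ∣ hammingNorm c := by
  change (c ∈ C ∧ ∑ p, c p * blockWord 0 p = 0) ↔ _
  rw [sum_mul_blockWord, ZMod.natCast_eq_zero_iff]
  constructor
  · rintro ⟨hc, h⟩
    have := hC.mod_four c hc 0
    exact ⟨hc, by omega⟩
  · rintro ⟨hc, h⟩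
    have := hC.mod_four c hc 0
    exact ⟨hc, by omega⟩

theorem mem_autGroup_evenPart (hC : IsBlockCode C) {σ : Equiv.Perm (Fin (3 * 20))}
    (hσ : σ ∈ C.autGroup) : σ ∈ (evenPart C).autGroup := by
  refine mem_autGroup_of_forall fun c hc => ?_
  rw [hC.mem_evenPart_iff] at hc ⊢
  rw [hammingNorm_comp_perm]
  exact ⟨comp_mem_of_mem_autGroup hσ hc.1, hc.2⟩

/-- Automorphisms permute the blocks, since these are the words of weight six in the shadow. -/
theorem exists_blockWord_comp (hC : IsBlockCode C) {σ : Equiv.Perm (Fin (3 * 20))}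
    (hσ : σ ∈ C.autGroup) (b : Fin 10) : ∃ b', blockWord b ∘ σ = blockWord b' := by
  have h1 := comp_mem_of_mem_autGroup (mem_autGroup_dual (hC.mem_autGroup_evenPart hσ))
    (hC.blockWord_mem_dual b)
  have h2 : hammingNorm (blockWord b ∘ σ) = 6 := by
    rw [hammingNorm_comp_perm, hammingNorm_blockWord]
  refine hC.eq_blockWord_of_lt_ten h1 ?_ (by omega)
  intro h0
  rw [h0] at h2
  simp at h2

set_option maxRecDepth 5000 in
theorem comp_mem_tenWords (hC : IsBlockCode C) {σ : Equiv.Perm (Fin (3 * 20))}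
    (hσ : σ ∈ C.autGroup) : ∀ d ∈ tenWords C, d ∘ σ ∈ tenWords C := by
  intro d hd
  rw [mem_tenWords] at hd ⊢
  refine ⟨comp_mem_of_mem_autGroup (mem_autGroup_dual (hC.mem_autGroup_evenPart hσ)) hd.1, ?_, ?_⟩
  · intro b
    obtain ⟨b', hb'⟩ := hC.exists_blockWord_comp (C.autGroup.inv_mem hσ) b
    have h1 := hd.2.1 b'
    rw [← Nat.dvd_iff_mod_eq_zero, ← ZMod.natCast_eq_zero_iff, ← sum_mul_blockWord] at h1 ⊢
    rw [← h1, ← hb', ← sum_mul_comp_perm d _ σ, Function.comp_assoc, ← Equiv.Perm.coe_mul,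
      inv_mul_cancel]
    rfl
  · rw [hammingNorm_comp_perm, hd.2.2]

set_option maxRecDepth 5000 in
theorem profile_autGroup (hC : IsBlockCode C) {σ : Equiv.Perm (Fin (3 * 20))}
    (hσ : σ ∈ C.autGroup) (x y : Fin (3 * 20)) :
    profile (tenWords C) (σ x) (σ y) = profile (tenWords C) x y :=
  profile_comp (hC.comp_mem_tenWords hσ) x y

end IsBlockCode

/-! ### Binary words as natural numbers -/

/-- The word whose coordinates are the binary digits of `x`. -/
def word (x : ℕ) : Fin (3 * 20) → ZMod 2 := fun p => if x.testBit p.val then 1 else 0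

theorem word_eq_one {x : ℕ} {p : Fin (3 * 20)} : word x p = 1 ↔ x.testBit p.val = true := by
  simp [word]

theorem word_xor (x y : ℕ) : word (x ^^^ y) = word x + word y := by
  ext p
  simp only [word, Nat.testBit_xor, Pi.add_apply]
  cases x.testBit p.val <;> cases y.testBit p.val <;> rfl

theorem word_land (x y : ℕ) (p : Fin (3 * 20)) : word (x &&& y) p = word x p * word y p := by
  simp only [word, Nat.testBit_land]
  cases x.testBit p.val <;> cases y.testBit p.val <;> rfl

theorem word_zero : word 0 = 0 := by
  ext p
  simp [word]

theorem exists_word (c : Fin (3 * 20) → ZMod 2) : ∃ x, word x = c := by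
  refine ⟨Nat.ofBits fun p : Fin (3 * 20) => decide (c p = 1), ?_⟩
  ext p
  have h : ∀ a : ZMod 2, (if decide (a = 1) = true then (1 : ZMod 2) else 0) = a := by decide
  rw [word, Nat.testBit_ofBits_lt _ _ p.isLt]
  exact h (c p)

theorem word_injOn {x y : ℕ} (hx : x < 2 ^ 60) (hy : y < 2 ^ 60) (h : word x = word y) :
    x = y := by
  apply Nat.eq_of_testBit_eq
  intro i
  by_cases hi : i < 60
  · have h1 := congrFun h ⟨i, hi⟩
    simp only [word] at h1
    cases hxi : x.testBit i <;> cases hyi : y.testBit i <;> simp [hxi, hyi] at h1 ⊢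
  · rw [Nat.testBit_lt_two_pow (hx.trans_le (Nat.pow_le_pow_right (by norm_num) (by omega))),
      Nat.testBit_lt_two_pow (hy.trans_le (Nat.pow_le_pow_right (by norm_num) (by omega)))]

/-- The number of nonzero binary digits of `m < 64`, by table lookup. -/
def popSix (m : ℕ) : ℕ :=
  Nat.mod (Nat.shiftRight 0x6554544354434332544343324332322154434332433232214332322132212110
    (Nat.mul 4 m)) 16

/-- The six digits of `x` in block `b`. -/
def digits (x b : ℕ) : ℕ := Nat.mod (Nat.shiftRight x (Nat.mul 6 b)) 64

/-- The number of nonzero digits of `x` in block `b`. -/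
def count (x b : ℕ) : ℕ := popSix (digits x b)

/-- The number of nonzero digits of `x` among the first sixty. -/
def weight (x : ℕ) : ℕ :=
  count x 0 + count x 1 + count x 2 + count x 3 + count x 4 + count x 5 + count x 6 + count x 7 +
    count x 8 + count x 9

/-- The indicator of a block, as a number. -/
def blockNat (b : ℕ) : ℕ := Nat.shiftLeft 63 (Nat.mul 6 b)

theorem popSix_eq : ∀ m < 64, popSix m = (m.testBit 0).toNat + (m.testBit 1).toNat +
    (m.testBit 2).toNat + (m.testBit 3).toNat + (m.testBit 4).toNat + (m.testBit 5).toNat := by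
  decide +kernel

theorem digits_lt (x b : ℕ) : digits x b < 64 := Nat.mod_lt _ (by norm_num)

theorem testBit_digits (x b : ℕ) {k : ℕ} (hk : k < 6) :
    (digits x b).testBit k = x.testBit (6 * b + k) := by
  change ((x >>> (6 * b)) % 2 ^ 6).testBit k = _
  rw [Nat.testBit_mod_two_pow, Nat.testBit_shiftRight]
  simp [hk]

theorem digits_xor (x y b : ℕ) : digits (x ^^^ y) b = digits x b ^^^ digits y b := by
  change ((x ^^^ y) >>> (6 * b)) % 2 ^ 6 = ((x >>> (6 * b)) % 2 ^ 6) ^^^ ((y >>> (6 * b)) % 2 ^ 6)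
  rw [Nat.shiftRight_xor_distrib, Nat.xor_mod_two_pow]

theorem blockCount_word (x : ℕ) (b : Fin 10) : blockCount (word x) b = count x b := by
  rw [count, popSix_eq _ (digits_lt x b), testBit_digits x b (by norm_num : 0 < 6),
    testBit_digits x b (by norm_num : 1 < 6), testBit_digits x b (by norm_num : 2 < 6),
    testBit_digits x b (by norm_num : 3 < 6), testBit_digits x b (by norm_num : 4 < 6),
    testBit_digits x b (by norm_num : 5 < 6)]
  have h : ∀ k : Fin 6, (word x (point b k)).val = (x.testBit (6 * b.val + k.val)).toNat := by
    intro k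
    have e : ∀ t : Bool, (if t = true then (1 : ZMod 2) else 0).val = t.toNat := by decide
    exact e _
  simp only [blockCount, h, Fin.sum_univ_six]
  rfl

theorem hammingNorm_word (x : ℕ) : hammingNorm (word x) = weight x := by
  rw [hammingNorm_eq_sum_blockCount]
  simp only [blockCount_word, weight, Fin.sum_univ_succ, Fin.sum_univ_zero]
  simp only [Fin.val_zero, Fin.val_succ]
  ring_nf

theorem overlap_word (x y : ℕ) : overlap (word x) (word y) = weight (x &&& y) := by
  rw [← hammingNorm_word, hammingNorm_eq_sum_val]
  refine Finset.sum_congr rfl fun p _ => ?_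
  rw [word_land]
  have h : ∀ a b : ZMod 2, a.val * b.val = (a * b).val := by decide
  exact h _ _

theorem sum_word_mul_word (x y : ℕ) : ∑ p, word x p * word y p = (weight (x &&& y) : ℕ) := by
  rw [← overlap_word, overlap, cast_sum_val_mul]

theorem word_blockNat (b : Fin 10) : word (blockNat b) = blockWord b := by
  ext p
  have h : ∀ b : Fin 10, ∀ p : Fin (3 * 20), word (blockNat b) p = blockWord b p := by
    decide +kernel
  rw [h]

/-! ### Words that are constant on blocks -/

/-- A word is flat on a block if it is constant there. -/
def FlatOn (c : Fin (3 * 20) → ZMod 2) (b : Fin 10) : Prop := ∀ k, c (point b k) = c (point b 0)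

/-- The inner product of two words on a block. -/
def innerOn (c d : Fin (3 * 20) → ZMod 2) (b : Fin 10) : ZMod 2 :=
  ∑ k, c (point b k) * d (point b k)

theorem FlatOn.add {c d : Fin (3 * 20) → ZMod 2} {b : Fin 10} (hc : FlatOn c b)
    (hd : FlatOn d b) : FlatOn (c + d) b := fun k => by
  rw [Pi.add_apply, Pi.add_apply, hc, hd]

theorem FlatOn.of_add {c d : Fin (3 * 20) → ZMod 2} {b : Fin 10} (hc : FlatOn (c + d) b)
    (hd : FlatOn d b) : FlatOn c b := by
  have h := hc.add hd
  rwa [add_assoc, add_self_binary, add_zero] at h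

theorem FlatOn.blockCount_eq {c : Fin (3 * 20) → ZMod 2} {b : Fin 10} (hc : FlatOn c b) :
    blockCount c b = 6 * (c (point b 0)).val := by
  simp only [blockCount, hc _]
  simp

theorem flatOn_iff {c : Fin (3 * 20) → ZMod 2} {b : Fin 10} :
    FlatOn c b ↔ blockCount c b = 0 ∨ blockCount c b = 6 := by
  have h : ∀ v : Fin 6 → ZMod 2,
      (∀ k, v k = v 0) ↔ (∑ k, (v k).val = 0 ∨ ∑ k, (v k).val = 6) := by decide +kernel
  exact h fun k => c (point b k)

theorem flatOn_blockWord (b b' : Fin 10) : FlatOn (blockWord b) b' := fun k => by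
  simp [blockWord]

theorem cast_blockCount (c : Fin (3 * 20) → ZMod 2) (b : Fin 10) :
    ((blockCount c b : ℕ) : ZMod 2) = ∑ k, c (point b k) := by
  rw [blockCount]
  push_cast
  simp

theorem innerOn_add (c d e : Fin (3 * 20) → ZMod 2) (b : Fin 10) :
    innerOn c (d + e) b = innerOn c d b + innerOn c e b := by
  simp only [innerOn, Pi.add_apply, mul_add, Finset.sum_add_distrib]

theorem innerOn_comm (c d : Fin (3 * 20) → ZMod 2) (b : Fin 10) :
    innerOn c d b = innerOn d c b :=
  Finset.sum_congr rfl fun _ _ => mul_comm _ _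

theorem innerOn_eq_zero {c d : Fin (3 * 20) → ZMod 2} {b : Fin 10} (hc : blockCount c b % 2 = 0)
    (hd : FlatOn d b) : innerOn c d b = 0 := by
  simp only [innerOn, hd _]
  rw [← Finset.sum_mul, ← cast_blockCount,
    (ZMod.natCast_eq_zero_iff _ 2).mpr (Nat.dvd_of_mod_eq_zero hc), zero_mul]

theorem sum_mul_eq_sum_innerOn (c d : Fin (3 * 20) → ZMod 2) :
    ∑ p, c p * d p = ∑ b, innerOn c d b :=
  sum_eq_sum_point _

/-- A word that is flat on all blocks is a sum of blocks. -/
theorem eq_sum_blockWord {c : Fin (3 * 20) → ZMod 2} (hc : ∀ b, FlatOn c b) :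
    c = ∑ b, c (point b 0) • blockWord b := by
  ext p
  obtain ⟨k, hk⟩ := exists_eq_point p
  rw [Finset.sum_apply, Finset.sum_eq_single (blockOf p)]
  · rw [hk, hc]
    simp [blockWord]
  · intro b _ hb
    simp [blockWord, hb.symm]
  · simp

/-! ### Verification of a block code by enumeration -/

/-- Generators of a block code in systematic form: for every block four words, which are flat on
the other blocks of the same half (the halves being the blocks `0, …, 4` and `5, …, 9`), and a word
meeting all blocks oddly. Thus the code is generated by `odd`, the sums of two blocks and the words
belonging to one half, while the words belonging to the other half are a second system. -/
structure BlockData where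
  /-- For every block, the list of its generators. -/
  gens : List (List ℕ)
  /-- A word meeting all blocks oddly. -/
  odd : ℕ

/-- All sums of the words of a list. -/
def sums (l : List ℕ) : List ℕ := l.foldr (fun g acc => acc ++ acc.map (Nat.xor g)) [0]

/-- Whether six digits are all equal. -/
def flatDigits (m : ℕ) : Bool := Nat.beq m 0 || Nat.beq m 63

/-- The number of blocks on which a word is not flat. -/
def active (x : ℕ) : ℕ :=
  (bif flatDigits (digits x 0) then 0 else 1) + (bif flatDigits (digits x 1) then 0 else 1) +
  (bif flatDigits (digits x 2) then 0 else 1) + (bif flatDigits (digits x 3) then 0 else 1) +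
  (bif flatDigits (digits x 4) then 0 else 1) + (bif flatDigits (digits x 5) then 0 else 1) +
  (bif flatDigits (digits x 6) then 0 else 1) + (bif flatDigits (digits x 7) then 0 else 1) +
  (bif flatDigits (digits x 8) then 0 else 1) + (bif flatDigits (digits x 9) then 0 else 1)

/-- Whether a sum of an even number of blocks can be added to `x` such that the result meets
every block in one coordinate. -/
def isTransversal (x : ℕ) : Bool :=
  ((List.range 10).all fun b => Nat.beq (count x b) 1 || Nat.beq (count x b) 5) &&
    Nat.beq (Nat.mod (weight x) 8) 2

/-- Whether no sum of `x` and one word of each list is a transversal. -/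
def noTransversal : List (List ℕ) → ℕ → Bool
  | [], x => !isTransversal x
  | l :: ls, x => l.all fun t => noTransversal ls (Nat.xor x t)

/-- The pairs of distinct blocks in the same half. -/
def halfPairs : List (Fin 10 × Fin 10) :=
  [(0, 1), (0, 2), (0, 3), (0, 4), (1, 2), (1, 3), (1, 4), (2, 3), (2, 4), (3, 4),
    (5, 6), (5, 7), (5, 8), (5, 9), (6, 7), (6, 8), (6, 9), (7, 8), (7, 9), (8, 9)]

namespace BlockData

variable (D : BlockData)

/-- The generators belonging to a block. -/
def gensAt (b : ℕ) : List ℕ := D.gens.getD b []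

/-- All sums of the generators belonging to a block. -/
def sumsAt (b : ℕ) : List ℕ := sums (D.gensAt b)

/-- The words generating the code: the odd word, the sums of two blocks, and the generators
belonging to the first half. -/
def basic : List ℕ :=
  D.odd :: ((List.range 10).map fun b => Nat.xor (blockNat b) (blockNat 0)) ++
    (List.range 5).flatMap D.gensAt

/-- The words `basic` and the generators belonging to the second half, which lie in the same
code. -/
def words : List ℕ := D.basic ++ (List.range' 5 5).flatMap D.gensAt

/-- The code generated by the words of a `BlockData`. -/
def code : LinearCode (ZMod 2) (3 * 20) := Submodule.span (ZMod 2) (word '' {x | x ∈ D.words})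

/-- Whether any two generating words are orthogonal. -/
def orthogonalCheck : Bool :=
  D.words.all fun x => D.words.all fun y => Nat.beq (Nat.mod (weight (Nat.land x y)) 2) 0

/-- Whether the weights of the generating words are, modulo four, twice their weights on every
block. -/
def weightCheck : Bool :=
  D.words.all fun x => (List.range 10).all fun b =>
    Nat.beq (Nat.mod (weight x) 4) (Nat.mul 2 (Nat.mod (count x b) 2))

/-- Whether the generators belonging to blocks meet all blocks evenly. -/
def evenCheck : Bool :=
  (List.range 10).all fun b => (D.gensAt b).all fun x => (List.range 10).all fun b' =>
    Nat.beq (Nat.mod (count x b') 2) 0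

/-- Whether the generators belonging to a block are flat on the other blocks of its half. -/
def flatCheck : Bool :=
  (List.range 10).all fun b => (D.gensAt b).all fun x => (List.range 10).all fun b' =>
    Nat.beq b b' || !Nat.beq (Nat.div b 5) (Nat.div b' 5) || flatDigits (digits x b')

/-- Whether every even pattern on a block is that of a sum of the generators, up to
complementation. -/
def coverCheck : Bool :=
  (List.range 10).all fun b => (List.range 64).all fun m =>
    Nat.beq (Nat.mod (popSix m) 2) 1 ||
      (D.sumsAt b).any fun x => flatDigits (Nat.xor m (digits x b))

/-- Whether the sums of generators belonging to two blocks of the same half have no or at least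
five active blocks. -/
def activeCheck : Bool :=
  halfPairs.all fun ij => (D.sumsAt ij.1).all fun x => (D.sumsAt ij.2).all fun y =>
    Nat.beq (active (Nat.xor x y)) 0 || Nat.ble 5 (active (Nat.xor x y))

/-- The sums of the generators belonging to a block which turn the odd word into a word that is,
up to complementation, a single coordinate of the block. -/
def singles (b : ℕ) : List ℕ :=
  (D.sumsAt b).filter fun t => (List.range 6).any fun k =>
    flatDigits (Nat.xor (Nat.xor (digits D.odd b) (digits t b)) (Nat.shiftLeft 1 k))

/-- Whether no codeword meets every block in one coordinate. The blocks of the second half are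
treated one after the other. -/
def transversalCheck : Bool := noTransversal ((List.range' 5 5).map D.singles) D.odd

/-- The conditions under which `BlockData.code` is a block code. -/
def check : Bool :=
  D.orthogonalCheck && D.weightCheck && Nat.beq (Nat.mod (count D.odd 0) 2) 1 && D.evenCheck &&
    D.flatCheck && D.coverCheck && D.activeCheck && D.transversalCheck

end BlockData

theorem sums_induction {P : ℕ → Prop} {l : List ℕ} (h0 : P 0)
    (h : ∀ g ∈ l, ∀ x, P x → P (g ^^^ x)) : ∀ x ∈ sums l, P x := by
  induction l with
  | nil =>
    intro x hx
    rw [List.mem_singleton.mp hx]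
    exact h0
  | cons g l ih =>
    intro x hx
    have ih' := ih fun g' hg' => h g' (List.mem_cons_of_mem _ hg')
    change x ∈ sums l ++ (sums l).map (Nat.xor g) at hx
    rw [List.mem_append, List.mem_map] at hx
    rcases hx with hx | ⟨y, hy, rfl⟩
    · exact ih' x hx
    · exact h g List.mem_cons_self y (ih' y hy)

theorem flatDigits_iff : ∀ m < 64, (flatDigits m = true ↔ popSix m = 0 ∨ popSix m = 6) := by
  decide +kernel

theorem flatDigits_digits (x : ℕ) (b : Fin 10) :
    flatDigits (digits x b) = true ↔ FlatOn (word x) b := by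
  rw [flatDigits_iff _ (digits_lt x b), flatOn_iff, blockCount_word]
  rfl

theorem active_eq (x : ℕ) :
    active x = ∑ b : Fin 10, bif flatDigits (digits x b) then 0 else 1 := by
  simp only [active, Fin.sum_univ_succ, Fin.sum_univ_zero]
  simp only [Fin.val_zero, Fin.val_succ]
  ring_nf

namespace BlockData

/-- The properties of a `BlockData` established by `BlockData.check`. -/
structure Valid (D : BlockData) : Prop where
  orthogonal : ∀ x ∈ D.words, ∀ y ∈ D.words, ∑ p, word x p * word y p = 0
  mod_four : ∀ x ∈ D.words, ∀ b : Fin 10,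
    hammingNorm (word x) % 4 = 2 * (blockCount (word x) b % 2)
  odd : ∀ b : Fin 10, blockCount (word D.odd) b % 2 = 1
  even : ∀ b : Fin 10, ∀ x ∈ D.gensAt b, ∀ b', blockCount (word x) b' % 2 = 0
  flat : ∀ b : Fin 10, ∀ x ∈ D.gensAt b, ∀ b' : Fin 10, b ≠ b' → b.val / 5 = b'.val / 5 →
    FlatOn (word x) b'
  cover : ∀ (b : Fin 10) (c : Fin (3 * 20) → ZMod 2), blockCount c b % 2 = 0 →
    ∃ x ∈ D.sumsAt b, FlatOn (c + word x) b
  active : ∀ ij ∈ halfPairs, ∀ x ∈ D.sumsAt ij.1.val, ∀ y ∈ D.sumsAt ij.2.val,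
    active (x ^^^ y) = 0 ∨ 5 ≤ active (x ^^^ y)
  transversal : noTransversal ((List.range' 5 5).map D.singles) D.odd = true

theorem valid_of_check {D : BlockData} (h : D.check = true) : D.Valid := by
  simp only [check, Bool.and_eq_true] at h
  obtain ⟨⟨⟨⟨⟨⟨⟨h1, h2⟩, h3⟩, h4⟩, h5⟩, h6⟩, h7⟩, h8⟩ := h
  have hodd : D.odd ∈ D.words := List.mem_append_left _ (List.mem_append_left _ List.mem_cons_self)
  have h2' : ∀ x ∈ D.words, ∀ b : Fin 10,
      hammingNorm (word x) % 4 = 2 * (blockCount (word x) b % 2) := by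
    intro x hx b
    simp only [weightCheck, List.all_eq_true, List.mem_range, Nat.beq_eq] at h2
    rw [hammingNorm_word, blockCount_word]
    exact h2 x hx b b.isLt
  refine ⟨?_, h2', ?_, ?_, ?_, ?_, ?_, h8⟩
  · intro x hx y hy
    simp only [orthogonalCheck, List.all_eq_true, Nat.beq_eq] at h1
    rw [sum_word_mul_word, ZMod.natCast_eq_zero_iff]
    exact Nat.dvd_of_mod_eq_zero (h1 x hx y hy)
  · intro b
    rw [Nat.beq_eq] at h3
    have e0 := h2' _ hodd 0
    have e1 := h2' _ hodd b
    rw [blockCount_word _ 0] at e0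
    have e2 : count D.odd (0 : Fin 10).val % 2 = 1 := h3
    omega
  · intro b x hx b'
    simp only [evenCheck, List.all_eq_true, List.mem_range, Nat.beq_eq] at h4
    rw [blockCount_word]
    exact h4 b b.isLt x hx b' b'.isLt
  · intro b x hx b' hne hb
    simp only [flatCheck, List.all_eq_true, List.mem_range, Bool.or_eq_true, Bool.not_eq_true',
      Nat.beq_eq, ← Bool.not_eq_true] at h5
    rcases h5 b b.isLt x hx b' b'.isLt with (h | h) | h
    · exact absurd (Fin.ext h) hne
    · exact absurd hb h
    · rwa [← flatDigits_digits]
  · intro b c hc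
    obtain ⟨y, rfl⟩ := exists_word c
    simp only [coverCheck, List.all_eq_true, List.mem_range, Bool.or_eq_true, Nat.beq_eq,
      List.any_eq_true] at h6
    rw [blockCount_word] at hc
    rcases h6 b b.isLt (digits y b) (digits_lt y b) with h | ⟨x, hx, h⟩
    · have h' : count y b % 2 = 1 := h
      omega
    · refine ⟨x, hx, ?_⟩
      rw [← word_xor, ← flatDigits_digits, digits_xor]
      exact h
  · intro ij hij x hx y hy
    simp only [activeCheck, List.all_eq_true, Bool.or_eq_true, Nat.beq_eq, Nat.ble_eq] at h7
    exact h7 ij hij x hx y hy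

namespace Valid

variable {D : BlockData}

theorem even_sums (hD : D.Valid) {b : Fin 10} {x : ℕ} (hx : x ∈ D.sumsAt b) (b' : Fin 10) :
    blockCount (word x) b' % 2 = 0 := by
  refine sums_induction (P := fun x => blockCount (word x) b' % 2 = 0) ?_ ?_ x hx
  · rw [word_zero]
    simp [blockCount]
  · intro g hg y hy
    have h := hD.even b g hg b'
    rw [word_xor, blockCount_add_mod_two]
    omega

theorem flat_sums (hD : D.Valid) {b : Fin 10} {x : ℕ} (hx : x ∈ D.sumsAt b) {b' : Fin 10}
    (hne : b ≠ b') (hb : b.val / 5 = b'.val / 5) : FlatOn (word x) b' := by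
  refine sums_induction (P := fun x => FlatOn (word x) b') ?_ ?_ x hx
  · rw [word_zero]
    exact fun _ => rfl
  · intro g hg y hy
    rw [word_xor]
    exact (hD.flat b g hg b' hne hb).add hy

theorem word_mem {x : ℕ} (hx : x ∈ D.words) : word x ∈ D.code :=
  Submodule.subset_span ⟨x, hx, rfl⟩

theorem gensAt_subset {b : Fin 10} {x : ℕ} (hx : x ∈ D.gensAt b) : x ∈ D.words := by
  by_cases hb : b.val < 5
  · exact List.mem_append_left _ (List.mem_append_right _
      (List.mem_flatMap.mpr ⟨b, List.mem_range.mpr hb, hx⟩))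
  · exact List.mem_append_right _ (List.mem_flatMap.mpr ⟨b, by
      rw [List.mem_range'_1]
      omega, hx⟩)

theorem sums_mem {M : Submodule (ZMod 2) (Fin (3 * 20) → ZMod 2)} {b : Fin 10}
    (hM : ∀ x ∈ D.gensAt b, word x ∈ M) {x : ℕ} (hx : x ∈ D.sumsAt b) : word x ∈ M := by
  refine sums_induction (P := fun x => word x ∈ M) ?_ ?_ x hx
  · rw [word_zero]
    exact M.zero_mem
  · intro g hg y hy
    rw [word_xor]
    exact M.add_mem (hM g hg) hy

/-- Every even word can be made flat on the blocks of one half by adding generators belonging to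
these blocks. -/
theorem exists_flat (hD : D.Valid) {M : Submodule (ZMod 2) (Fin (3 * 20) → ZMod 2)} (h : ℕ)
    (hM : ∀ b : Fin 10, b.val / 5 = h → ∀ x ∈ D.gensAt b, word x ∈ M)
    {c : Fin (3 * 20) → ZMod 2} (hc : ∀ b, blockCount c b % 2 = 0) :
    ∃ w ∈ M, (∀ b, blockCount (c + w) b % 2 = 0) ∧
      ∀ b : Fin 10, b.val / 5 = h → FlatOn (c + w) b := by
  suffices H : ∀ s : Finset (Fin 10), ∃ w ∈ M, (∀ b, blockCount (c + w) b % 2 = 0) ∧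
      ∀ b ∈ s, b.val / 5 = h → FlatOn (c + w) b by
    obtain ⟨w, hw, h1, h2⟩ := H Finset.univ
    exact ⟨w, hw, h1, fun b => h2 b (Finset.mem_univ b)⟩
  intro s
  induction s using Finset.induction_on with
  | empty => exact ⟨0, M.zero_mem, by simpa using hc, by simp⟩
  | insert b s hb ih =>
    obtain ⟨w, hw, h1, h2⟩ := ih
    by_cases hbh : b.val / 5 = h
    · obtain ⟨x, hx, hxf⟩ := hD.cover b (c + w) (h1 b)
      refine ⟨w + word x, M.add_mem hw (sums_mem (hM b hbh) hx), ?_, ?_⟩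
      · intro b'
        have e := hD.even_sums hx b'
        have e1 := h1 b'
        rw [← add_assoc, blockCount_add_mod_two]
        omega
      · intro b' hb' hbh'
        rw [← add_assoc]
        by_cases hbb : b = b'
        · exact hbb ▸ hxf
        · exact (h2 b' (Finset.mem_of_mem_insert_of_ne hb' (Ne.symm hbb)) hbh').add
            (hD.flat_sums hx hbb (hbh.trans hbh'.symm))
    · refine ⟨w, hw, h1, fun b' hb' hbh' => h2 b' (Finset.mem_of_mem_insert_of_ne hb' ?_) hbh'⟩
      rintro rfl
      exact hbh hbh'

/-- An even word orthogonal to all generators and flat on one half is flat everywhere. -/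
theorem flat_of_half (hD : D.Valid) {h : ℕ} (hlt : h < 2) {d : Fin (3 * 20) → ZMod 2}
    (hd : ∀ b, blockCount d b % 2 = 0)
    (ho : ∀ b : Fin 10, ∀ x ∈ D.sumsAt b, ∑ p, d p * word x p = 0)
    (hh : ∀ b : Fin 10, b.val / 5 = h → FlatOn d b) (b : Fin 10) : FlatOn d b := by
  by_cases hb : b.val / 5 = h
  · exact hh b hb
  have key : ∀ x ∈ D.sumsAt b, innerOn d (word x) b = 0 := by
    intro x hx
    have h1 := ho b x hx
    rw [sum_mul_eq_sum_innerOn, Finset.sum_eq_single b] at h1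
    · exact h1
    · intro b' _ hne
      by_cases hb' : b'.val / 5 = h
      · rw [innerOn_comm]
        exact innerOn_eq_zero (hD.even_sums hx b') (hh b' hb')
      · refine innerOn_eq_zero (hd b') (hD.flat_sums hx hne.symm ?_)
        omega
    · simp
  have hall : ∀ c : Fin (3 * 20) → ZMod 2, blockCount c b % 2 = 0 → innerOn d c b = 0 := by
    intro c hc
    obtain ⟨x, hx, hxf⟩ := hD.cover b c hc
    have h1 := innerOn_eq_zero (hd b) hxf
    rwa [innerOn_add, key x hx, add_zero] at h1
  intro k
  by_cases hk : k = 0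
  · rw [hk]
  let e : Fin (3 * 20) → ZMod 2 := fun p => if p = point b k ∨ p = point b 0 then 1 else 0
  have hinj : ∀ i j : Fin 6, point b i = point b j ↔ i = j := by
    intro i j
    simp only [point, Fin.ext_iff]
    omega
  have he : ∀ i, e (point b i) = (if i = k then 1 else 0) + if i = 0 then 1 else 0 := by
    intro i
    simp only [e, hinj]
    by_cases h1 : i = k
    · subst h1
      simp [hk]
    · simp [h1]
  have h1 := hall e (by
    rw [← Nat.dvd_iff_mod_eq_zero, ← ZMod.natCast_eq_zero_iff, cast_blockCount]
    simp only [he, Finset.sum_add_distrib]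
    simp
    rfl)
  simp only [innerOn, he, mul_add, Finset.sum_add_distrib] at h1
  simp at h1
  exact CharTwo.add_eq_zero.mp h1

theorem flat_of_half_of_gensAt (hD : D.Valid) {h : ℕ} (hlt : h < 2) {d : Fin (3 * 20) → ZMod 2}
    (hd : ∀ b, blockCount d b % 2 = 0)
    (ho : ∀ b : Fin 10, ∀ x ∈ D.gensAt b, ∑ p, d p * word x p = 0)
    (hh : ∀ b : Fin 10, b.val / 5 = h → FlatOn d b) (b : Fin 10) : FlatOn d b := by
  refine hD.flat_of_half hlt hd (fun b x hx => ?_) hh b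
  refine sums_induction (P := fun x => ∑ p, d p * word x p = 0) ?_ ?_ x hx
  · simp [word_zero]
  · intro g hg y hy
    rw [word_xor]
    simp only [Pi.add_apply, mul_add, Finset.sum_add_distrib, hy, ho b g hg, add_zero]

/-- A word orthogonal to all generators lies in the span of the basic words. -/
theorem mem_of_orthogonal (hD : D.Valid) {M : Submodule (ZMod 2) (Fin (3 * 20) → ZMod 2)}
    (hM : ∀ x ∈ D.basic, word x ∈ M) (hMw : ∀ c ∈ M, ∀ x ∈ D.words, ∑ p, c p * word x p = 0)
    {c : Fin (3 * 20) → ZMod 2} (hc : ∀ x ∈ D.words, ∑ p, c p * word x p = 0) : c ∈ M := by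
  have hodd : D.odd ∈ D.basic := List.mem_append_left _ List.mem_cons_self
  have hblock : ∀ b : Fin 10, blockNat b ^^^ blockNat 0 ∈ D.basic := fun b =>
    List.mem_append_left _ (List.mem_cons_of_mem _
      (List.mem_map.mpr ⟨b, List.mem_range.mpr b.isLt, rfl⟩))
  have hbasic : ∀ x ∈ D.basic, x ∈ D.words := fun x hx => List.mem_append_left _ hx
  have hblockM : ∀ b : Fin 10, blockWord b + blockWord 0 ∈ M := fun b => by
    have h := hM _ (hblock b)
    rwa [word_xor, word_blockNat, show (0 : ℕ) = (0 : Fin 10).val from rfl, word_blockNat] at h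
  -- all blocks are met with the same parity
  have hpar : ∀ b : Fin 10, blockCount c b % 2 = blockCount c 0 % 2 := by
    intro b
    have h := hc _ (hbasic _ (hblock b))
    rw [word_xor, word_blockNat, show (0 : ℕ) = (0 : Fin 10).val from rfl, word_blockNat] at h
    simp only [Pi.add_apply, mul_add, Finset.sum_add_distrib] at h
    rw [sum_mul_blockWord, sum_mul_blockWord, ← Nat.cast_add, ZMod.natCast_eq_zero_iff] at h
    omega
  -- the case of even words
  have heven : ∀ c : Fin (3 * 20) → ZMod 2, (∀ x ∈ D.words, ∑ p, c p * word x p = 0) →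
      (∀ b, blockCount c b % 2 = 0) → c ∈ M := by
    intro c hc h0
    obtain ⟨w, hw, h1, h2⟩ := hD.exists_flat (M := M) 0 (fun b hb x hx =>
      hM x (List.mem_append_right _ (List.mem_flatMap.mpr
        ⟨b, List.mem_range.mpr (by omega), hx⟩))) h0
    have hcw : ∀ x ∈ D.words, ∑ p, (c + w) p * word x p = 0 := by
      intro x hx
      simp only [Pi.add_apply, add_mul, Finset.sum_add_distrib, hc x hx, hMw w hw x hx, add_zero]
    have h3 : ∀ b, FlatOn (c + w) b := hD.flat_of_half_of_gensAt (by norm_num) h1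
      (fun b g hg => hcw g (gensAt_subset hg)) h2
    have h4 := eq_sum_blockWord h3
    have h5 : ∑ b, (c + w) (point b 0) = 0 := by
      have h6 := hcw D.odd (hbasic _ hodd)
      rw [sum_mul_eq_sum_innerOn] at h6
      rw [← h6]
      refine Finset.sum_congr rfl fun b _ => ?_
      simp only [innerOn, h3 b _]
      rw [← Finset.mul_sum, ← cast_blockCount]
      have h7 : ((blockCount (word D.odd) b : ℕ) : ZMod 2) = (1 : ℕ) :=
        (ZMod.natCast_eq_natCast_iff' _ _ 2).mpr (hD.odd b)
      rw [h7, Nat.cast_one, mul_one]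
    have h8 : c + w ∈ M := by
      have h9 : c + w = ∑ b, (c + w) (point b 0) • (blockWord b + blockWord 0) := by
        simp only [smul_add, Finset.sum_add_distrib]
        rw [← h4, ← Finset.sum_smul, h5, zero_smul, add_zero]
      rw [h9]
      exact M.sum_mem fun b _ => M.smul_mem _ (hblockM b)
    have h10 := M.add_mem h8 hw
    rwa [add_assoc, add_self_binary, add_zero] at h10
  rcases Nat.mod_two_eq_zero_or_one (blockCount c 0) with h0 | h0
  · exact heven c hc fun b => (hpar b).trans h0
  · have h1 := heven (c + word D.odd) (by
      intro x hx
      simp only [Pi.add_apply, add_mul, Finset.sum_add_distrib, hc x hx,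
        hD.orthogonal _ (hbasic _ hodd) x hx, add_zero]) (by
      intro b
      have h2 := hD.odd b
      have h3 := hpar b
      rw [blockCount_add_mod_two]
      omega)
    have h2 := M.add_mem h1 (hM _ hodd)
    rwa [add_assoc, add_self_binary, add_zero] at h2

theorem orthogonal_of_mem (hD : D.Valid) {c : Fin (3 * 20) → ZMod 2} (hc : c ∈ D.code) :
    ∀ x ∈ D.words, ∑ p, c p * word x p = 0 := by
  intro x hx
  induction hc using Submodule.span_induction with
  | mem y hy =>
    obtain ⟨y, hy, rfl⟩ := hy
    exact hD.orthogonal y hy x hx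
  | zero => simp
  | add a b _ _ ha hb => simp only [Pi.add_apply, add_mul, Finset.sum_add_distrib, ha, hb, add_zero]
  | smul r a _ ha =>
    simp only [Pi.smul_apply, smul_eq_mul, mul_assoc, ← Finset.mul_sum, ha, mul_zero]

theorem mem_code_iff (hD : D.Valid) {c : Fin (3 * 20) → ZMod 2} :
    c ∈ D.code ↔ ∀ x ∈ D.words, ∑ p, c p * word x p = 0 :=
  ⟨hD.orthogonal_of_mem, hD.mem_of_orthogonal (fun _ hx => word_mem (List.mem_append_left _ hx))
    fun _ hc => hD.orthogonal_of_mem hc⟩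

theorem code_eq_span_basic (hD : D.Valid) :
    D.code = Submodule.span (ZMod 2) (word '' {x | x ∈ D.basic}) := by
  have hle : Submodule.span (ZMod 2) (word '' {x | x ∈ D.basic}) ≤ D.code := by
    refine Submodule.span_mono (Set.image_mono fun x hx => ?_)
    exact List.mem_append_left _ hx
  refine le_antisymm (fun c hc => ?_) hle
  exact hD.mem_of_orthogonal (fun x hx => Submodule.subset_span (Set.mem_image_of_mem word hx))
    (fun d hd => hD.orthogonal_of_mem (hle hd)) (hD.orthogonal_of_mem hc)

theorem isSelfDual (hD : D.Valid) : D.code.IsSelfDual := by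
  ext c
  constructor
  · intro hc d hd
    induction hd using Submodule.span_induction with
    | mem y hy =>
      obtain ⟨y, hy, rfl⟩ := hy
      exact hD.orthogonal_of_mem hc y hy
    | zero => simp
    | add a b _ _ ha hb =>
      simp only [Pi.add_apply, mul_add, Finset.sum_add_distrib, ha, hb, add_zero]
    | smul r a _ ha =>
      simp only [Pi.smul_apply, smul_eq_mul, mul_left_comm _ r, ← Finset.mul_sum, ha, mul_zero]
  · exact fun hc => hD.mem_code_iff.mpr fun x hx => hc _ (word_mem hx)

theorem mod_four_of_mem (hD : D.Valid) {c : Fin (3 * 20) → ZMod 2} (hc : c ∈ D.code)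
    (b : Fin 10) : hammingNorm c % 4 = 2 * (blockCount c b % 2) := by
  induction hc using Submodule.span_induction with
  | mem y hy =>
    obtain ⟨y, hy, rfl⟩ := hy
    exact hD.mod_four y hy b
  | zero => simp [blockCount]
  | add c d hc hd ihc ihd =>
    have h1 := hammingNorm_add_mod_four (hD.isSelfDual.sum_mul_eq_zero hc hd)
    have h2 := blockCount_add_mod_two c d b
    omega
  | smul r a _ ha =>
    have h : r = 0 ∨ r = 1 := by
      revert r
      decide
    rcases h with rfl | rfl
    · simp [blockCount]
    · rwa [one_smul]

end Valid

end BlockData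

/-! ### The minimum weight -/

theorem blockCount_add_of_flatOn {c d : Fin (3 * 20) → ZMod 2} {b : Fin 10} (hd : FlatOn d b) :
    blockCount (c + d) b + 2 * ((d (point b 0)).val * blockCount c b) =
      blockCount c b + 6 * (d (point b 0)).val := by
  have h : ∀ x y : ZMod 2, (x + y).val + 2 * (y.val * x.val) = x.val + y.val := by decide
  rw [← hd.blockCount_eq]
  simp only [blockCount, Finset.mul_sum, ← Finset.sum_add_distrib]
  refine Finset.sum_congr rfl fun k _ => ?_
  rw [Pi.add_apply, ← h, hd k]

/-- At most five blocks are contained in a pair of blocks on one of the two halves. -/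
theorem exists_halfPair (A : Finset (Fin 10)) (hA : A.card ≤ 5) :
    ∃ ij ∈ halfPairs, ∀ b ∈ A, b.val / 5 = ij.1.val / 5 → b = ij.1 ∨ b = ij.2 := by
  revert A
  decide +kernel

theorem div_five_eq_of_mem_halfPairs :
    ∀ ij ∈ halfPairs, ij.2.val / 5 = ij.1.val / 5 ∧ ij.1 ≠ ij.2 := by
  decide

/-- The blocks on which a word is not constant. -/
def activeBlocks (c : Fin (3 * 20) → ZMod 2) : Finset (Fin 10) :=
  Finset.univ.filter fun b => ¬ (blockCount c b = 0 ∨ blockCount c b = 6)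

theorem mem_activeBlocks {c : Fin (3 * 20) → ZMod 2} {b : Fin 10} :
    b ∈ activeBlocks c ↔ ¬ FlatOn c b := by
  simp [activeBlocks, flatOn_iff]

theorem active_eq_card (x : ℕ) : active x = (activeBlocks (word x)).card := by
  rw [active_eq, activeBlocks, Finset.card_filter]
  refine Finset.sum_congr rfl fun b _ => ?_
  have h := flatDigits_digits x b
  rw [flatOn_iff] at h
  by_cases h1 : flatDigits (digits x b) = true
  · rw [h1, if_neg (not_not.mpr (h.mp h1))]
    rfl
  · rw [if_pos fun h2 => h1 (h.mpr h2), Bool.eq_false_iff.mpr h1]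
    rfl

theorem activeBlocks_eq_of_flatOn {c d : Fin (3 * 20) → ZMod 2} (h : ∀ b, FlatOn (c + d) b) :
    activeBlocks c = activeBlocks d := by
  ext b
  rw [mem_activeBlocks, mem_activeBlocks]
  refine not_congr ⟨fun hc => ?_, fun hd => (h b).of_add hd⟩
  have h1 := h b
  rw [add_comm] at h1
  exact h1.of_add hc

theorem two_mul_card_activeBlocks_le {c : Fin (3 * 20) → ZMod 2}
    (hc : ∀ b, blockCount c b % 2 = 0) : 2 * (activeBlocks c).card ≤ hammingNorm c := by
  rw [hammingNorm_eq_sum_blockCount, activeBlocks, Finset.card_filter, Finset.mul_sum]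
  refine Finset.sum_le_sum fun b _ => ?_
  have := hc b
  split_ifs with h <;> omega

namespace BlockData.Valid

variable {D : BlockData}

/-- An even word with at most five active blocks which is orthogonal to the generators is, up to
adding blocks, a sum of generators belonging to two blocks of the same half. -/
theorem exists_sums_flatOn (hD : D.Valid) {c : Fin (3 * 20) → ZMod 2}
    (hc : ∀ b, blockCount c b % 2 = 0)
    (ho : ∀ b : Fin 10, ∀ x ∈ D.gensAt b, ∑ p, c p * word x p = 0)
    (hA : (activeBlocks c).card ≤ 5) :
    ∃ ij ∈ halfPairs, ∃ x ∈ D.sumsAt ij.1.val, ∃ y ∈ D.sumsAt ij.2.val,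
      ∀ b, FlatOn (c + word (x ^^^ y)) b := by
  obtain ⟨⟨i, j⟩, hij, h1⟩ := exists_halfPair _ hA
  obtain ⟨hdiv, hne⟩ := div_five_eq_of_mem_halfPairs _ hij
  dsimp only at h1 hdiv hne
  obtain ⟨x, hx, hxf⟩ := hD.cover i c (hc i)
  have hcx : ∀ b, blockCount (c + word x) b % 2 = 0 := fun b => by
    have h2 := hc b
    have h3 := hD.even_sums hx b
    rw [blockCount_add_mod_two]
    omega
  obtain ⟨y, hy, hyf⟩ := hD.cover j _ (hcx j)
  refine ⟨⟨i, j⟩, hij, x, hx, y, hy, ?_⟩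
  rw [word_xor, ← add_assoc]
  have hortho : ∀ (i : Fin 10) (x : ℕ), x ∈ D.sumsAt i → ∀ b : Fin 10, ∀ g ∈ D.gensAt b,
      ∑ p, word x p * word g p = 0 := by
    intro i x hx b g hg
    refine hD.orthogonal_of_mem ?_ g (gensAt_subset hg)
    exact sums_mem (fun g hg => word_mem (gensAt_subset hg)) hx
  refine hD.flat_of_half_of_gensAt (h := i.val / 5) (by omega) ?_ ?_ ?_
  · intro b
    have h2 := hcx b
    have h3 := hD.even_sums hy b
    rw [blockCount_add_mod_two]
    omega
  · intro b g hg
    simp only [Pi.add_apply, add_mul, Finset.sum_add_distrib, ho b g hg, hortho i x hx b g hg,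
      hortho j y hy b g hg, add_zero]
  · intro b hb
    by_cases hbi : i = b
    · subst hbi
      exact hxf.add (hD.flat_sums hy hne.symm hdiv)
    by_cases hbj : j = b
    · subst hbj
      exact hyf
    refine (FlatOn.add ?_ (hD.flat_sums hx hbi hb.symm)).add
      (hD.flat_sums hy hbj (hdiv.trans hb.symm))
    by_contra hcb
    rcases h1 b (mem_activeBlocks.mpr hcb) hb with h | h
    · exact hbi h.symm
    · exact hbj h.symm

/-- A codeword of weight four or eight has at most four active blocks, which `active` excludes, and
a flat word has weight divisible by six. -/
theorem twelve_le_of_even (hD : D.Valid) {c : Fin (3 * 20) → ZMod 2} (hc : c ∈ D.code)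
    (h0 : c ≠ 0) (he : blockCount c 0 % 2 = 0) : 12 ≤ hammingNorm c := by
  by_contra hlt
  have hm := hD.mod_four_of_mem hc
  have hev : ∀ b, blockCount c b % 2 = 0 := fun b => by
    have h1 := hm 0
    have h2 := hm b
    omega
  have hcard := two_mul_card_activeBlocks_le hev
  obtain ⟨ij, hij, x, hx, y, hy, hf⟩ := hD.exists_sums_flatOn hev
    (fun b g hg => hD.orthogonal_of_mem hc g (gensAt_subset hg)) (by omega)
  have h1 := hD.active ij hij x hx y hy
  rw [active_eq_card, ← activeBlocks_eq_of_flatOn hf] at h1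
  have h4 := hm 0
  have hflat : ∀ b, FlatOn c b := by
    intro b
    by_contra hb
    have h2 : 0 < (activeBlocks c).card := Finset.card_pos.mpr ⟨b, mem_activeBlocks.mpr hb⟩
    omega
  have h2 : hammingNorm c = 6 * ∑ b, (c (point b 0)).val := by
    rw [hammingNorm_eq_sum_blockCount, Finset.mul_sum]
    exact Finset.sum_congr rfl fun b _ => (hflat b).blockCount_eq
  have h3 : hammingNorm c = 0 := by omega
  exact h0 (hammingNorm_eq_zero.mp h3)

/-- Up to blocks, `x` is a codeword meeting every block in one coordinate. The parity of the number
of these blocks is visible in the weight of `x`. -/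
theorem isTransversal_of_flatOn (hD : D.Valid) {c : Fin (3 * 20) → ZMod 2}
    (h1 : ∀ b, blockCount c b = 1) {x : ℕ} (hx : c + word x ∈ D.code)
    (hf : ∀ b, FlatOn (c + word x) b) : isTransversal x = true := by
  have hcount : ∀ b : Fin 10, count x b = 1 + 4 * ((c + word x) (point b 0)).val := by
    intro b
    have h2 := blockCount_add_of_flatOn (c := c) (hf b)
    rw [← add_assoc, add_self_binary, zero_add, h1 b, blockCount_word] at h2
    omega
  have hs : weight x = 10 + 4 * ∑ b, ((c + word x) (point b 0)).val := by
    rw [← hammingNorm_word, hammingNorm_eq_sum_blockCount, Finset.mul_sum]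
    simp only [blockCount_word, hcount, Finset.sum_add_distrib]
    simp
  have hn : hammingNorm (c + word x) = 6 * ∑ b, ((c + word x) (point b 0)).val := by
    rw [hammingNorm_eq_sum_blockCount, Finset.mul_sum]
    exact Finset.sum_congr rfl fun b _ => (hf b).blockCount_eq
  have hm := hD.mod_four_of_mem hx 0
  have h0 := (hf 0).blockCount_eq
  rw [isTransversal, Bool.and_eq_true, List.all_eq_true]
  refine ⟨fun b hb => ?_, ?_⟩
  · have h2 := hcount ⟨b, List.mem_range.mp hb⟩
    have h3 := ZMod.val_lt ((c + word x) (point ⟨b, List.mem_range.mp hb⟩ 0))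
    simp only [Bool.or_eq_true, Nat.beq_eq]
    dsimp only at h2
    omega
  · rw [Nat.beq_eq]
    change weight x % 8 = 2
    omega

/-- A codeword `c` meeting all blocks in one coordinate would be found by `noTransversal`. The
list `bs` consists of the blocks of the second half on which `x` has not yet been adapted to `c`. -/
theorem noTransversal_eq_false (hD : D.Valid) {c : Fin (3 * 20) → ZMod 2} (hc : c ∈ D.code)
    (h1 : ∀ b, blockCount c b = 1) (bs : List (Fin 10)) (hbs : bs.Nodup)
    (hhalf : ∀ b ∈ bs, b.val / 5 = 1) (x : ℕ) (hx : word x ∈ D.code)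
    (hodd : ∀ b, blockCount (word x) b % 2 = 1)
    (hdone : ∀ b : Fin 10, b.val / 5 = 1 → b ∉ bs → FlatOn (c + word x) b)
    (htodo : ∀ b ∈ bs, FlatOn (word x + word D.odd) b) :
    noTransversal (bs.map fun b => D.singles b.val) x = false := by
  have hev : ∀ b, blockCount (c + word x) b % 2 = 0 := fun b => by
    have h2 := h1 b
    have h3 := hodd b
    rw [blockCount_add_mod_two]
    omega
  induction bs generalizing x with
  | nil =>
    have hcx := D.code.add_mem hc hx
    have hf := hD.flat_of_half_of_gensAt (by norm_num) hev
      (fun b g hg => hD.orthogonal_of_mem hcx g (gensAt_subset hg))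
      (fun b hb => hdone b hb List.not_mem_nil)
    simp only [List.map_nil, noTransversal, hD.isTransversal_of_flatOn h1 hcx hf, Bool.not_true]
  | cons b bs ih =>
    obtain ⟨hb, hbs'⟩ := List.nodup_cons.mp hbs
    obtain ⟨t, ht, htf⟩ := hD.cover b _ (hev b)
    have hbh := hhalf b List.mem_cons_self
    have hsingle : t ∈ D.singles b.val := by
      rw [singles, List.mem_filter, List.any_eq_true]
      refine ⟨ht, ?_⟩
      obtain ⟨y, rfl⟩ := exists_word c
      have hy : popSix (digits y b) = 1 := by
        have h2 := h1 b
        rwa [blockCount_word] at h2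
      have key : ∀ m < 64, popSix m = 1 → ∃ k ∈ List.range 6, m = Nat.shiftLeft 1 k := by
        decide +kernel
      obtain ⟨k, hk, hyk⟩ := key _ (digits_lt y b) hy
      refine ⟨k, hk, ?_⟩
      rw [← hyk]
      change flatDigits (digits D.odd b ^^^ digits t b ^^^ digits y b) = true
      rw [← digits_xor, ← digits_xor, flatDigits_digits, word_xor, word_xor]
      have h3 := htf.add (htodo b List.mem_cons_self)
      have h4 : word y + word x + word t + (word x + word D.odd) =
          word D.odd + word t + word y + (word x + word x) := by abel
      rwa [h4, add_self_binary, add_zero] at h3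
    have hxt : word (x ^^^ t) ∈ D.code := by
      rw [word_xor]
      exact D.code.add_mem hx (sums_mem (fun g hg => word_mem (gensAt_subset hg)) ht)
    have hoddt : ∀ b, blockCount (word (x ^^^ t)) b % 2 = 1 := fun b' => by
      have h2 := hodd b'
      have h3 := hD.even_sums ht b'
      rw [word_xor, blockCount_add_mod_two]
      omega
    have hrec := ih hbs' (fun b' hb' => hhalf b' (List.mem_cons_of_mem _ hb')) (x ^^^ t) hxt hoddt
      (fun b' hb' hn => ?_) (fun b' hb' => ?_) (fun b' => ?_)
    · rw [List.map_cons, noTransversal, List.all_eq_false]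
      refine ⟨t, hsingle, ?_⟩
      rw [show Nat.xor x t = x ^^^ t from rfl, hrec]
      exact Bool.false_ne_true
    · rw [word_xor, ← add_assoc]
      by_cases hbb : b = b'
      · exact hbb ▸ htf
      · refine (hdone b' hb' ?_).add (hD.flat_sums ht hbb (hbh.trans hb'.symm))
        rw [List.mem_cons, not_or]
        exact ⟨Ne.symm hbb, hn⟩
    · have hbb : b ≠ b' := fun h => hb (h ▸ hb')
      have hb'' := List.mem_cons_of_mem b hb'
      have h2 := (htodo b' hb'').add
        (hD.flat_sums ht hbb (hbh.trans (hhalf b' hb'').symm))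
      rwa [add_right_comm, ← word_xor] at h2
    · have h2 := hoddt b'
      have h3 := h1 b'
      rw [blockCount_add_mod_two]
      omega

/-- A codeword of weight at most ten meeting all blocks oddly meets each of them once. -/
theorem twelve_le_of_odd (hD : D.Valid) {c : Fin (3 * 20) → ZMod 2} (hc : c ∈ D.code)
    (ho : blockCount c 0 % 2 = 1) : 12 ≤ hammingNorm c := by
  by_contra hlt
  have hm := hD.mod_four_of_mem hc
  have hpos : ∀ b ∈ Finset.univ, 1 ≤ blockCount c b := fun b _ => by
    have h1 := hm 0
    have h2 := hm b
    omega
  have hsum := hammingNorm_eq_sum_blockCount c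
  have hten : ∑ _b : Fin 10, 1 = 10 := by simp
  have hle := Finset.sum_le_sum hpos
  have h0 := hm 0
  have heq : ∑ _b : Fin 10, 1 = ∑ b, blockCount c b := by omega
  have h1 : ∀ b, blockCount c b = 1 := fun b =>
    ((Finset.sum_eq_sum_iff_of_le hpos).mp heq b (Finset.mem_univ b)).symm
  have hodd : D.odd ∈ D.words := List.mem_append_left _ (List.mem_append_left _ List.mem_cons_self)
  have h2 := hD.noTransversal_eq_false hc h1 [5, 6, 7, 8, 9] (by decide) (by decide) D.odd
    (word_mem hodd) hD.odd
    (fun b hb hn => absurd hb ((by decide : ∀ b : Fin 10, b ∉ [5, 6, 7, 8, 9] → b.val / 5 ≠ 1) b hn))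
    (fun b _ => by
      rw [add_self_binary]
      exact fun _ => rfl)
  have h3 := hD.transversal
  change noTransversal ([(5 : Fin 10), 6, 7, 8, 9].map fun b => D.singles b.val) D.odd = true at h3
  rw [h2] at h3
  exact Bool.false_ne_true h3

theorem isBlockCode (hD : D.Valid) : IsBlockCode D.code where
  selfDual := hD.isSelfDual
  mod_four _ hc b := hD.mod_four_of_mem hc b
  minimum c hc h0 := by
    rcases Nat.mod_two_eq_zero_or_one (blockCount c 0) with h | h
    · exact hD.twelve_le_of_even hc h0 h
    · exact hD.twelve_le_of_odd hc h

end BlockData.Valid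

/-! ### The words of weight ten -/

/-- The sum of `x` with the blocks which it meets in more than three coordinates. -/
def small (x : ℕ) : ℕ :=
  (List.range 10).foldr (fun b z => bif Nat.ble 4 (count x b) then Nat.xor z (blockNat b) else z) x

/-- The list without repetitions of the elements of a list. -/
def distinct (l : List ℕ) : List ℕ :=
  l.foldr (fun a l' => bif l'.any (Nat.beq a) then l' else a :: l') []

theorem mem_distinct {l : List ℕ} {a : ℕ} : a ∈ distinct l ↔ a ∈ l := by
  induction l with
  | nil => rfl
  | cons b l ih =>
    change a ∈ (bif (distinct l).any (Nat.beq b) then distinct l else b :: distinct l) ↔ _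
    rw [List.mem_cons, ← ih]
    cases h : (distinct l).any (Nat.beq b)
    · exact List.mem_cons
    · obtain ⟨c, hc, hbc⟩ := List.any_eq_true.mp h
      rw [Nat.beq_eq] at hbc
      subst hbc
      exact ⟨Or.inr, fun h => h.elim (fun h => h ▸ hc) id⟩

theorem nodup_distinct (l : List ℕ) : (distinct l).Nodup := by
  induction l with
  | nil => exact List.nodup_nil
  | cons b l ih =>
    change (bif (distinct l).any (Nat.beq b) then distinct l else b :: distinct l).Nodup
    cases h : (distinct l).any (Nat.beq b)
    · refine List.nodup_cons.mpr ⟨fun hb => ?_, ih⟩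
      rw [List.any_eq_false] at h
      exact h b hb (by rw [Nat.beq_eq])
    · exact ih

theorem nodup_of_length_distinct {l : List ℕ} (h : (distinct l).length = l.length) : l.Nodup := by
  have h1 : (distinct l).toFinset = l.toFinset := by
    ext a
    simp [mem_distinct]
  rw [← List.toFinset_card_of_nodup (nodup_distinct l), h1] at h
  exact (Multiset.toFinset_card_eq_card_iff_nodup (m := (l : Multiset ℕ))).mp h

theorem word_small (x : ℕ) :
    word (small x) = word x + ∑ b : Fin 10, if 4 ≤ count x b then blockWord b else 0 := by
  have h : ∀ l : List ℕ, word (l.foldr (fun b z =>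
      bif Nat.ble 4 (count x b) then Nat.xor z (blockNat b) else z) x) =
      word x + (l.map fun b => if 4 ≤ count x b then word (blockNat b) else 0).sum := by
    intro l
    induction l with
    | nil => simp
    | cons b l ih =>
      rw [List.foldr_cons, List.map_cons, List.sum_cons, add_left_comm, ← ih]
      by_cases hb : 4 ≤ count x b
      · rw [if_pos hb, Nat.ble_eq_true_of_le hb, add_comm]
        exact word_xor _ _
      · rw [if_neg hb, Bool.eq_false_iff.mpr fun h => hb (Nat.le_of_ble_eq_true h), zero_add]
        rfl
  refine (h _).trans (congrArg (word x + ·) ?_)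
  rw [← List.sum_toFinset _ List.nodup_range, List.toFinset_range, Finset.sum_range]
  simp only [word_blockNat]

theorem flatOn_sum_blockWord {s : Finset (Fin 10)} {f : Fin 10 → Fin (3 * 20) → ZMod 2}
    {b : Fin 10} (h : ∀ b' ∈ s, FlatOn (f b') b) : FlatOn (∑ b' ∈ s, f b') b := fun k => by
  simp only [Finset.sum_apply]
  exact Finset.sum_congr rfl fun b' hb' => h b' hb' k

theorem flatOn_word_small_add (x : ℕ) (b : Fin 10) : FlatOn (word (small x) + word x) b := by
  rw [word_small, add_right_comm, add_self_binary, zero_add]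
  refine flatOn_sum_blockWord fun b' _ => ?_
  split_ifs
  · exact flatOn_blockWord b' b
  · exact fun _ => rfl

theorem count_small_le (x : ℕ) (b : Fin 10) : count (small x) b ≤ 3 := by
  have h1 := blockCount_add_of_flatOn (c := word x) (flatOn_word_small_add x b)
  rw [add_left_comm, add_self_binary, add_zero, blockCount_word, blockCount_word] at h1
  have h2 : (word (small x) + word x) (point b 0) = if 4 ≤ count x b then 1 else 0 := by
    rw [word_small, add_right_comm, add_self_binary, zero_add, Finset.sum_apply,
      Finset.sum_eq_single b]
    · split_ifs <;> simp [blockWord, blockOf_point]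
    · intro b' _ hb
      split_ifs
      · simp [blockWord, blockOf_point, hb.symm]
      · rfl
    · simp
  rw [h2] at h1
  split_ifs at h1 with h
  · rw [show (1 : ZMod 2).val = 1 from rfl] at h1
    omega
  · rw [show (0 : ZMod 2).val = 0 from rfl] at h1
    omega

namespace BlockData

variable (D : BlockData)

/-- The sums of generators belonging to two blocks of the same half which have weight ten after
complementation on blocks. -/
def candidates : List ℕ :=
  halfPairs.flatMap fun ij => (D.sumsAt ij.1).flatMap fun x =>
    ((D.sumsAt ij.2).map fun y => small (Nat.xor x y)).filter fun z => Nat.beq (weight z) 10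

/-- The elements of `tenWords`, see `Valid.tenWords_eq`. -/
def tenList : List ℕ := distinct D.candidates

theorem mem_tenList {z : ℕ} : z ∈ D.tenList ↔ ∃ ij ∈ halfPairs, ∃ x ∈ D.sumsAt ij.1.val,
    ∃ y ∈ D.sumsAt ij.2.val, small (x ^^^ y) = z ∧ weight z = 10 := by
  simp only [tenList, mem_distinct, candidates, List.mem_flatMap, List.mem_filter, List.mem_map,
    Nat.beq_eq]
  constructor
  · rintro ⟨ij, hij, x, hx, ⟨y, hy, h⟩, hw⟩
    exact ⟨ij, hij, x, hx, y, hy, h, hw⟩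
  · rintro ⟨ij, hij, x, hx, y, hy, h, hw⟩
    exact ⟨ij, hij, x, hx, ⟨y, hy, h⟩, hw⟩

end BlockData

namespace BlockData.Valid

variable {D : BlockData}

theorem mem_dual_evenPart_of_flatOn (hD : D.Valid) {c : Fin (3 * 20) → ZMod 2}
    (hc : ∀ b, FlatOn c b) : c ∈ (evenPart D.code).dual := by
  rw [eq_sum_blockWord hc]
  exact Submodule.sum_mem _ fun b _ => Submodule.smul_mem _ _ (hD.isBlockCode.blockWord_mem_dual b)

theorem mem_dual_evenPart (hD : D.Valid) {c : Fin (3 * 20) → ZMod 2} (hc : c ∈ D.code) :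
    c ∈ (evenPart D.code).dual := by
  rintro d ⟨hd, -⟩
  exact hD.isSelfDual.sum_mul_eq_zero hc hd

theorem sum_mul_of_mem_dual_evenPart (hD : D.Valid) {c : Fin (3 * 20) → ZMod 2}
    (hc : c ∈ (evenPart D.code).dual) (b : Fin 10) : ∀ x ∈ D.gensAt b, ∑ p, c p * word x p = 0 := by
  intro x hx
  refine hc _ ⟨word_mem (gensAt_subset hx), ?_⟩
  rw [sum_mul_blockWord, ZMod.natCast_eq_zero_iff]
  exact Nat.dvd_of_mod_eq_zero (hD.even b x hx 0)

theorem even_word_small (hD : D.Valid) {i j b : Fin 10} {x y : ℕ} (hx : x ∈ D.sumsAt i)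
    (hy : y ∈ D.sumsAt j) : blockCount (word (small (x ^^^ y))) b % 2 = 0 := by
  have h1 := hD.even_sums hx b
  have h2 := hD.even_sums hy b
  have h3 := blockCount_add_mod_two (word x) (word y) b
  have h4 := blockCount_add_of_flatOn (c := word (x ^^^ y)) (flatOn_word_small_add (x ^^^ y) b)
  rw [add_left_comm, add_self_binary, add_zero, word_xor] at h4
  omega

/-- A word of weight ten meeting all blocks evenly has five active blocks, at most two of which lie
in one of the halves. -/
theorem tenWords_eq (hD : D.Valid) (d : Fin (3 * 20) → ZMod 2) :
    d ∈ tenWords D.code ↔ ∃ z ∈ D.tenList, word z = d := by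
  rw [mem_tenWords]
  constructor
  · rintro ⟨hd, hev, hw⟩
    have hcard := two_mul_card_activeBlocks_le hev
    obtain ⟨ij, hij, x, hx, y, hy, hf⟩ := hD.exists_sums_flatOn hev
      (hD.sum_mul_of_mem_dual_evenPart hd) (by omega)
    have hact := hD.active ij hij x hx y hy
    rw [active_eq_card, ← activeBlocks_eq_of_flatOn hf] at hact
    -- a word that is flat on all blocks does not have weight ten
    have hpos : (activeBlocks d).card ≠ 0 := by
      intro h0
      have h1 : ∀ b, FlatOn d b := fun b => by
        by_contra hb
        rw [Finset.card_eq_zero] at h0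
        have := mem_activeBlocks.mpr hb
        simp [h0] at this
      have h2 : hammingNorm d = 6 * ∑ b, (d (point b 0)).val := by
        rw [hammingNorm_eq_sum_blockCount, Finset.mul_sum]
        exact Finset.sum_congr rfl fun b _ => (h1 b).blockCount_eq
      omega
    -- hence the word meets five blocks in two coordinates
    have hle : ∀ b, blockCount d b ≤ 2 := by
      have h1 : ∀ b ∈ Finset.univ, (if ¬ (blockCount d b = 0 ∨ blockCount d b = 6) then 2 else 0) ≤
          blockCount d b := fun b _ => by
        have := hev b
        split_ifs <;> omega
      have h2 : ∑ b, (if ¬ (blockCount d b = 0 ∨ blockCount d b = 6) then 2 else 0) =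
          ∑ b, blockCount d b := by
        rw [← hammingNorm_eq_sum_blockCount, hw, ← Finset.sum_filter, Finset.sum_const,
          smul_eq_mul]
        change (activeBlocks d).card * 2 = 10
        omega
      intro b
      have h3 := (Finset.sum_eq_sum_iff_of_le h1).mp h2 b (Finset.mem_univ b)
      split_ifs at h3 <;> omega
    have hG : ∀ b, FlatOn (word (small (x ^^^ y)) + d) b := fun b => by
      have h1 := (flatOn_word_small_add (x ^^^ y) b).add (hf b)
      have h2 : word (small (x ^^^ y)) + word (x ^^^ y) + (d + word (x ^^^ y)) =
          word (small (x ^^^ y)) + d + (word (x ^^^ y) + word (x ^^^ y)) := by abel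
      rwa [h2, add_self_binary, add_zero] at h1
    have hzero : word (small (x ^^^ y)) + d = 0 := by
      rw [eq_sum_blockWord hG]
      refine Finset.sum_eq_zero fun b _ => ?_
      have h1 := blockCount_add_of_flatOn (c := d) (hG b)
      rw [add_left_comm, add_self_binary, add_zero, blockCount_word] at h1
      have h2 := count_small_le (x ^^^ y) b
      have h3 := hle b
      have h4 := ZMod.val_lt ((word (small (x ^^^ y)) + d) (point b 0))
      have h5 : ((word (small (x ^^^ y)) + d) (point b 0)).val = 0 := by
        by_contra h6
        have h7 : ((word (small (x ^^^ y)) + d) (point b 0)).val = 1 := by omega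
        rw [h7] at h1
        omega
      rw [(ZMod.val_eq_zero _).mp h5, zero_smul]
    have heq : word (small (x ^^^ y)) = d := by
      have h1 := congrArg (· + d) hzero
      simpa only [add_assoc, add_self_binary, add_zero, zero_add] using h1
    refine ⟨_, D.mem_tenList.mpr ⟨ij, hij, x, hx, y, hy, rfl, ?_⟩, heq⟩
    rw [← hammingNorm_word, heq, hw]
  · rintro ⟨z, hz, rfl⟩
    obtain ⟨ij, -, x, hx, y, hy, rfl, hw⟩ := D.mem_tenList.mp hz
    refine ⟨?_, fun b => hD.even_word_small hx hy, by rw [hammingNorm_word, hw]⟩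
    have h1 := hD.mem_dual_evenPart_of_flatOn (flatOn_word_small_add (x ^^^ y))
    have h2 : word (x ^^^ y) ∈ D.code := by
      rw [word_xor]
      exact D.code.add_mem (sums_mem (fun g hg => word_mem (gensAt_subset hg)) hx)
        (sums_mem (fun g hg => word_mem (gensAt_subset hg)) hy)
    have h3 := Submodule.add_mem _ h1 (hD.mem_dual_evenPart h2)
    rwa [add_assoc, add_self_binary, add_zero] at h3

end BlockData.Valid

/-! ### Computing the invariant -/

/-- The words of a list that contain a coordinate. -/
def through (l : List ℕ) (x : ℕ) : List ℕ := l.filter fun d => Nat.testBit d x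

/-- The total overlap of `d` with the words of a list. -/
def totalOverlap (l : List ℕ) (d : ℕ) : ℕ :=
  l.foldr (fun e s => Nat.add (weight (Nat.land d e)) s) 0

/-- The invariant `profile` of the words of a list. -/
def profileNat (l : List ℕ) (x y : ℕ) : ℕ :=
  (through l y).foldr (fun d s => Nat.add (scramble (totalOverlap (through l x) d)) s) 0

theorem foldr_filter_eq_sum (l : List ℕ) (P : ℕ → Bool) (f : ℕ → ℕ) :
    (l.filter P).foldr (fun a s => Nat.add (f a) s) 0 =
      (l.map fun a => if P a = true then f a else 0).sum := by
  induction l with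
  | nil => rfl
  | cons a l ih =>
    rw [List.map_cons, List.sum_cons, ← ih, List.filter_cons]
    split_ifs
    · rfl
    · rw [zero_add]

theorem sum_word_image {H : Finset (Fin (3 * 20) → ZMod 2)} {l : List ℕ}
    (hl : ∀ z ∈ l, z < 2 ^ 60) (hn : l.Nodup) (hH : ∀ d, d ∈ H ↔ ∃ z ∈ l, word z = d)
    (f : (Fin (3 * 20) → ZMod 2) → ℕ) : ∑ d ∈ H, f d = (l.map fun z => f (word z)).sum := by
  classical
  have h1 : H = l.toFinset.image word := by
    ext d
    simp [hH]
  rw [h1, Finset.sum_image, List.sum_toFinset _ hn]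
  intro x hx y hy h
  exact word_injOn (hl x (List.mem_toFinset.mp hx)) (hl y (List.mem_toFinset.mp hy)) h

theorem profile_eq {H : Finset (Fin (3 * 20) → ZMod 2)} {l : List ℕ}
    (hl : ∀ z ∈ l, z < 2 ^ 60) (hn : l.Nodup) (hH : ∀ d, d ∈ H ↔ ∃ z ∈ l, word z = d)
    (x y : Fin (3 * 20)) : profile H x y = profileNat l x y := by
  rw [profile, sum_word_image hl hn hH, profileNat,
    through.eq_def l y, foldr_filter_eq_sum]
  refine congrArg _ (List.map_congr_left fun d _ => ?_)
  simp only [word_eq_one]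
  rw [overlapAt, sum_word_image hl hn hH, totalOverlap, through,
    foldr_filter_eq_sum l _ fun e => weight (Nat.land d e)]
  simp only [word_eq_one, overlap_word]
  rfl

/-! ### Permutations as natural numbers -/

/-- The image of `p` under the map whose values are the digits of `s` in base `64`. -/
def permAt (s p : ℕ) : ℕ := Nat.mod (Nat.shiftRight s (Nat.mul 6 p)) 64

/-- Whether `permAt s` permutes the numbers below sixty. -/
def isPerm (s : ℕ) : Bool :=
  (List.range 60).all fun p => Nat.ble (permAt s p) 59 &&
    (List.range 60).any fun q => Nat.beq (permAt s q) p

/-- The word `x` with its coordinates permuted by `permAt s`. -/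
def permWord (s x : ℕ) : ℕ :=
  (List.range 60).foldr
    (fun p z => bif Nat.testBit x (permAt s p) then Nat.lor z (Nat.shiftLeft 1 p) else z) 0

theorem exists_perm_of_isPerm {s : ℕ} (hs : isPerm s = true) :
    ∃ σ : Equiv.Perm (Fin (3 * 20)), ∀ p, (σ p).val = permAt s p.val := by
  simp only [isPerm, List.all_eq_true, List.mem_range, Bool.and_eq_true, List.any_eq_true,
    Nat.beq_eq] at hs
  let f : Fin (3 * 20) → Fin (3 * 20) := fun p =>
    ⟨permAt s p.val, Nat.lt_succ_of_le (Nat.le_of_ble_eq_true (hs p.val p.isLt).1)⟩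
  have hf : Function.Surjective f := fun p => by
    obtain ⟨q, hq, h⟩ := (hs p.val p.isLt).2
    exact ⟨⟨q, hq⟩, Fin.ext h⟩
  exact ⟨Equiv.ofBijective f ⟨Finite.injective_iff_surjective.mpr hf, hf⟩, fun p => rfl⟩

theorem testBit_permWord (s x : ℕ) {i : ℕ} (hi : i < 60) :
    (permWord s x).testBit i = x.testBit (permAt s i) := by
  have h : ∀ l : List ℕ, (l.foldr (fun p z =>
      bif Nat.testBit x (permAt s p) then Nat.lor z (Nat.shiftLeft 1 p) else z) 0).testBit i =
      l.any fun p => x.testBit (permAt s p) && decide (p = i) := by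
    intro l
    induction l with
    | nil => simp
    | cons p l ih =>
      rw [List.foldr_cons, List.any_cons, ← ih]
      cases hp : x.testBit (permAt s p)
      · rfl
      · change (_ ||| 1 <<< p).testBit i = _
        rw [Nat.testBit_or, Nat.one_shiftLeft, Nat.testBit_two_pow, Bool.true_and, Bool.or_comm]
  rw [permWord, h, Bool.eq_iff_iff, List.any_eq_true]
  constructor
  · rintro ⟨p, -, hp⟩
    rw [Bool.and_eq_true, decide_eq_true_eq] at hp
    exact hp.2 ▸ hp.1
  · exact fun hx => ⟨i, List.mem_range.mpr hi, by simp [hx]⟩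

theorem word_permWord {s : ℕ} {σ : Equiv.Perm (Fin (3 * 20))}
    (hσ : ∀ p, (σ p).val = permAt s p.val) (x : ℕ) : word (permWord s x) = word x ∘ σ := by
  ext p
  rw [word, testBit_permWord s x p.isLt, Function.comp_apply, word, hσ]

/-- The numbers reached from a list in at most `n` steps, every step applying one of the given
permutations. -/
def reach (perms : List ℕ) : ℕ → List ℕ → List ℕ
  | 0, l => l
  | n + 1, l => reach perms n (distinct (l ++ perms.flatMap fun s => l.map (permAt s)))

/-- Elements reached from a list are images under the group generated by the permutations. -/
theorem exists_of_mem_reach {perms : List ℕ} {G : Subgroup (Equiv.Perm (Fin (3 * 20)))}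
    (hG : ∀ s ∈ perms, ∃ σ ∈ G, ∀ p, (σ p).val = permAt s p.val) (n : ℕ) (l : List ℕ)
    (hl : ∀ y ∈ l, y < 60) (x : ℕ) (hx : x ∈ reach perms n l) :
    ∃ y : Fin (3 * 20), y.val ∈ l ∧ ∃ σ ∈ G, (σ y).val = x := by
  induction n generalizing l with
  | zero => exact ⟨⟨x, hl x hx⟩, hx, 1, G.one_mem, rfl⟩
  | succ n ih =>
    have key : ∀ y ∈ distinct (l ++ perms.flatMap fun s => l.map (permAt s)),
        ∃ z : Fin (3 * 20), z.val ∈ l ∧ ∃ σ ∈ G, (σ z).val = y := by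
      intro y hy
      rw [mem_distinct, List.mem_append, List.mem_flatMap] at hy
      rcases hy with hy | ⟨s, hs, hy⟩
      · exact ⟨⟨y, hl y hy⟩, hy, 1, G.one_mem, rfl⟩
      · obtain ⟨z, hz, rfl⟩ := List.mem_map.mp hy
        obtain ⟨σ, hσ, h⟩ := hG s hs
        exact ⟨⟨z, hl z hz⟩, hz, σ, hσ, h _⟩
    obtain ⟨y, hy, σ, hσ, rfl⟩ := ih _ (fun y hy => by
      obtain ⟨z, -, σ, -, rfl⟩ := key y hy
      exact (σ z).isLt) hx
    obtain ⟨z, hz, τ, hτ, h⟩ := key _ hy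
    exact ⟨z, hz, σ * τ, G.mul_mem hσ hτ, congrArg (fun q => (σ q).val) (Fin.ext h)⟩

/-! ### Certificates for cubic codes -/

/-- A block code together with the data determining its automorphism group. -/
structure Certificate extends BlockData where
  /-- An automorphism permuting the coordinates in cycles of length three. -/
  cubic : ℕ
  /-- A numbering of the coordinates for which `cubic` becomes the block shift. -/
  numbering : ℕ
  /-- Further automorphisms. -/
  perms : List ℕ
  /-- A coordinate with trivial stabilizer. -/
  base : ℕ
  /-- Representatives of the other orbits. -/
  others : List ℕ

namespace Certificate

variable (D : Certificate)

/-- Whether the given permutations are automorphisms. -/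
def autCheck : Bool :=
  (D.cubic :: D.perms).all fun s => isPerm s && D.basic.all fun x => D.words.all fun y =>
    Nat.beq (Nat.mod (weight (Nat.land (permWord s x) y)) 2) 0

/-- Whether `numbering` conjugates `cubic` to the block shift. -/
def cubicCheck : Bool :=
  isPerm D.numbering && (List.range 60).all fun p =>
    Nat.beq (permAt D.numbering (permAt D.cubic p)) (Nat.mod (Nat.add (permAt D.numbering p) 40) 60)

/-- The orbit of the base point. -/
def orbit : List ℕ := reach (D.cubic :: D.perms) 12 [D.base]

/-- Whether every coordinate lies in the orbit of `base` or of one of `others`. -/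
def orbitCheck : Bool :=
  Nat.ble D.base 59 && D.others.all (fun x => Nat.ble x 59) &&
    (List.range 60).all fun x => (D.orbit ++ reach (D.cubic :: D.perms) 12 D.others).any (Nat.beq x)

/-- Whether the invariant `profile` of the words in `l` distinguishes `base` from `others`, and
any two coordinates with respect to `base`. -/
def invariantCheck (l : List ℕ) : Bool :=
  l.all (fun z => Nat.beq (Nat.shiftRight z 60) 0) &&
    D.others.all (fun x => !Nat.beq (profileNat l x x) (profileNat l D.base D.base)) &&
      Nat.beq (distinct ((List.range 60).map (profileNat l D.base))).length 60

end Certificate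

/-! ### From certificates to cubic codes -/

theorem weightEnumerator_permute {n : ℕ} (C : LinearCode (ZMod 2) n) (σ : Equiv.Perm (Fin n)) :
    (C.permute σ).weightEnumerator = C.weightEnumerator := by
  simp only [weightEnumerator, weightCount_permute]

theorem finrank_permute {n : ℕ} (C : LinearCode (ZMod 2) n) (σ : Equiv.Perm (Fin n)) :
    Module.finrank (ZMod 2) (C.permute σ) = Module.finrank (ZMod 2) C := by
  have h : C.permute σ =
      Submodule.map ((LinearEquiv.funCongrLeft (ZMod 2) (ZMod 2) σ).symm.toLinearMap) C :=
    Submodule.comap_equiv_eq_map_symm (LinearEquiv.funCongrLeft (ZMod 2) (ZMod 2) σ) C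
  rw [h]
  exact LinearEquiv.finrank_map_eq _ C

theorem IsBlockCode.hasParams_permute {C : LinearCode (ZMod 2) (3 * 20)} (hC : IsBlockCode C)
    (σ : Equiv.Perm (Fin (3 * 20))) : (C.permute σ).HasParams 30 12 := by
  refine hasParams_of_weight ((finrank_permute C σ).trans hC.finrank) ?_ (by norm_num) ?_
  · refine ⟨(blockWord 0 + blockWord 1) ∘ σ.symm, ?_, ?_⟩
    · rw [mem_permute, Function.comp_assoc, Equiv.symm_comp_self]
      exact hC.blockWord_add_mem 0 1
    · have h := hammingNorm_add_blockWord (blockWord 0) 1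
      rw [blockCount_blockWord, hammingNorm_blockWord, if_neg (by decide)] at h
      rw [hammingNorm_comp_perm]
      omega
  · intro c hc h0
    rw [← hammingNorm_comp_perm c σ]
    refine hC.minimum _ hc fun h => h0 ?_
    have h1 := congrArg (· ∘ σ.symm) h
    rwa [Function.comp_assoc, Equiv.self_comp_symm] at h1

/-- Cubic self-dual `[60, 30, 12]` codes of Type I with weight enumerator `W₃` and automorphism
group of order `N` which arise from the cubic construction. -/
def IsCubicCode (N : ℕ) (C : LinearCode (ZMod 2) (3 * 20)) : Prop :=
  C.IsCubic ∧ C.IsTypeI ∧ C.HasParams 30 12 ∧ C.weightEnumerator = W₃ ∧ Nat.card C.autGroup = N ∧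
    ∃ (ω : F4) (C₁ : LinearCode (ZMod 2) 20) (C₂ : LinearCode F4 20),
      ω ^ 2 + ω + 1 = 0 ∧ C₁.IsTypeI ∧ C₂.IsHermitianSelfDual ∧
      (C : Set (Fin (3 * 20) → ZMod 2)) = cubicConstruction ω C₁ C₂

/-- A block code with a suitable automorphism of order three is equivalent to a cubic code. -/
theorem IsBlockCode.exists_isCubicCode {C : LinearCode (ZMod 2) (3 * 20)} (hC : IsBlockCode C)
    {σ τ : Equiv.Perm (Fin (3 * 20))} (hσ : σ ∈ C.autGroup)
    (hτ : ∀ p, τ (σ p) = blockShift (τ p)) : ∃ C', IsCubicCode (Nat.card C.autGroup) C' := by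
  have hshift : ∀ c ∈ C.permute τ, c ∘ blockShift ∈ C.permute τ := by
    intro c hc
    have h1 : (c ∘ blockShift) ∘ τ = (c ∘ τ) ∘ σ := funext fun p => congrArg c (hτ p).symm
    rw [mem_permute, h1]
    exact comp_mem_of_mem_autGroup hσ hc
  refine ⟨C.permute τ, ⟨⟨3, rfl⟩, fun c hc => ?_⟩, hC.isTypeI.permute τ, hC.hasParams_permute τ,
    (weightEnumerator_permute C τ).trans hC.weightEnumerator_eq,
    (permEquiv_permute C τ).card_autGroup, (hC.isTypeI.permute τ).exists_cubicConstruction hshift⟩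
  rw [iterate_cyclicShift]
  exact hshift c hc

namespace Certificate

variable {D : Certificate}

theorem exists_aut (hD : D.Valid) (h : D.autCheck = true) :
    ∀ s ∈ D.cubic :: D.perms, ∃ σ ∈ D.code.autGroup, ∀ p, (σ p).val = permAt s p.val := by
  intro s hs
  simp only [autCheck, List.all_eq_true, Bool.and_eq_true, Nat.beq_eq] at h
  obtain ⟨h1, h2⟩ := h s hs
  obtain ⟨σ, hσ⟩ := exists_perm_of_isPerm h1
  refine ⟨σ, mem_autGroup_of_forall fun c hc => ?_, hσ⟩
  rw [hD.code_eq_span_basic] at hc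
  change c ∈ D.code.comap (LinearMap.funLeft (ZMod 2) (ZMod 2) σ)
  refine Submodule.span_le.mpr ?_ hc
  rintro _ ⟨x, hx, rfl⟩
  change word x ∘ σ ∈ D.code
  rw [← word_permWord hσ, hD.mem_code_iff]
  intro y hy
  rw [sum_word_mul_word, ZMod.natCast_eq_zero_iff]
  exact Nat.dvd_of_mod_eq_zero (h2 x hx y hy)

/-- The automorphism group acts regularly on the orbit of the base point. -/
theorem card_autGroup (hD : D.Valid) (haut : D.autCheck = true) (horb : D.orbitCheck = true)
    (hinv : D.invariantCheck D.tenList = true) :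
    Nat.card D.code.autGroup = (distinct D.orbit).length := by
  simp only [orbitCheck, Bool.and_eq_true, List.all_eq_true, List.mem_range, List.any_eq_true,
    Nat.beq_eq, Nat.ble_eq, List.mem_append] at horb
  simp only [invariantCheck, Bool.and_eq_true, List.all_eq_true, Nat.beq_eq, Bool.not_eq_true',
    ← Bool.not_eq_true] at hinv
  obtain ⟨⟨hb, hoth⟩, hcov⟩ := horb
  obtain ⟨⟨hlt, hne⟩, hinj⟩ := hinv
  have hb' : D.base < 60 := Nat.lt_succ_of_le hb
  have hoth' : ∀ x ∈ D.others, x < 60 := fun x hx => Nat.lt_succ_of_le (hoth x hx)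
  have hlt' : ∀ z ∈ D.tenList, z < 2 ^ 60 := fun z hz => by
    have h : z >>> 60 = 0 := hlt z hz
    rw [Nat.shiftRight_eq_div_pow, Nat.div_eq_zero_iff] at h
    exact h.resolve_left (by norm_num)
  have hprof := profile_eq hlt' (nodup_distinct _) hD.tenWords_eq
  have hG := exists_aut hD haut
  let b : Fin (3 * 20) := ⟨D.base, hb'⟩
  let O : Finset (Fin (3 * 20)) := Finset.univ.filter fun x => x.val ∈ D.orbit
  have horbit : ∀ x ∈ D.orbit, ∃ σ ∈ D.code.autGroup, (σ b).val = x := by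
    intro x hx
    obtain ⟨y, hy, σ, hσ, h⟩ := exists_of_mem_reach hG _ _ (by simpa using hb') x hx
    have hyb : y = b := Fin.ext (List.mem_singleton.mp hy)
    exact ⟨σ, hσ, hyb ▸ h⟩
  have hO : O.card = (distinct D.orbit).length := by
    rw [← List.toFinset_card_of_nodup (nodup_distinct _)]
    refine Finset.card_bij (fun x _ => x.val) ?_ ?_ ?_
    · intro x hx
      exact List.mem_toFinset.mpr (mem_distinct.mpr (Finset.mem_filter.mp hx).2)
    · exact fun x _ y _ h => Fin.ext h
    · intro x hx
      have hx' := mem_distinct.mp (List.mem_toFinset.mp hx)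
      obtain ⟨σ, -, rfl⟩ := horbit x hx'
      exact ⟨σ b, Finset.mem_filter.mpr ⟨Finset.mem_univ _, hx'⟩, rfl⟩
  rw [← hO]
  refine card_eq_of_invariant _ (profile (tenWords D.code))
    (fun σ hσ x y => hD.isBlockCode.profile_autGroup hσ x y) b ?_ O ?_ ?_
  · intro x y hxy
    have h1 : ((List.range 60).map (profileNat D.tenList D.base)).Nodup := by
      refine nodup_of_length_distinct (hinj.trans ?_)
      rw [List.length_map, List.length_range]
    rw [hprof, hprof] at hxy
    exact Fin.ext (List.inj_on_of_nodup_map h1 (List.mem_range.mpr x.isLt)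
      (List.mem_range.mpr y.isLt) hxy)
  · intro x hx
    obtain ⟨σ, hσ, h⟩ := horbit x.val (Finset.mem_filter.mp hx).2
    exact ⟨σ, hσ, Fin.ext h⟩
  · intro x hx h
    obtain ⟨y, hy, hxy⟩ := hcov x.val x.isLt
    subst hxy
    rcases hy with hy | hy
    · exact hx (Finset.mem_filter.mpr ⟨Finset.mem_univ _, hy⟩)
    · obtain ⟨z, hz, σ, hσ, hσx⟩ := exists_of_mem_reach hG _ _ hoth' x.val hy
      have hσx := Fin.ext hσx
      subst hσx
      rw [hD.isBlockCode.profile_autGroup hσ, hprof, hprof] at h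
      exact hne z.val hz h

variable (D) in
/-- Whether the data certify a cubic code with automorphism group of order `N`. -/
def verify (N : ℕ) : Bool :=
  D.check && D.autCheck && D.cubicCheck && D.orbitCheck && D.invariantCheck D.tenList &&
    Nat.beq (distinct D.orbit).length N

theorem exists_isCubicCode {N : ℕ} (h : D.verify N = true) : ∃ C, IsCubicCode N C := by
  simp only [verify, Bool.and_eq_true] at h
  obtain ⟨⟨⟨⟨⟨hcheck, haut⟩, hcub⟩, horb⟩, hinv⟩, hN⟩ := h
  have hD := BlockData.valid_of_check hcheck
  simp only [cubicCheck, Bool.and_eq_true, List.all_eq_true, List.mem_range, Nat.beq_eq] at hcub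
  obtain ⟨τ, hτ⟩ := exists_perm_of_isPerm hcub.1
  obtain ⟨σ, hσ, hσs⟩ := exists_aut hD haut _ List.mem_cons_self
  rw [← Nat.eq_of_beq_eq_true hN, ← card_autGroup hD haut horb hinv]
  refine hD.isBlockCode.exists_isCubicCode hσ (τ := τ) fun p => Fin.ext ?_
  change (τ (σ p)).val = ((τ p).val + 40) % 60
  rw [hτ, hσs, hcub.2 p.val p.isLt, hτ]
  rfl

end Certificate

/-! ### Nine cubic codes -/

namespace Certificate

/-- A cubic code whose automorphism group has order 3. -/
def three : Certificate where
  gens := [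
    [0x74978c0c0000003, 0x5de14a140000005,
      0x29e18f240000009, 0x6d1480440000011],
    [0x28078c1800000c0, 0x846612280000140,
      0x3184430c0000240, 0xe4a6c3480000440],
    [0xfd80d4180003000, 0xb5d01d280005000,
      0x75d5d70c0009000, 0xfdb617480011000],
    [0x3122910c00c0000, 0x60a0d4140140000,
      0xaca157240240000, 0xd9d6c0440440000],
    [0xad73db183000000, 0xf143ca285000000,
      0x1e4890c9000000, 0xe86789491000000],
    [0xc90c9243, 0x14a14a285,
      0x24c24c309, 0x458458611],
    [0x300375b6db, 0x500519d15d,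
      0xfc000901b298146, 0xfc00110186dd0d7],
    [0xc001828029e, 0x14000f51d14a,
      0xfc024000f445446, 0xfc044001e312189],
    [0x300001878c51e, 0x500000300f6de,
      0xfc900000a31d603, 0xfd100000c75d5d1],
    [0xc000000f3cc24a, 0x1400000061400cf,
      0xd8000001418044c, 0xb800000090db6c0]]
  odd := 0x4104104b41c716
  cubic :=
    0xe7beb6e37cf5d30cb1b6fbaab2b9e9a249a55d65544d22ca2481c61440c204075c6da6584503ce34c8e28607de
  numbering :=
    0x9fb4e6e92979464e108f73e2d8e875360d0cb6caeaa687de75c6da6585d6554cf2c70bee2ca2481c61440c2040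
  perms := []
  base := 0
  others := [1, 2, 3, 4, 5, 6, 7, 8, 9, 10, 11, 36, 39, 42, 45, 48, 51, 54, 57]

theorem verify_three : three.verify 3 = true := by
  decide +kernel

/-- A cubic code whose automorphism group has order 6. -/
def six : Certificate where
  gens := [
    [0x5c5157180000003, 0x5092510c0000005,
      0x9dd498280000009, 0x89761b480000011],
    [0xb4a2466c00000c0, 0x88325e5c0000140,
      0x85d500600000240, 0xd4f498440000440],
    [0xdd4546c0003000, 0x1587465c0005000,
      0x50314c600009000, 0x854243140011000],
    [0xd175d2400c0000, 0xcc319e180140000,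
      0x845305440240000, 0xe9b152280440000],
    [0xb4518f243000000, 0x1453c0605000000,
      0x14a30f3c9000000, 0xd814c0d1000000],
    [0xdd78f3c5, 0xfc000015245d486,
      0x2546030cc, 0xfc000045e7585d4],
    [0x300079b19b, 0xfc000500f6de194,
      0xfc000900f318511, 0xfc001100a0d2517],
    [0xfc00c001225e251, 0xfc014000a31245b,
      0xfc024001860a012, 0xfc04400143d879e],
    [0xfc300001129d291, 0xfc50000002586db,
      0xfc900001e44c192, 0x11000009303506],
    [0xc000001161478f, 0xe8000000f4455db,
      0xd8000000378960a, 0x44000001e15e28c]]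
  odd := 0x4104105c08459f
  cubic :=
    0xeb9ef7db841138f30d28b209187a27a659268a18df7a0d35cb3c31beeb6caea75c6da658597515493103141002
  numbering :=
    0xee74fa99282179f71d69b619597e65478910de33f688ed74cf2c70bafb2daab34c2ca2481c61440c2a55068500
  perms := [
    0xc5100081d35cb3c31bafb2daab86389e81fa27a6592671d69b61959751549341138f30d28b209187eb9ef7db8]
  base := 0
  others := [3, 6, 8, 10, 12, 14, 16, 30, 33]

theorem verify_six : six.verify 6 = true := by
  decide +kernel

/-- A cubic code whose automorphism group has order 9. -/
def nine : Certificate where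
  gens := [
    [0xe4f48a140000003, 0xf1825e180000005,
      0x45160f6c0000009, 0x91275d300000011],
    [0xb8a1971400000c0, 0x31e0cf180000140,
      0x458609500000240, 0xcc52456c0000440],
    [0xe97492180003000, 0xe4f2490c0005000,
      0x89e617480009000, 0xd9d74a740011000],
    [0x4943091800c0000, 0x24a75b0c0140000,
      0xd926c9280240000, 0xfcf15b480440000],
    [0x5c629e0c3000000, 0x3c3794145000000,
      0x84a0cf789000000, 0x892309251000000],
    [0xc3145186, 0x1451860c3,
      0x25131b752, 0x45e50c29d],
    [0x3012289609, 0x500979b5db,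
      0x901d018486, 0xfc001101e2860cc],
    [0xc0006509489, 0x14000329b25b,
      0xfc024001e497317, 0xfc044000c3d10d1],
    [0x3000005318258, 0x50000067576d7,
      0x900000c6ca78c, 0x1100001414c0c9],
    [0xf0000001845e28a, 0xe8000001731479e,
      0xd8000000a01d78c, 0x44000000c45201b]]
  odd := 0xf81041053081419
  cubic :=
    0xe7beb6e37cf5d30cb1b6fbaab2b9e9a249a586389e81f6dd7186995575925133d140c38d24b2862070c5100081
  numbering :=
    0x9fb4e6e92979464e108f73e2d8e875360d0c7f32dec8a77125cc086ef1dab8666d158b045eb0d6a82569054a00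
  perms := [
    0xe7beb6e37cf5d32c70beeb6caea9e9a269643d140c38d55759251324b2862070c51000816dd71869986389e81f]
  base := 0
  others := [3, 6, 9, 36, 39, 42, 45, 48, 51, 54, 57]

theorem verify_nine : nine.verify 9 = true := by
  decide +kernel

/-- A cubic code whose automorphism group has order 12. -/
def twelve : Certificate where
  gens := [
    [0xb4549d300000003, 0x45d3ca0c0000005,
      0xc14612600000009, 0x9cf506480000011],
    [0x28379e6000000c0, 0x8923030c0000140,
      0xf0c6cc480000240, 0x1940ca300000440],
    [0x300257280003000, 0x18c611180005000,
      0x5113db480009000, 0x90c0c50c0011000],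
    [0x9dd75e5000c0000, 0xcc33c9300140000,
      0xd865c5140240000, 0x2927916c0440000],
    [0xb5e303483000000, 0x2975d2445000000,
      0x89b60a3c9000000, 0xf1d286611000000],
    [0xfc00000c65d15cf, 0xfc000015b254506,
      0x254312251, 0x445298443],
    [0x300379449e, 0xfc000501224c44f,
      0x900a14979b, 0x1100644f197],
    [0xc000f49d75d, 0x14001d3d278f,
      0x24001e614257, 0xfc044001751e49e],
    [0x30000121576c6, 0xfc500000a303157,
      0x90000066c329d, 0x1100001d500245],
    [0xf0000001161b246, 0xe8000000f31e61b,
      0xd8000001425d294, 0x4400000122975c5]]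
  odd := 0x4104104b55c682
  cubic :=
    0xa689e6964cf5d30cb1b6fbaab2b1440c20405d65544d28e28607de75c6da6583d140c38d24b286207efae78df6
  numbering :=
    0xb6caeaa689fb4e6e92979464e106585d65548e28607dedf6d74cf23ce34c2ca77125cc086ef1dab861440c2040
  perms := [
    0x5d65544d2aabb2fb6ecb0c73d358e28607dea689e69641440c2040efae78df61c818b24a38c35044f75c6da658,
    0x5d65544d22ca2481c64503ce34c75c6da658efae78df61440c2040a689e6964b6fbaab2bcf5d30cb18e28607de]
  base := 6
  others := [0, 1, 2, 3, 4, 5, 9]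

theorem verify_twelve : twelve.verify 12 = true := by
  decide +kernel

/-- A cubic code whose automorphism group has order 18. -/
def eighteen : Certificate where
  gens := [
    [0x6113c93c0000003, 0x2520c5140000005,
      0xb5d191600000009, 0x511518140000011],
    [0xf1b4831800000c0, 0xac6751440000140,
      0x6cc280300000240, 0x31725e0c0000440],
    [0xe45445780003000, 0x3065060c0005000,
      0x61d29d0c0009000, 0x9789280011000],
    [0x6055c63c00c0000, 0x3c66035c0140000,
      0x51b292780240000, 0x48c25d6c0440000],
    [0x88579d303000000, 0x60c61b5c5000000,
      0xb4078c749000000, 0x3145dd611000000],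
    [0xd75d2194, 0xfc000015d611780,
      0xfc000024931e0c3, 0xfc000044f2913de],
    [0xfc000301215e511, 0x500c19424a,
      0xfc00090176dd243, 0xfc0011000312489],
    [0xc000a605797, 0x14000a3c93c3,
      0xfc024001e4455db, 0x440011514489],
    [0x300001d19e6de, 0x50000140d4452,
      0xfc900000649d612, 0xfd100001275201b],
    [0xf0000000a3dd00c, 0xe8000000f5c6794,
      0x24000001474c49d, 0xb8000000c79719e]]
  odd := 0x4104105f0531c8
  cubic :=
    0xe7beb6e375d65544d2b6fbaab2bd74cf2c7086389e81f2ca2481c6a689e69643d140c38d1440c204075c6da658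
  numbering :=
    0x9fb4e6e928607de75c979464e10d74cf2c708f73e2d8eb6caeaa6834c2ca2486ef1dab866585d65541440c2040
  perms := [
    0x18720a2c94944d655769865b71d9649a9a270420050c4e36dfaef9cb1c33d7434c39140f79f823862aecaadbaf]
  base := 0
  others := [3, 12, 18]

theorem verify_eighteen : eighteen.verify 18 = true := by
  decide +kernel

/-- A cubic code whose automorphism group has order 24. -/
def twentyFour : Certificate where
  gens := [
    [0x1896d46c0000003, 0x9c32455c0000005,
      0x19b78f5c0000009, 0x486283280000011],
    [0x29460a5000000c0, 0x9cc5d8300000140,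
      0x24f3093c0000240, 0x50a254240000440],
    [0xd4a517500003000, 0x1890d8500005000,
      0x898189300009000, 0xade7926c0011000],
    [0x14a6d76000c0000, 0x19715d280140000,
      0xac349b180240000, 0x78f75b600440000],
    [0xd9724c483000000, 0x4526030c5000000,
      0xcd4146789000000, 0x6db492491000000],
    [0xfc00000c53003cf, 0xfc000014c5de25d,
      0x24c2576c3, 0x45e486140],
    [0x30186d829b, 0xfc0005011617612,
      0xfc0009006746194, 0x110140030de],
    [0xfc00c00050d83c3, 0xfc014001d75e611,
      0xfc024000c6d4458, 0xfc044001e30948c],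
    [0xfc300001b7493d2, 0x50000185d419e,
      0x900001d44551b, 0x1100000c603286],
    [0xc0000006251285, 0xe8000001e0d460a,
      0x24000000c49d19b, 0x44000001d14f0d4]]
  odd := 0x410410440487c1
  cubic :=
    0xa689e6964105083001b6fbaab2b8e28607deefae78df66dd718699d74cf2c703d140c38d2892c7188597515493
  numbering :=
    0xe78df6d746195975159fb4e6e929648e28604503ce34c7f32dec8ab2daaba2977125cc08bdb1ee6861440c2040
  perms := [
    0xebbe39db7d35cb3c3134c39140fa299a79258a382179f1c818b24a597515493b2baadbee69865c75b105083001,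
    0x5975154938a382179f2892c71881440c2040d35cb3c3144f40e30debbe39db775b71a619b6fbaab2ba689e6964,
    0xefae78df65d65544d21881ca24b8e28607dea689e696438c34f411d74cf2c7061969d6dcaacaeeb6f1440c2040]
  base := 6
  others := [0, 2, 4]

theorem verify_twentyFour : twentyFour.verify 24 = true := by
  decide +kernel

/-- A cubic code whose automorphism group has order 30. -/
def thirty : Certificate where
  gens := [
    [0x918614600000003, 0xb575ca5c0000005,
      0xb51011280000009, 0xfc5609300000011],
    [0x31e2915c00000c0, 0x89478c3c0000140,
      0x78645e180000240, 0xe5b5db480000440],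
    [0xcc9018440003000, 0x75b017300005000,
      0x745303740009000, 0xfca45e740011000],
    [0x7897941400c0000, 0xadb50a180140000,
      0xac361d280240000, 0xf458440440000],
    [0xe8f0c3143000000, 0x198145185000000,
      0x49249e009000000, 0x854609151000000],
    [0xc9785617, 0xfc000015b5065cf,
      0x25214675e, 0xfc000045274051d],
    [0xfc000300330f283, 0x5005758785,
      0xfc000901151e44c, 0x1101e4855d2],
    [0xc000c48f440, 0x14001d258300,
      0xfc0240009158789, 0xfc044001e4406d2],
    [0x3000017745298, 0xfc500000f446797,
      0x900001b5d875e, 0xfd100001e14a192],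
    [0xc000001e74c0cc, 0x14000001445d15d,
      0xd8000001275d280, 0x4400000054405cc]]
  odd := 0xf810410501d64c7
  cubic :=
    0xe7beb6e37cf5d30cb1b6fbaab2b9e9a249a586389e81f6dd7186995575925133d140c38d24b2862070c5100081
  numbering :=
    0x9fb4e6e92979464e108f73e2d8e875360d0c7f32dec8a77125cc086ef1dab8666d158b045eb0d6a82569054a00
  perms := [
    0xdb7e39ebb34e31044faecaaebed4d44965d518720928b001083105966928a67c72c34d7379f8218a361969b71d,
    0x75c6da658557592513d74cf2c703d140c38d2ca2481c686389e81fa689e6964beeb6caea0c5100081efae78df6]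
  base := 0
  others := [12]

theorem verify_thirty : thirty.verify 30 = true := by
  decide +kernel

/-- A cubic code whose automorphism group has order 48. -/
def fortyEight : Certificate where
  gens := [
    [0xe46791180000003, 0xc350c140000005,
      0x6c55066c0000009, 0x3c5014500000011],
    [0x3d11915c00000c0, 0x60c0cc600000140,
      0xe58603740000240, 0x29e257180000440],
    [0x61b780740003000, 0x5d2500300005000,
      0xcd8189000009000, 0x2546d2740011000],
    [0xcd86145c00c0000, 0x8975ca600140000,
      0x5d128a5c0240000, 0xac5300600440000],
    [0xc11289483000000, 0x5dd512245000000,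
      0xcd47460c9000000, 0x49b6ca511000000],
    [0xfc00000c6012606, 0xfc000014301b3c5,
      0x25779b19b, 0xfc000045e5006d4],
    [0x301e31874a, 0xfc000500a75745e,
      0xfc000900f300786, 0xfc00110067585cf],
    [0xc000a5ca49d, 0x1400143de251,
      0x24001d79d31d, 0x44001b7460d1],
    [0xfc300000661b485, 0xfc50000055d2246,
      0x900001d797783, 0xfd1000017483603],
    [0xc000000f6cf61d, 0x1400000174985d1,
      0xd8000000c29151b, 0xb800000123d2194]]
  odd := 0x4104105320b4d3
  cubic :=
    0xe7beb6e37cf5d30cb1b6fbaab2b9e9a249a58a18df7a071b75961a5575925133d140c38d24b2862070c5100081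
  numbering :=
    0x9fb4e6e92979464e108f73e2d8e875360d0ccdf2f278ac5d2707086ef1dab8666d158b045eb0d6a82569054a00
  perms := [
    0x4935175561c818a2c9e36dfbe7ab2aaedbaf8e18a079f6dc75865a0800450c49a49699e830d3913d0cb0c73d35,
    0xdf8dbaef95124d65d530d3913d004200414371d6d96988a385f81ec72c35cf4b2aaedbaf18720928b966928a67]
  base := 0
  others := [24, 27]

theorem verify_fortyEight : fortyEight.verify 48 = true := by
  decide +kernel

/-- A cubic code whose automorphism group has order 60. -/
def sixty : Certificate where
  gens := [
    [0x45b297300000003, 0x48f783600000005,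
      0xcca01e780000009, 0xa1b5c50c0000011],
    [0x5cc6037400000c0, 0x297785240000140,
      0x25251d740000240, 0xb4a5d73c0000440],
    [0xdd78c140003000, 0x5033c36c0005000,
      0xb57311180009000, 0x289252500011000],
    [0x18c2492400c0000, 0x51244c480140000,
      0xd4315e500240000, 0x258294280440000],
    [0x29d3c90c3000000, 0x914618245000000,
      0xd8a78f009000000, 0x1986dd151000000],
    [0xfc00000d424a457, 0xfc00001462836c5,
      0x2523dd01e, 0x449452503],
    [0x3012298318, 0xfc000501d79174c,
      0x901b31125e, 0x11011154183],
    [0xfc00c00177926c6, 0xfc014001818531b,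
      0x24000c0ca249, 0xfc044001128945b],
    [0x300000a6d2617, 0x500001b294752,
      0xfc900001814c257, 0x110000140d45db],
    [0xc00000051580c6, 0xe800000032465ca,
      0x24000001d5d2185, 0x44000001751161b]]
  odd := 0x4104105c055395
  cubic :=
    0x5d65544d2cf5d30cb124b28620771d69b619ebbe39db71440c20408a382179fbeeb6caea40f44d30ea299a7925
  numbering :=
    0x9648e28609fb4e6e9275f79a71bb2daaba29e39db7d356585d65544503ce34cc73caec2f2ca2481c61440c2040
  perms := [
    0x6d865c75a34e31044f0c1144002cf2d70d31495593517aaeaedb2f9e4968a6685f8e27a0dfbe76e3a20918b1ca]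
  base := 0
  others := []

theorem verify_sixty : sixty.verify 60 = true := by
  decide +kernel

end Certificate

end LinearCode

theorem mainTheorem2 :
    ∃ C : Fin 9 → LinearCode (ZMod 2) (3 * 20),
      (∀ i, (C i).IsCubic ∧ (C i).IsTypeI ∧ (C i).HasParams 30 12 ∧
        (C i).weightEnumerator = W₃ ∧
        Nat.card (C i).autGroup = ![3, 6, 9, 12, 18, 24, 30, 48, 60] i ∧
        ∃ (ω : LinearCode.F4) (C₁ : LinearCode (ZMod 2) 20) (C₂ : LinearCode LinearCode.F4 20),
          ω ^ 2 + ω + 1 = 0 ∧ C₁.IsTypeI ∧ C₂.IsHermitianSelfDual ∧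
          (C i : Set (Fin (3 * 20) → ZMod 2)) = LinearCode.cubicConstruction ω C₁ C₂) ∧
      (∀ i j, i ≠ j → ¬ (C i).PermEquiv (C j)) ∧
      (∀ i ∈ ({2, 4, 5, 6, 7, 8} : Finset (Fin 9)), ∀ D : LinearCode (ZMod 2) (3 * 20),
        Nat.card D.autGroup ∈ ({3, 6, 12} : Set ℕ) → ¬ (C i).PermEquiv D) := by
  have h : ∀ i : Fin 9, ∃ C,
      LinearCode.IsCubicCode (![3, 6, 9, 12, 18, 24, 30, 48, 60] i) C := by
    intro i
    fin_cases i
    exacts [LinearCode.Certificate.exists_isCubicCode LinearCode.Certificate.verify_three,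
      LinearCode.Certificate.exists_isCubicCode LinearCode.Certificate.verify_six,
      LinearCode.Certificate.exists_isCubicCode LinearCode.Certificate.verify_nine,
      LinearCode.Certificate.exists_isCubicCode LinearCode.Certificate.verify_twelve,
      LinearCode.Certificate.exists_isCubicCode LinearCode.Certificate.verify_eighteen,
      LinearCode.Certificate.exists_isCubicCode LinearCode.Certificate.verify_twentyFour,
      LinearCode.Certificate.exists_isCubicCode LinearCode.Certificate.verify_thirty,
      LinearCode.Certificate.exists_isCubicCode LinearCode.Certificate.verify_fortyEight,
      LinearCode.Certificate.exists_isCubicCode LinearCode.Certificate.verify_sixty]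
  choose C hC using h
  have hcard : ∀ i, Nat.card (C i).autGroup = ![3, 6, 9, 12, 18, 24, 30, 48, 60] i :=
    fun i => (hC i).2.2.2.2.1
  refine ⟨C, hC, fun i j hij h => ?_, fun i hi D hD h => ?_⟩
  · have h1 := h.card_autGroup
    rw [hcard, hcard] at h1
    exact hij ((by decide : Function.Injective (![3, 6, 9, 12, 18, 24, 30, 48, 60] : Fin 9 → ℕ)) h1)
  · rw [← h.card_autGroup, hcard] at hD
    simp only [Set.mem_insert_iff, Set.mem_singleton_iff] at hD
    exact (by decide : ∀ i ∈ ({2, 4, 5, 6, 7, 8} : Finset (Fin 9)),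
      ¬ ((![3, 6, 9, 12, 18, 24, 30, 48, 60] : Fin 9 → ℕ) i = 3 ∨
        (![3, 6, 9, 12, 18, 24, 30, 48, 60] : Fin 9 → ℕ) i = 6 ∨
        (![3, 6, 9, 12, 18, 24, 30, 48, 60] : Fin 9 → ℕ) i = 12)) i hi hD
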